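/- Let $\pi$ be a set of primes and $\mathbb{Z}_{\hat\pi}=\prod_{p\in\pi}\mathbb{Z}_p$. A profinite graph is a profinite space $T$ with a nonempty closed subspace $V(T)$ and continuous maps $d_0,d_1\colon T\to V(T)$ that are the identity on $V(T)$; put $E^*(T)=T/V(T)$, a profinite space pointed by the image $*$ of $V(T)$. $T$ is a pro-$\pi$ tree if the sequence of free profinite modules $$0\to \mathbb{Z}_{\hat\pi}[[(E^*(T),*)]]\xrightarrow{\,d\,}\mathbb{Z}_{\hat\pi}[[V(T)]]\xrightarrow{\,\varepsilon\,}\mathbb{Z}_{\hat\pi}\to 0,\qquad d(e)=d_1(e)-d_0(e),\quad \varepsilon(v)=1,$$ is exact. Let a profinite group $G$ act continuously on a pro-$\pi$ tree $T$ (commuting with $d_0,d_1$), and suppose that the quotient map $T\to G\backslash T$ has a continuous section $\sigma$. Write $\sigma$ also for the induced sections $G\backslash V(T)\to V(T)$ and $G\backslash E^*(T)\to E^*(T)$, and $G_y$ for the stabilizer of $y$. For a discrete $\pi$-primary $G$-module $A$ and $n\ge 0$, give $\bigsqcup_v H^n(G_{\sigma(v)},A)\to G\backslash V(T)$ and $\bigsqcup_e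 H^n(G_{\sigma(e)},A)\to G\backslash E^*(T)$ the topology generated by the images of the local sections $x\mapsto \mathrm{res}^H_{G_{\sigma(x)}}(c)$, where $H\le G$ is an open subgroup, $c\in H^n(H,A)$, and $x$ runs over the points of an open set for which $G_{\sigma(x)}\le H$. Then these are étale spaces, and a family of classes is a continuous global section if and only if it is locally of the form $x\mapsto \mathrm{res}^H_{G_{\sigma(x)}}(c)$. Let $\dot\prod_{v\in G\backslash V(T)} H^n(G_{\sigma(v)},A)$ be the group of continuous global sections of the first, and let $\dot\prod_{e\in G\backslash E^*(T)} H^n(G_{\sigma(e)},A)$ be the group of those continuous global sections of the second that vanish at the base point $*$ of $G\backslash E^*(T)$. Then there is a long exact sequence $$0\to H^0(G,A)\to\cdots\to H^n(G,A)\xrightarrow{\alpha}\dot\prod_{v\in G\backslash V(T)}H^n(G_{\sigma(v)},A)\xrightarrow{\beta}\dot\prod_{e\in G\backslash E^*(T)}H^n(G_{\sigma(e)},A)\xrightarrow{\delta}H^{n+1}(G,A)\to\cdots$$ for every discrete $\pi$-primary $G$-module $A$, natural in $A$. Here $\alpha$ is given by the restriction maps and $\beta$ is induced by $d$: if $e\neq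 *$, $\sigma(e)$ is the edge $t\in T\setminus V(T)$, $v_i$ is the orbit of $d_i(t)$, and $g_i\in G$ satisfies $g_i\sigma(v_i)=d_i(t)$ ($i=0,1$), then $\beta(s)(e)=c_{1}(s(v_1))-c_{0}(s(v_0))$, where $c_i\colon H^n(G_{\sigma(v_i)},A)\to H^n(G_{\sigma(e)},A)$ is conjugation by $g_i$, with values in $H^n(G_{d_i(t)},A)$, followed by restriction to $G_{\sigma(e)}=G_t\le G_{d_i(t)}$. -/

import Mathlib

open CategoryTheory MulAction

universe u v

/-! ## Free profinite modules over the pro-`π` integers -/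

namespace ProPi

instance factPrime {π : Set Nat.Primes} (p : π) : Fact (((p : Nat.Primes) : ℕ).Prime) :=
  ⟨(p : Nat.Primes).2⟩

/-- The ring `ℤ_π̂ = ∏_{p ∈ π} ℤ_p` of pro-`π` integers. -/
abbrev ZHat (π : Set Nat.Primes) : Type := ∀ p : π, ℤ_[((p : Nat.Primes) : ℕ)]

section FreeProfinite

variable (R : Type*) [CommRing R] (X : Type*) [TopologicalSpace X]

/-- The compatible families in `∏_S R[S]`, where `S` runs through the discrete quotients of `X`. -/
noncomputable def compatibleFamilies : Submodule R (∀ S : DiscreteQuotient X, S →₀ R) where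
  carrier := {m | ∀ (S S' : DiscreteQuotient X) (h : S ≤ S'),
    Finsupp.lmapDomain R R (DiscreteQuotient.ofLE h) (m S) = m S'}
  add_mem' ha hb S S' h := by simp only [Pi.add_apply, map_add, ha S S' h, hb S S' h]
  zero_mem' S S' h := by simp only [Pi.zero_apply, map_zero]
  smul_mem' c _ ha S S' h := by simp only [Pi.smul_apply, map_smul, ha S S' h]

/-- The free profinite module `R⟦X⟧ = lim_S R[S]` on a profinite space `X`, where `S` runs through
the discrete (finite, as `X` is compact) quotients of `X`. -/
def FreeProfinite : Type _ := compatibleFamilies R X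

noncomputable instance : AddCommGroup (FreeProfinite R X) :=
  inferInstanceAs (AddCommGroup (compatibleFamilies R X))

noncomputable instance : Module R (FreeProfinite R X) :=
  inferInstanceAs (Module R (compatibleFamilies R X))

variable {X}

/-- The component of an element of `R⟦X⟧` in `R[S]`. -/
noncomputable def component (S : DiscreteQuotient X) : FreeProfinite R X →ₗ[R] (S →₀ R) where
  toFun m := m.1 S
  map_add' _ _ := rfl
  map_smul' _ _ := rfl

/-- The canonical image of a point of `X` in `R⟦X⟧`. -/
noncomputable def dirac (x : X) : FreeProfinite R X :=
  ⟨fun S => Finsupp.single (S.proj x) 1, fun S S' h => by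
    simp [Finsupp.mapDomain_single]⟩

variable {M N : Type*} [AddCommGroup M] [Module R M] [AddCommGroup N] [Module R N]

/-- The `R`-linear extension to `R⟦X⟧` of a locally constant map `f` from `X` to an `R`-module. -/
noncomputable def extend (f : LocallyConstant X M) : FreeProfinite R X →ₗ[R] M :=
  Finsupp.linearCombination R (f.lift : f.discreteQuotient → M) ∘ₗ
    component R f.discreteQuotient

lemma extend_apply (f : LocallyConstant X M) (m : FreeProfinite R X) :
    extend R f m =
      Finsupp.linearCombination R (f.lift : f.discreteQuotient → M) (m.1 f.discreteQuotient) :=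
  rfl

lemma extend_dirac (f : LocallyConstant X M) (x : X) : extend R f (dirac R x) = f x := by
  rw [extend_apply, dirac, Finsupp.linearCombination_single, one_smul]
  rfl

/-- `extend` can be computed on any discrete quotient through which the map factors. -/
lemma extend_eq_of_le (f : LocallyConstant X M) (S : DiscreteQuotient X)
    (h : S ≤ f.discreteQuotient) (m : FreeProfinite R X) :
    extend R f m = Finsupp.linearCombination R
      ((f.lift : f.discreteQuotient → M) ∘ DiscreteQuotient.ofLE h) (m.1 S) := by
  rw [extend_apply, ← m.2 S _ h, Finsupp.lmapDomain_apply, Finsupp.linearCombination_mapDomain]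

lemma extend_map (f : LocallyConstant X M) (g : M →ₗ[R] N) (m : FreeProfinite R X) :
    extend R (f.map g) m = g (extend R f m) := by
  have h : f.discreteQuotient ≤ (f.map g).discreteQuotient := by
    intro x y hxy
    exact congrArg g hxy
  rw [extend_eq_of_le R (f.map g) _ h, extend_apply, Finsupp.apply_linearCombination]
  congr 2
  funext s
  obtain ⟨x, rfl⟩ := DiscreteQuotient.proj_surjective _ s
  rfl

/-- The augmentation `R⟦X⟧ → R`, sending every point of `X` to `1`. -/
noncomputable def augmentation : FreeProfinite R X →ₗ[R] R :=
  extend R (LocallyConstant.const X 1)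

/-- The free profinite module `R⟦(X, x₀)⟧` on a pointed profinite space: the quotient of `R⟦X⟧`
obtained by setting the base point to zero. -/
abbrev FreeProfinitePointed (x₀ : X) : Type _ :=
  FreeProfinite R X ⧸ Submodule.span R {dirac R x₀}

end FreeProfinite

/-! ## Profinite graphs and pro-`π` trees -/

/-- A profinite graph on the space `T` (which is to be a profinite space): a nonempty closed
subset `V(T)` of vertices and continuous maps `d₀, d₁ : T → V(T)` that are the identity on
`V(T)`. -/
structure ProfiniteGraph (T : Type*) [TopologicalSpace T] where
  verts : Set T
  isClosed_verts : IsClosed verts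
  nonempty_verts : verts.Nonempty
  d₀ : C(T, verts)
  d₁ : C(T, verts)
  d₀_vert : ∀ v : verts, d₀ v = v
  d₁_vert : ∀ v : verts, d₁ v = v

namespace ProfiniteGraph

variable {T : Type*} [TopologicalSpace T] (Γ : ProfiniteGraph T)

/-- The vertex space `V(T)`. -/
abbrev V : Type _ := Γ.verts

/-- The relation on `T` that collapses `V(T)` to a point. -/
def edgeSetoid : Setoid T where
  r s t := s = t ∨ (s ∈ Γ.verts ∧ t ∈ Γ.verts)
  iseqv :=
    { refl := fun _ => Or.inl rfl
      symm := by
        rintro _ _ (rfl | ⟨h, h'⟩)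
        exacts [Or.inl rfl, Or.inr ⟨h', h⟩]
      trans := by
        rintro _ _ _ (rfl | ⟨h, h'⟩) (rfl | ⟨k, k'⟩)
        exacts [Or.inl rfl, Or.inr ⟨k, k'⟩, Or.inr ⟨h, h'⟩, Or.inr ⟨h, k'⟩] }

/-- The pointed edge space `E*(T) = T / V(T)`, with the quotient topology. -/
abbrev E : Type _ := Quotient Γ.edgeSetoid

/-- The quotient map `T → E*(T)`. -/
def toE (t : T) : Γ.E := Quotient.mk Γ.edgeSetoid t

lemma toE_eq_of_mem {s t : T} (hs : s ∈ Γ.verts) (ht : t ∈ Γ.verts) : Γ.toE s = Γ.toE t :=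
  Quotient.sound (Or.inr ⟨hs, ht⟩)

/-- The base point `*` of `E*(T)`, the common image of all vertices. -/
noncomputable def basePoint : Γ.E := Γ.toE Γ.nonempty_verts.some

lemma toE_eq_basePoint {t : T} (ht : t ∈ Γ.verts) : Γ.toE t = Γ.basePoint :=
  Γ.toE_eq_of_mem ht Γ.nonempty_verts.some_mem

section Boundary

variable (R : Type*) [CommRing R]

/-- The map `E*(T) → R[S]`, `e ↦ [d₁ e] - [d₀ e]`, for a discrete quotient `S` of `V(T)`. -/
noncomputable def boundaryFun (S : DiscreteQuotient Γ.V) : Γ.E → (S →₀ R) :=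
  Quotient.lift
    (fun t => Finsupp.single (S.proj (Γ.d₁ t)) 1 - Finsupp.single (S.proj (Γ.d₀ t)) 1) (by
      rintro s t (rfl | ⟨hs, ht⟩)
      · rfl
      · rw [Γ.d₀_vert ⟨s, hs⟩, Γ.d₁_vert ⟨s, hs⟩, Γ.d₀_vert ⟨t, ht⟩, Γ.d₁_vert ⟨t, ht⟩,
          sub_self, sub_self])

lemma isLocallyConstant_boundaryFun (S : DiscreteQuotient Γ.V) :
    IsLocallyConstant (Γ.boundaryFun R S) := by
  intro s
  refine isOpen_coinduced.2 ?_
  have h₁ : IsLocallyConstant (fun t => S.proj (Γ.d₁ t)) :=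
    S.proj_isLocallyConstant.comp_continuous Γ.d₁.continuous
  have h₀ : IsLocallyConstant (fun t => S.proj (Γ.d₀ t)) :=
    S.proj_isLocallyConstant.comp_continuous Γ.d₀.continuous
  exact (h₁.comp₂ h₀ fun a b =>
    (Finsupp.single a (1 : R) - Finsupp.single b (1 : R) : S →₀ R)) s

/-- `boundaryFun` as a locally constant map. -/
noncomputable def boundaryLC (S : DiscreteQuotient Γ.V) : LocallyConstant Γ.E (S →₀ R) :=
  ⟨Γ.boundaryFun R S, Γ.isLocallyConstant_boundaryFun R S⟩

/-- The `R`-linear map `R⟦E*(T)⟧ → R⟦V(T)⟧` extending `e ↦ d₁ e - d₀ e`. -/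
noncomputable def boundaryAux : FreeProfinite R Γ.E →ₗ[R] FreeProfinite R Γ.V :=
  LinearMap.codRestrict (compatibleFamilies R Γ.V)
    (LinearMap.pi fun S => extend R (Γ.boundaryLC R S)) (by
    intro m S S' h
    simp only [LinearMap.pi_apply]
    rw [← extend_map]
    congr 2
    ext1 e
    induction e using Quotient.inductionOn with
    | _ t => simp [boundaryLC, boundaryFun, Finsupp.mapDomain_single, Finsupp.mapDomain_sub])

/-- The boundary map `d : R⟦(E*(T), *)⟧ → R⟦V(T)⟧`, `d(e) = d₁ e - d₀ e`, `d(*) = 0`. -/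
noncomputable def boundary : FreeProfinitePointed R Γ.basePoint →ₗ[R] FreeProfinite R Γ.V :=
  Submodule.liftQ _ (Γ.boundaryAux R) (by
    rw [Submodule.span_singleton_le_iff_mem, LinearMap.mem_ker]
    refine Subtype.ext (funext fun S => ?_)
    refine (extend_dirac R (Γ.boundaryLC R S) Γ.basePoint).trans ?_
    have h := Γ.nonempty_verts.some_mem
    change Finsupp.single (S.proj (Γ.d₁ _)) (1 : R) - Finsupp.single (S.proj (Γ.d₀ _)) 1 = 0
    rw [Γ.d₁_vert ⟨_, h⟩, Γ.d₀_vert ⟨_, h⟩, sub_self])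

end Boundary

/-- A profinite graph is a pro-`π` tree if
`0 → ℤ_π̂⟦(E*(T), *)⟧ → ℤ_π̂⟦V(T)⟧ → ℤ_π̂ → 0` is exact. -/
def IsProTree (π : Set Nat.Primes) : Prop :=
  Function.Injective (Γ.boundary (ZHat π)) ∧
  Function.Exact (Γ.boundary (ZHat π)) (augmentation (ZHat π) (X := Γ.V)) ∧
  Function.Surjective (augmentation (ZHat π) (X := Γ.V))

variable (G : Type*) [Group G] [MulAction G T]

/-- The action of `G` on `T` is an action by graph automorphisms (it commutes with `d₀` and `d₁`,
and therefore preserves `V(T)`). -/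
class GraphAction : Prop where
  smul_d₀ : ∀ (g : G) (t : T), (Γ.d₀ (g • t) : T) = g • (Γ.d₀ t : T)
  smul_d₁ : ∀ (g : G) (t : T), (Γ.d₁ (g • t) : T) = g • (Γ.d₁ t : T)

variable [Γ.GraphAction G]

variable {G} in
lemma smul_mem_verts (g : G) {t : T} (ht : t ∈ Γ.verts) : g • t ∈ Γ.verts := by
  have h := GraphAction.smul_d₀ (Γ := Γ) g t
  rw [Γ.d₀_vert ⟨t, ht⟩] at h
  exact h ▸ (Γ.d₀ (g • t)).2

/-- The induced action on `V(T)`. -/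
instance instMulActionV : MulAction G Γ.V where
  smul g v := ⟨g • (v : T), Γ.smul_mem_verts g v.2⟩
  one_smul v := Subtype.ext (one_smul G (v : T))
  mul_smul g h v := Subtype.ext (mul_smul g h (v : T))

/-- The induced action on `E*(T)`. -/
instance instMulActionE : MulAction G Γ.E where
  smul g := Quotient.map (fun t => g • t) (by
    rintro s t (rfl | ⟨hs, ht⟩)
    · exact Or.inl rfl
    · exact Or.inr ⟨Γ.smul_mem_verts g hs, Γ.smul_mem_verts g ht⟩)
  one_smul e := by
    induction e using Quotient.inductionOn with
    | _ t => exact congrArg Γ.toE (one_smul G t)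
  mul_smul g h e := by
    induction e using Quotient.inductionOn with
    | _ t => exact congrArg Γ.toE (mul_smul g h t)

end ProfiniteGraph

/-! ## Orbit spaces and continuous sections -/

/-- The orbit space `G \ Y`, with the quotient topology. -/
abbrev OrbitSpace (G Y : Type*) [Group G] [MulAction G Y] : Type _ := Quotient (orbitRel G Y)

/-- The quotient map `Y → G \ Y`. -/
def orbitMk (G : Type*) {Y : Type*} [Group G] [MulAction G Y] (y : Y) : OrbitSpace G Y :=
  Quotient.mk (orbitRel G Y) y

/-- A continuous section `G \ Y → Y` of the quotient map `Y → G \ Y`. -/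
structure OrbitSection (G Y : Type*) [Group G] [MulAction G Y] [TopologicalSpace Y] extends
    C(OrbitSpace G Y, Y) where
  isSection : ∀ x, orbitMk G (toFun x) = x

namespace OrbitSection

variable {G Y : Type*} [Group G] [MulAction G Y] [TopologicalSpace Y]

instance : CoeFun (OrbitSection G Y) (fun _ => OrbitSpace G Y → Y) := ⟨fun σ => σ.toFun⟩

lemma exists_smul (σ : OrbitSection G Y) (y : Y) : ∃ g : G, g • y = σ (orbitMk G y) :=
  Quotient.exact (σ.isSection (orbitMk G y))

end OrbitSection

namespace ProfiniteGraph

variable {G T : Type*} [TopologicalSpace T] (Γ : ProfiniteGraph T) [Group G] [MulAction G T]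
  [Γ.GraphAction G] (σ : OrbitSection G T)

lemma section_mem_verts {t : T} (ht : t ∈ Γ.verts) : σ (orbitMk G t) ∈ Γ.verts := by
  obtain ⟨g, hg⟩ := σ.exists_smul t
  exact hg ▸ Γ.smul_mem_verts g ht

/-- The section `G \ V(T) → V(T)` obtained by restricting a section `G \ T → T`. -/
def vertexSection : OrbitSection G Γ.V where
  toFun := Quotient.lift (fun v : Γ.V => (⟨σ (orbitMk G (v : T)), Γ.section_mem_verts σ v.2⟩ : Γ.V))
    (by
      rintro v w ⟨g, hg⟩
      exact Subtype.ext (congrArg σ.toFun (Quotient.sound ⟨g, congrArg Subtype.val hg⟩)))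
  continuous_toFun := Continuous.quotient_lift
    (Continuous.subtype_mk (σ.continuous_toFun.comp
      (continuous_quotient_mk'.comp continuous_subtype_val)) _) _
  isSection x := by
    induction x using Quotient.inductionOn with
    | _ v =>
      obtain ⟨g, hg⟩ := σ.exists_smul (v : T)
      exact Quotient.sound ⟨g, Subtype.ext hg⟩

/-- The section `G \ E*(T) → E*(T)` induced by a section `G \ T → T`. -/
def edgeSection : OrbitSection G Γ.E where
  toFun := Quotient.lift (Quotient.lift (fun t : T => Γ.toE (σ (orbitMk G t)))
      (by
        rintro s t (rfl | ⟨hs, ht⟩)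
        · rfl
        · exact Γ.toE_eq_of_mem (Γ.section_mem_verts σ hs) (Γ.section_mem_verts σ ht)))
    (by
      intro e f h
      induction e using Quotient.inductionOn with
      | _ s =>
        induction f using Quotient.inductionOn with
        | _ t =>
          obtain ⟨g, hg⟩ := h
          rcases Quotient.exact hg with h | ⟨hs, ht⟩
          · exact congrArg (fun x => Γ.toE (σ x)) (Quotient.sound ⟨g, h⟩)
          · have ht' : t ∈ Γ.verts := by
              have := Γ.smul_mem_verts g⁻¹ hs
              rwa [inv_smul_smul] at this
            exact Γ.toE_eq_of_mem (Γ.section_mem_verts σ ht) (Γ.section_mem_verts σ ht'))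
  continuous_toFun := Continuous.quotient_lift (Continuous.quotient_lift
    (continuous_quotient_mk'.comp (σ.continuous_toFun.comp continuous_quotient_mk')) _) _
  isSection x := by
    induction x using Quotient.inductionOn with
    | _ e =>
      induction e using Quotient.inductionOn with
      | _ t =>
        obtain ⟨g, hg⟩ := σ.exists_smul t
        exact Quotient.sound ⟨g, congrArg Γ.toE hg⟩

end ProfiniteGraph

/-! ## Cohomology of a continuously indexed family of subgroups -/

section Cohomology

variable {k : Type*} [Ring k] [TopologicalSpace k]
  {G : Type u} [Group G] [TopologicalSpace G] [IsTopologicalGroup G]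

/-- `A` is a discrete `π`-primary `G`-module: the topology is discrete, `G` acts continuously, and
every element is killed by a positive integer all of whose prime factors lie in `π`. -/
structure IsDiscretePrimary (π : Set Nat.Primes) (A : TopRep.{u} k G) : Prop where
  discrete : DiscreteTopology A
  continuous_action : Continuous fun x : G × A => A.ρ x.1 x.2
  primary : ∀ a : A, ∃ m : ℕ, 0 < m ∧ m • a = 0 ∧ ∀ p : Nat.Primes, (p : ℕ) ∣ m → p ∈ π

/-- The continuous cohomology `Hⁿ(K, A)` of a subgroup `K` of `G` with coefficients in a
`G`-module `A`. -/
noncomputable abbrev subgroupH (n : ℕ) (K : Subgroup G) (A : TopRep.{u} k G) : TopModuleCat k :=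
  continuousCohomology n (TopRep.res K.subtype A)

/-- The inclusion of a subgroup as a continuous homomorphism. -/
def inclG (K : Subgroup G) : K →ₜ* G := ⟨K.subtype, continuous_subtype_val⟩

/-- For `g⁻¹ L g ≤ K`, the continuous homomorphism `L → K`, `l ↦ g⁻¹ l g`. -/
def conjHom (g : G) {K L : Subgroup G} (h : ∀ l ∈ L, g⁻¹ * l * g ∈ K) : L →ₜ* K where
  toFun l := ⟨g⁻¹ * l * g, h l l.2⟩
  map_one' := Subtype.ext (by simp)
  map_mul' a b := Subtype.ext (by simp [mul_assoc])
  continuous_toFun := by fun_prop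

/-- The restriction map `Hⁿ(G, A) → Hⁿ(K, A)`. -/
noncomputable def resG (n : ℕ) (K : Subgroup G) (A : TopRep.{u} k G) :
    continuousCohomology n A ⟶ subgroupH n K A :=
  ContinuousCohomology.map (inclG K) (𝟙 (TopRep.res K.subtype A)) n

/-- Multiplication by `g` on `A`, as an `L`-equivariant map when `L` acts on the source through
`l ↦ g⁻¹ l g`. -/
def conjRep (g : G) {K L : Subgroup G} (h : ∀ l ∈ L, g⁻¹ * l * g ∈ K) (A : TopRep.{u} k G) :
    TopRep.res (conjHom g h : L →* K) (TopRep.res K.subtype A) ⟶ TopRep.res L.subtype A :=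
  TopRep.ofHom
    { toContinuousLinearMap := A.ρ g
      isIntertwining' := fun l => by
        change A.ρ g * A.ρ (g⁻¹ * l * g) = A.ρ l * A.ρ g
        rw [← map_mul, ← map_mul]
        congr 1
        group }

/-- For `g⁻¹ L g ≤ K`, the map `Hⁿ(K, A) → Hⁿ(L, A)` induced by `l ↦ g⁻¹ l g` and `a ↦ g a`, that
is, conjugation `Hⁿ(K, A) ≅ Hⁿ(g K g⁻¹, A)` followed by restriction to `L`. -/
noncomputable def conjRes (n : ℕ) (g : G) {K L : Subgroup G} (h : ∀ l ∈ L, g⁻¹ * l * g ∈ K)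
    (A : TopRep.{u} k G) : subgroupH n K A ⟶ subgroupH n L A :=
  ContinuousCohomology.map (conjHom g h) (conjRep g h A) n

/-- The restriction map `Hⁿ(K, A) → Hⁿ(L, A)` for `L ≤ K`. -/
noncomputable def resK (n : ℕ) {K L : Subgroup G} (h : L ≤ K) (A : TopRep.{u} k G) :
    subgroupH n K A ⟶ subgroupH n L A :=
  ContinuousCohomology.map (⟨Subgroup.inclusion h, continuous_inclusion h⟩ : L →ₜ* K)
    (𝟙 (TopRep.res L.subtype A)) n

/-- The map `Hⁿ(K, A) → Hⁿ(K, B)` induced by a morphism `A ⟶ B` of `G`-modules. -/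
noncomputable def coeffMap (n : ℕ) (K : Subgroup G) {A B : TopRep.{u} k G} (f : A ⟶ B) :
    subgroupH n K A ⟶ subgroupH n K B :=
  ContinuousCohomology.map (ContinuousMonoidHom.id K) ((TopRep.resFunctor K.subtype).map f) n

/-- The map `Hⁿ(G, A) → Hⁿ(G, B)` induced by a morphism `A ⟶ B` of `G`-modules. -/
noncomputable def coeffMapG (n : ℕ) {A B : TopRep.{u} k G} (f : A ⟶ B) :
    continuousCohomology n A ⟶ continuousCohomology n B :=
  ContinuousCohomology.map (ContinuousMonoidHom.id G) f n

lemma resK_trans (n : ℕ) {K L M : Subgroup G} (h : L ≤ K) (h' : M ≤ L) (A : TopRep.{u} k G) :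
    resK n h A ≫ resK n h' A = resK n (h'.trans h) A :=
  (ContinuousCohomology.map_comp (X := TopRep.res K.subtype A) (Y := TopRep.res L.subtype A)
    (Z := TopRep.res M.subtype A)
    (⟨Subgroup.inclusion h, continuous_inclusion h⟩ : L →ₜ* K)
    (⟨Subgroup.inclusion h', continuous_inclusion h'⟩ : M →ₜ* L) (𝟙 (TopRep.res L.subtype A))
    (𝟙 (TopRep.res M.subtype A)) n).symm

lemma resK_coeffMap (n : ℕ) {K L : Subgroup G} (h : L ≤ K) {A B : TopRep.{u} k G} (f : A ⟶ B) :
    resK n h A ≫ coeffMap n L f = coeffMap n K f ≫ resK n h B :=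
  (ContinuousCohomology.map_comp (X := TopRep.res K.subtype A) (Y := TopRep.res L.subtype A)
    (Z := TopRep.res L.subtype B)
    (⟨Subgroup.inclusion h, continuous_inclusion h⟩ : L →ₜ* K)
    (ContinuousMonoidHom.id L) (𝟙 (TopRep.res L.subtype A))
    ((TopRep.resFunctor L.subtype).map f) n).symm.trans
  (ContinuousCohomology.map_comp (X := TopRep.res K.subtype A) (Y := TopRep.res K.subtype B)
    (Z := TopRep.res L.subtype B) (ContinuousMonoidHom.id K)
    (⟨Subgroup.inclusion h, continuous_inclusion h⟩ : L →ₜ* K)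
    ((TopRep.resFunctor K.subtype).map f) (𝟙 (TopRep.res L.subtype B)) n)

variable {X : Type*} [TopologicalSpace X] (K : X → Subgroup G) (n : ℕ) (A : TopRep.{u} k G)

/-- The total space `⨆_x Hⁿ(K_x, A)` of the family of cohomology groups of subgroups `K_x`. -/
def EtaleH : Type _ := Σ x, subgroupH n (K x) A

/-- The projection of the total space to the base. -/
def EtaleH.proj (a : EtaleH K n A) : X := a.1

/-- The set-theoretic section of the total space given by a family of cohomology classes. -/
def EtaleH.ofFamily (s : ∀ x, subgroupH n (K x) A) : X → EtaleH K n A := fun x => ⟨x, s x⟩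

/-- The image of the local section `x ↦ res c` for a class `c ∈ Hⁿ(H, A)`; it is defined at the
points `x` of `U` with `K_x ≤ H`. -/
def EtaleH.basicSet (H : Subgroup G) (c : subgroupH n H A) (U : Set X) : Set (EtaleH K n A) :=
  {a | a.1 ∈ U ∧ ∃ h : K a.1 ≤ H, (resK n h A).hom c = a.2}

/-- The étale topology on the total space: it is generated by the images of the local sections
given by restricting classes in `Hⁿ(H, A)`, for `H` an open subgroup of `G`. -/
instance : TopologicalSpace (EtaleH K n A) :=
  TopologicalSpace.generateFrom
    {W | ∃ (H : Subgroup G) (c : subgroupH n H A) (U : Set X),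
      IsOpen (H : Set G) ∧ IsOpen U ∧ W = EtaleH.basicSet K n A H c U}

/-- The continuous product `∏̇_x Hⁿ(K_x, A)`: the families that are locally given by restricting a
class in `Hⁿ(H, A)` for an open subgroup `H`. -/
noncomputable def contProd : AddSubgroup (∀ x, subgroupH n (K x) A) where
  carrier := {s | ∀ x, ∃ (H : Subgroup G) (c : subgroupH n H A) (U : Set X),
    IsOpen (H : Set G) ∧ IsOpen U ∧ x ∈ U ∧
      ∀ y ∈ U, ∃ h : K y ≤ H, s y = (resK n h A).hom c}
  add_mem' {s t} hs ht x := by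
    obtain ⟨H, c, U, hH, hU, hx, hc⟩ := hs x
    obtain ⟨H', c', U', hH', hU', hx', hc'⟩ := ht x
    refine ⟨H ⊓ H', (resK n inf_le_left A).hom c + (resK n inf_le_right A).hom c', U ∩ U',
      hH.inter hH', hU.inter hU', ⟨hx, hx'⟩, fun y hy => ?_⟩
    obtain ⟨h, e⟩ := hc y hy.1
    obtain ⟨h', e'⟩ := hc' y hy.2
    refine ⟨le_inf h h', ?_⟩
    rw [map_add, Pi.add_apply, e, e', ← resK_trans n inf_le_left (le_inf h h'),
      ← resK_trans n inf_le_right (le_inf h h')]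
    rfl
  zero_mem' x := ⟨⊤, 0, Set.univ, isOpen_univ, isOpen_univ, trivial,
    fun y _ => ⟨le_top, (map_zero _).symm⟩⟩
  neg_mem' {s} hs x := by
    obtain ⟨H, c, U, hH, hU, hx, hc⟩ := hs x
    refine ⟨H, -c, U, hH, hU, hx, fun y hy => ?_⟩
    obtain ⟨h, e⟩ := hc y hy
    exact ⟨h, by rw [map_neg, Pi.neg_apply, e]⟩

/-- The continuous product over a pointed base `(X, x₀)`: the sections that vanish at `x₀`. -/
noncomputable def contProdPointed (x₀ : X) : AddSubgroup (∀ x, subgroupH n (K x) A) :=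
  contProd K n A ⊓ (Pi.evalAddMonoidHom (fun x => subgroupH n (K x) A) x₀).ker

variable {A} in
/-- The map of continuous products induced by a morphism `A ⟶ B` of `G`-modules. -/
noncomputable def contProdMap {B : TopRep.{u} k G} (f : A ⟶ B) :
    contProd K n A →+ contProd K n B where
  toFun s := ⟨fun x => (coeffMap n (K x) f).hom (s.1 x), fun x => by
    obtain ⟨H, c, U, hH, hU, hx, hc⟩ := s.2 x
    refine ⟨H, (coeffMap n H f).hom c, U, hH, hU, hx, fun y hy => ?_⟩
    obtain ⟨h, e⟩ := hc y hy
    refine ⟨h, ?_⟩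
    dsimp only
    rw [e]
    exact congr($(resK_coeffMap n h f).hom c)⟩
  map_zero' := Subtype.ext (funext fun _ => map_zero _)
  map_add' _ _ := Subtype.ext (funext fun _ => map_add _ _ _)

variable {A} in
/-- The map of pointed continuous products induced by a morphism `A ⟶ B` of `G`-modules. -/
noncomputable def contProdPointedMap (x₀ : X) {B : TopRep.{u} k G} (f : A ⟶ B) :
    contProdPointed K n A x₀ →+ contProdPointed K n B x₀ where
  toFun s := ⟨(contProdMap K n f ⟨s.1, s.2.1⟩).1, (contProdMap K n f ⟨s.1, s.2.1⟩).2, by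
    change (coeffMap n (K x₀) f).hom (s.1 x₀) = 0
    rw [show s.1 x₀ = 0 from s.2.2, map_zero]⟩
  map_zero' := Subtype.ext (funext fun _ => map_zero _)
  map_add' _ _ := Subtype.ext (funext fun _ => map_add _ _ _)

end Cohomology

/-! ## The terms of the sequence -/

section Terms

variable {G : Type u} [Group G] {T : Type*} [TopologicalSpace T] [MulAction G T]
  (Γ : ProfiniteGraph T) [Γ.GraphAction G] (σ : OrbitSection G T)

/-- The stabilizer `G_{σ(v)}`, for `v ∈ G \ V(T)`. -/
def vertexStab (v : OrbitSpace G Γ.V) : Subgroup G := stabilizer G (Γ.vertexSection σ v)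

/-- The stabilizer `G_{σ(e)}`, for `e ∈ G \ E*(T)`. -/
def edgeStab (e : OrbitSpace G Γ.E) : Subgroup G := stabilizer G (Γ.edgeSection σ e)

variable (G) in
/-- The base point of `G \ E*(T)`. -/
noncomputable def orbitBasePoint : OrbitSpace G Γ.E := orbitMk G Γ.basePoint

variable [TopologicalSpace G] [IsTopologicalGroup G] (n : ℕ) (A : TopRep.{u} ℤ G)

/-- `∏̇_{v ∈ G \ V(T)} Hⁿ(G_{σ(v)}, A)`. -/
noncomputable abbrev VertexProd : AddSubgroup (∀ v, subgroupH n (vertexStab Γ σ v) A) :=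
  contProd (vertexStab Γ σ) n A

/-- `∏̇_{e ∈ G \ E*(T)} Hⁿ(G_{σ(e)}, A)`, the product over the pointed space `G \ E*(T)`. -/
noncomputable abbrev EdgeProd : AddSubgroup (∀ e, subgroupH n (edgeStab Γ σ e) A) :=
  contProdPointed (edgeStab Γ σ) n A (orbitBasePoint G Γ)

end Terms

end ProPi

/-!
The sequence is the long exact cohomology sequence of a short exact sequence of cochain complexes.
Let `X n` be the standard resolution `A`, `C(G, A)`, `C(G, C(G, A))`, … of `A` by discrete
`G`-modules. For a profinite `G`-space `Y`, the locally constant equivariant functions `Y → X n`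
form a complex in `n`. The inclusion of the constant functions and the map
`Φ ↦ (e ↦ Φ (d₁ e) - Φ (d₀ e))` give, for every `n ≥ 1`, a short exact sequence

`0 → (X n)^G → Map_G(V(T), X n) → Map_G((E*(T), *), X n) → 0`.

*Exactness.* For a `π`-primary discrete group `B`, the tree property gives the exactness of
`0 → B → Map(V(T), B) → Map((E*(T), *), B) → 0`, where `Map` denotes locally constant functions
(`IsProTree.eq_of_coboundary_eq_zero`, `IsProTree.exists_coboundary_eq`): a locally constant
function has finitely many values, so that it takes values in a module of finite exponent over the
pro-`π` integers and extends to the free profinite modules of the tree. The equivariant sequence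
then stays exact on the right because the modules `X (n + 1) = C(G, X n)` are coinduced
(`edgeDifferenceHom_surjective`).

*Cohomology of the terms.* The complex of invariants, with `(X (n + 1))^G` in degree `n`, computes
`Hⁿ(G, A)` by definition of continuous cohomology (`groupPresentation`). If `G \ Y` has a continuous
section `σ`, an equivariant function on `Y` amounts to a locally constant function on `G \ Y` that
sends `x` to an element of `X n` fixed by `G_{σ x}`. For a closed subgroup `K` of `G` the complex of
`K`-invariants in `X n` computes `Hⁿ(K, A)` (`clsK_surjective`, `clsK_eq_zero_iff`); this is shown
by pulling cochains back along continuous maps `G → K` that are `K`-equivariant modulo an open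
normal subgroup. A class of `Hⁿ(K, A)` is therefore represented by a cocycle on all of `G`, which is
invariant under an open subgroup containing `K`. Together with the semicontinuity of the stabilizers
`G_{σ x}` this shows that the projection of the étale space is a local homeomorphism, that its
continuous sections form the continuous product (`isLocalHomeomorph_etaleH_proj`,
`mem_contProd_iff_continuous`), and that the continuous product is the cohomology of the complex of
equivariant functions (`orbitPresentation`, `pointedPresentation`).

The formulas for the maps are read off on cocycles. The one for the map to the product over the
edges uses that conjugation by `g` sends the class of a cocycle `F` to the class of `g • F`
(`conjRes_clsK`), which holds because right translation by `g` is homotopic to the identity on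
cochains.
-/

namespace ProPi

section Presentation

/-! ### Cohomology classes of cocycles -/

variable {k : Type*} [Ring k] [TopologicalSpace k]

/-- The cycles of a complex of topological modules, as the kernel of the differential. -/
noncomputable def cyclesIsoKer (C : CochainComplex (TopModuleCat.{v} k) ℕ) (n : ℕ) :
    C.cycles n ≅ TopModuleCat.ker (C.d n (n + 1)) :=
  Limits.KernelFork.mapIsoOfIsLimit (C.cyclesIsKernel n (n + 1) (by simp))
    (TopModuleCat.isLimitKer _) (Iso.refl _)

lemma cyclesIsoKer_inv_iCycles (C : CochainComplex (TopModuleCat.{v} k) ℕ) (n : ℕ) :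
    (cyclesIsoKer C n).inv ≫ C.iCycles n = TopModuleCat.kerι (C.d n (n + 1)) := by
  rw [Iso.inv_comp_eq]
  exact ((Limits.KernelFork.mapOfIsLimit_ι (Limits.KernelFork.ofι (C.iCycles n) _)
    (TopModuleCat.isLimitKer (C.d n (n + 1))) (𝟙 (Arrow.mk (C.d n (n + 1))))).trans
      (Category.comp_id _)).symm

lemma iCycles_injective (C : CochainComplex (TopModuleCat.{v} k) ℕ) (n : ℕ) :
    Function.Injective (C.iCycles n).hom := by
  have h : C.iCycles n = (cyclesIsoKer C n).hom ≫ TopModuleCat.kerι (C.d n (n + 1)) := by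
    rw [← cyclesIsoKer_inv_iCycles, Iso.hom_inv_id_assoc]
  intro x y hxy
  rw [h] at hxy
  have h2 : (cyclesIsoKer C n).hom.hom x = (cyclesIsoKer C n).hom.hom y :=
    Subtype.val_injective hxy
  have h3 := congrArg (cyclesIsoKer C n).inv.hom h2
  change ((cyclesIsoKer C n).hom ≫ (cyclesIsoKer C n).inv).hom x =
    ((cyclesIsoKer C n).hom ≫ (cyclesIsoKer C n).inv).hom y at h3
  rw [Iso.hom_inv_id] at h3
  exact h3

/-- Up to isomorphism, homology is the quotient of the cycles by the boundaries. -/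
lemma exists_homologyIso_coker (C : CochainComplex (TopModuleCat.{v} k) ℕ) {i n : ℕ}
    (hi : (ComplexShape.up ℕ).prev n = i) :
    ∃ e : C.homology n ≅ TopModuleCat.coker (C.toCycles i n),
      C.homologyπ n ≫ e.hom = TopModuleCat.cokerπ (C.toCycles i n) :=
  ⟨(C.homologyIsCokernel i n hi).coconePointUniqueUpToIso (TopModuleCat.isColimitCoker _),
    (C.homologyIsCokernel i n hi).comp_coconePointUniqueUpToIso_hom
      (TopModuleCat.isColimitCoker _) Limits.WalkingParallelPair.one⟩

lemma homologyπ_surjective (C : CochainComplex (TopModuleCat.{v} k) ℕ) (n : ℕ) :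
    Function.Surjective (C.homologyπ n).hom := by
  obtain ⟨e, he⟩ := exists_homologyIso_coker C (n := n) rfl
  intro x
  obtain ⟨y, hy⟩ := TopModuleCat.cokerπ_surjective _ (e.hom.hom x)
  refine ⟨y, ?_⟩
  rw [← he] at hy
  have h3 := congrArg e.inv.hom hy
  change (C.homologyπ n ≫ e.hom ≫ e.inv).hom y = (e.hom ≫ e.inv).hom x at h3
  rw [Iso.hom_inv_id, Category.comp_id] at h3
  exact h3

lemma homologyπ_eq_zero_iff (C : CochainComplex (TopModuleCat.{v} k) ℕ) {i n : ℕ}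
    (hi : (ComplexShape.up ℕ).prev n = i) (z : C.cycles n) :
    (C.homologyπ n).hom z = 0 ↔ ∃ y, (C.d i n).hom y = (C.iCycles n).hom z := by
  obtain ⟨e, he⟩ := exists_homologyIso_coker C hi
  have hd (y) : (C.d i n).hom y = (C.iCycles n).hom ((C.toCycles i n).hom y) := by
    rw [← C.toCycles_i]
    rfl
  constructor
  · intro hz
    have h : (TopModuleCat.cokerπ (C.toCycles i n)).hom z = 0 := by
      rw [← he]
      change e.hom.hom ((C.homologyπ n).hom z) = 0
      rw [hz, map_zero]
    obtain ⟨y, hy⟩ := (Submodule.Quotient.mk_eq_zero _).1 h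
    exact ⟨y, (hd y).trans (congrArg _ hy)⟩
  · rintro ⟨y, hy⟩
    rw [hd] at hy
    rw [← iCycles_injective C n hy]
    change (C.toCycles i n ≫ C.homologyπ n).hom y = 0
    rw [C.toCycles_comp_homologyπ]
    rfl

/-- The cohomology class of a cocycle. -/
noncomputable def homologyClass (C : CochainComplex (TopModuleCat.{v} k) ℕ) (n : ℕ) :
    (C.d n (n + 1)).hom.ker →+ C.homology n where
  toFun z := ((cyclesIsoKer C n).inv ≫ C.homologyπ n).hom z
  map_zero' := map_zero _
  map_add' _ _ := map_add _ _ _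

lemma homologyClass_surjective (C : CochainComplex (TopModuleCat.{v} k) ℕ) (n : ℕ) :
    Function.Surjective (homologyClass C n) := by
  intro x
  obtain ⟨y, rfl⟩ := homologyπ_surjective C n x
  refine ⟨(cyclesIsoKer C n).hom.hom y, ?_⟩
  change ((cyclesIsoKer C n).hom ≫ (cyclesIsoKer C n).inv ≫ C.homologyπ n).hom y = _
  rw [Iso.hom_inv_id_assoc]

lemma iCycles_cyclesIsoKer_inv (C : CochainComplex (TopModuleCat.{v} k) ℕ) (n : ℕ)
    (z : (C.d n (n + 1)).hom.ker) :
    (C.iCycles n).hom ((cyclesIsoKer C n).inv.hom z) = z :=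
  congr($(cyclesIsoKer_inv_iCycles C n).hom z)

lemma homologyClass_zero_eq_zero_iff (C : CochainComplex (TopModuleCat.{v} k) ℕ)
    (z : (C.d 0 (0 + 1)).hom.ker) : homologyClass C 0 z = 0 ↔ z = 0 := by
  refine (homologyπ_eq_zero_iff C (i := 0) (by simp) ((cyclesIsoKer C 0).inv.hom z)).trans ?_
  rw [iCycles_cyclesIsoKer_inv, C.shape 0 0 (by simp)]
  refine ⟨fun ⟨y, hy⟩ => Subtype.ext hy.symm, fun h => ⟨0, h ▸ rfl⟩⟩

lemma homologyClass_succ_eq_zero_iff (C : CochainComplex (TopModuleCat.{v} k) ℕ) (n : ℕ)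
    (z : (C.d (n + 1) (n + 1 + 1)).hom.ker) :
    homologyClass C (n + 1) z = 0 ↔ ∃ y, (C.d n (n + 1)).hom y = z := by
  refine (homologyπ_eq_zero_iff C (i := n) (by simp)
    ((cyclesIsoKer C (n + 1)).inv.hom z)).trans ?_
  rw [iCycles_cyclesIsoKer_inv]

lemma homologyMap_homologyClass {C D : CochainComplex (TopModuleCat.{v} k) ℕ} (f : C ⟶ D) (n : ℕ)
    (z : (C.d n (n + 1)).hom.ker) (w : (D.d n (n + 1)).hom.ker)
    (h : (f.f n).hom z = w) :
    (HomologicalComplex.homologyMap f n).hom (homologyClass C n z) = homologyClass D n w := by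
  have key : (HomologicalComplex.cyclesMap f n).hom ((cyclesIsoKer C n).inv.hom z) =
      (cyclesIsoKer D n).inv.hom w := by
    apply iCycles_injective
    rw [iCycles_cyclesIsoKer_inv, ← h]
    change (HomologicalComplex.cyclesMap f n ≫ D.iCycles n).hom ((cyclesIsoKer C n).inv.hom z) = _
    rw [HomologicalComplex.cyclesMap_i]
    exact congrArg (f.f n).hom (iCycles_cyclesIsoKer_inv C n z)
  change (C.homologyπ n ≫ HomologicalComplex.homologyMap f n).hom
    ((cyclesIsoKer C n).inv.hom z) = (D.homologyπ n).hom ((cyclesIsoKer D n).inv.hom w)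
  rw [HomologicalComplex.homologyπ_naturality, ← key]
  rfl

end Presentation

section LongExact

/-! ### The long exact sequence of a short exact sequence of complexes -/

/-- A sequence of groups `H n` presented as the cohomology of the cochain complex `(C, d)`: every
element of `H n` is the class of a cocycle, and exactly the coboundaries have class zero. There are
no coboundaries but `0` in degree `0`. -/
structure CohomologyPresentation {C : ℕ → Type*} [∀ n, AddCommGroup (C n)]
    (d : ∀ n, C n →+ C (n + 1)) (H : ℕ → Type*) [∀ n, AddCommGroup (H n)] where
  d_d : ∀ n c, d (n + 1) (d n c) = 0
  cls : ∀ n, (d n).ker →+ H n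
  cls_surjective : ∀ n, Function.Surjective (cls n)
  cls_zero_eq_zero : ∀ z : (d 0).ker, cls 0 z = 0 → z = 0
  cls_succ_eq_zero : ∀ n (z : (d (n + 1)).ker), cls (n + 1) z = 0 ↔ ∃ y, d n y = z

namespace CohomologyPresentation

variable {A B C : ℕ → Type*} [∀ n, AddCommGroup (A n)] [∀ n, AddCommGroup (B n)]
  [∀ n, AddCommGroup (C n)]
  {dA : ∀ n, A n →+ A (n + 1)} {dB : ∀ n, B n →+ B (n + 1)} {dC : ∀ n, C n →+ C (n + 1)}
  {HA HB HC : ℕ → Type*} [∀ n, AddCommGroup (HA n)] [∀ n, AddCommGroup (HB n)]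
  [∀ n, AddCommGroup (HC n)]
  (P : CohomologyPresentation dA HA) (Q : CohomologyPresentation dB HB)
  (R : CohomologyPresentation dC HC)

/-- The map of cocycles induced by a map of complexes. -/
def kerMap (f : ∀ n, A n →+ B n) (hf : ∀ n a, dB n (f n a) = f (n + 1) (dA n a)) (n : ℕ) :
    (dA n).ker →+ (dB n).ker :=
  ((f n).comp (dA n).ker.subtype).codRestrict _ fun z => by
    change dB n (f n z) = 0
    rw [hf, show dA n z = 0 from z.2, map_zero]

lemma cls_kerMap_eq_zero {f : ∀ n, A n →+ B n} {hf : ∀ n a, dB n (f n a) = f (n + 1) (dA n a)}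
    {n : ℕ} {z : (dA n).ker} (hz : P.cls n z = 0) : Q.cls n (kerMap f hf n z) = 0 := by
  cases n with
  | zero => rw [P.cls_zero_eq_zero z hz, map_zero, map_zero]
  | succ n =>
    obtain ⟨y, hy⟩ := (P.cls_succ_eq_zero n z).1 hz
    exact (Q.cls_succ_eq_zero n _).2 ⟨f n y, by rw [hf, hy]; rfl⟩

/-- The map on cohomology induced by a map of complexes. -/
noncomputable def map (f : ∀ n, A n →+ B n) (hf : ∀ n a, dB n (f n a) = f (n + 1) (dA n a))
    (n : ℕ) : HA n →+ HB n :=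
  (P.cls n).liftOfSurjective (P.cls_surjective n) ⟨(Q.cls n).comp (kerMap f hf n),
    fun _ hz => P.cls_kerMap_eq_zero Q hz⟩

lemma map_cls (f : ∀ n, A n →+ B n) (hf : ∀ n a, dB n (f n a) = f (n + 1) (dA n a)) (n : ℕ)
    (z : (dA n).ker) : P.map Q f hf n (P.cls n z) = Q.cls n (kerMap f hf n z) :=
  AddMonoidHom.liftOfRightInverse_comp_apply _ _ _ _ _

variable {i : ∀ n, A n →+ B n} {hi : ∀ n a, dB n (i n a) = i (n + 1) (dA n a)}
  {p : ∀ n, B n →+ C n} {hp : ∀ n b, dC n (p n b) = p (n + 1) (dB n b)}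

theorem map_zero_injective (hinj : ∀ n, Function.Injective (i n)) :
    Function.Injective (P.map Q i hi 0) := by
  rw [injective_iff_map_eq_zero]
  intro x hx
  obtain ⟨z, rfl⟩ := P.cls_surjective 0 x
  rw [map_cls] at hx
  have h := congrArg Subtype.val (Q.cls_zero_eq_zero _ hx)
  have hz : z = 0 := Subtype.ext (hinj 0 (h.trans (map_zero (i 0)).symm))
  rw [hz, map_zero]

theorem exact_map_map (hinj : ∀ n, Function.Injective (i n))
    (hex : ∀ n, Function.Exact (i n) (p n)) (hsurj : ∀ n, Function.Surjective (p n)) (n : ℕ) :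
    Function.Exact (P.map Q i hi n) (Q.map R p hp n) := by
  intro y
  constructor
  · intro hy
    obtain ⟨b, rfl⟩ := Q.cls_surjective n y
    rw [map_cls] at hy
    -- after subtracting a coboundary, the cocycle `b` dies in `C`
    obtain ⟨b', hb', hcls⟩ : ∃ b' : (dB n).ker, p n b' = 0 ∧ Q.cls n b' = Q.cls n b := by
      cases n with
      | zero => exact ⟨b, congrArg Subtype.val (R.cls_zero_eq_zero _ hy), rfl⟩
      | succ n =>
        obtain ⟨c, hc⟩ := (R.cls_succ_eq_zero n _).1 hy
        obtain ⟨y, rfl⟩ := hsurj n c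
        refine ⟨b - ⟨dB n y, Q.d_d n y⟩, ?_, ?_⟩
        · change p (n + 1) ((b : B (n + 1)) - dB n y) = 0
          rw [map_sub, ← hp, hc]
          exact sub_self _
        · rw [map_sub, (Q.cls_succ_eq_zero n ⟨dB n y, Q.d_d n y⟩).2 ⟨y, rfl⟩, sub_zero]
    obtain ⟨a, ha⟩ := (hex n _).1 hb'
    have hda : dA n a = 0 := by
      apply hinj (n + 1)
      rw [← hi, ha, map_zero]
      exact b'.2
    refine ⟨P.cls n ⟨a, hda⟩, ?_⟩
    rw [map_cls, ← hcls]
    congr 1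
    exact Subtype.ext ha
  · rintro ⟨x, rfl⟩
    obtain ⟨a, rfl⟩ := P.cls_surjective n x
    rw [map_cls, map_cls, ← map_zero (R.cls n)]
    congr 1
    exact Subtype.ext ((hex n _).2 ⟨a, rfl⟩)

lemma cls_eq_of_lift (hi : ∀ n a, dB n (i n a) = i (n + 1) (dA n a))
    (hinj : ∀ n, Function.Injective (i n))
    (hex : ∀ n, Function.Exact (i n) (p n)) {n : ℕ} {b b' : B n} (hb : p n b = p n b')
    {a a' : (dA (n + 1)).ker} (ha : i (n + 1) a = dB n b) (ha' : i (n + 1) a' = dB n b') :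
    P.cls (n + 1) a = P.cls (n + 1) a' := by
  obtain ⟨c, hc⟩ := (hex n (b - b')).1 (by rw [map_sub, hb, sub_self])
  rw [← sub_eq_zero, ← map_sub, P.cls_succ_eq_zero]
  refine ⟨c, hinj (n + 1) ?_⟩
  rw [← hi, hc, map_sub, ← ha, ← ha', ← map_sub]
  rfl

/-- The lift used in the snake lemma: a cocycle of `C` comes from `b` in `B` whose coboundary comes
from a cocycle `a` of `A`. -/
lemma exists_snake_lift (Q : CohomologyPresentation dB HB)
    (hi : ∀ n a, dB n (i n a) = i (n + 1) (dA n a))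
    (hp : ∀ n b, dC n (p n b) = p (n + 1) (dB n b)) (hinj : ∀ n, Function.Injective (i n))
    (hex : ∀ n, Function.Exact (i n) (p n)) (hsurj : ∀ n, Function.Surjective (p n)) (n : ℕ)
    (z : (dC n).ker) :
    ∃ x : B n × (dA (n + 1)).ker, p n x.1 = z ∧ i (n + 1) x.2 = dB n x.1 := by
  obtain ⟨b, hb⟩ := hsurj n z
  obtain ⟨a, ha⟩ := (hex (n + 1) (dB n b)).1 (by rw [← hp, hb]; exact z.2)
  refine ⟨⟨b, a, ?_⟩, hb, ha⟩
  apply hinj (n + 1 + 1)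
  rw [← hi, ha, Q.d_d, map_zero]

section Connecting

variable (hi : ∀ n a, dB n (i n a) = i (n + 1) (dA n a))
  (hp : ∀ n b, dC n (p n b) = p (n + 1) (dB n b)) (hinj : ∀ n, Function.Injective (i n))
  (hex : ∀ n, Function.Exact (i n) (p n)) (hsurj : ∀ n, Function.Surjective (p n))

/-- The connecting homomorphism on cocycles. -/
noncomputable def connectingAux (n : ℕ) : (dC n).ker →+ HA (n + 1) :=
  AddMonoidHom.mk'
    (fun z => P.cls (n + 1) (exists_snake_lift Q hi hp hinj hex hsurj n z).choose.2) (by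
      intro z z'
      have h := (exists_snake_lift Q hi hp hinj hex hsurj n z).choose_spec
      have h' := (exists_snake_lift Q hi hp hinj hex hsurj n z').choose_spec
      have h'' := (exists_snake_lift Q hi hp hinj hex hsurj n (z + z')).choose_spec
      rw [← map_add]
      refine P.cls_eq_of_lift hi hinj hex ?_ h''.2
        (b' := (exists_snake_lift Q hi hp hinj hex hsurj n z).choose.1 +
          (exists_snake_lift Q hi hp hinj hex hsurj n z').choose.1) ?_
      · rw [h''.1, map_add, h.1, h'.1]
        rfl
      · rw [map_add, ← h.2, ← h'.2, ← map_add]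
        rfl)

lemma connectingAux_apply {n : ℕ} {b : B n} {a : (dA (n + 1)).ker} {z : (dC n).ker}
    (hb : p n b = z) (ha : i (n + 1) a = dB n b) :
    connectingAux P Q hi hp hinj hex hsurj n z = P.cls (n + 1) a := by
  have h := (exists_snake_lift Q hi hp hinj hex hsurj n z).choose_spec
  exact P.cls_eq_of_lift hi hinj hex (h.1.trans hb.symm) h.2 ha

/-- The connecting homomorphism of a short exact sequence of complexes. -/
noncomputable def connecting (n : ℕ) : HC n →+ HA (n + 1) :=
  (R.cls n).liftOfSurjective (R.cls_surjective n)
    ⟨connectingAux P Q hi hp hinj hex hsurj n, fun z hz => by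
      obtain ⟨b, hb, hdb⟩ : ∃ b, p n b = z ∧ dB n b = 0 := by
        cases n with
        | zero => exact ⟨0, by rw [R.cls_zero_eq_zero z hz, map_zero]; rfl, map_zero _⟩
        | succ n =>
          obtain ⟨y, hy⟩ := (R.cls_succ_eq_zero n z).1 hz
          obtain ⟨b, rfl⟩ := hsurj n y
          exact ⟨dB n b, by rw [← hp, hy], Q.d_d n b⟩
      change connectingAux P Q hi hp hinj hex hsurj n z = 0
      rw [connectingAux_apply P Q hi hp hinj hex hsurj (a := 0) hb
        (by rw [hdb]; exact map_zero _), map_zero]⟩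

lemma connecting_cls {n : ℕ} {b : B n} {a : (dA (n + 1)).ker} {z : (dC n).ker}
    (hb : p n b = z) (ha : i (n + 1) a = dB n b) :
    connecting P Q R hi hp hinj hex hsurj n (R.cls n z) = P.cls (n + 1) a :=
  (AddMonoidHom.liftOfRightInverse_comp_apply _ _ _ _ _).trans
    (connectingAux_apply P Q hi hp hinj hex hsurj hb ha)

theorem exact_map_connecting (n : ℕ) :
    Function.Exact (Q.map R p hp n) (connecting P Q R hi hp hinj hex hsurj n) := by
  intro y
  constructor
  · intro hy
    obtain ⟨z, rfl⟩ := R.cls_surjective n y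
    obtain ⟨⟨b, a⟩, hb, ha⟩ := exists_snake_lift Q hi hp hinj hex hsurj n z
    rw [connecting_cls P Q R hi hp hinj hex hsurj hb ha, P.cls_succ_eq_zero] at hy
    obtain ⟨c, hc⟩ := hy
    have hz : dB n (b - i n c) = 0 := by
      rw [map_sub, hi, hc]
      exact sub_eq_zero.2 ha.symm
    refine ⟨Q.cls n ⟨b - i n c, hz⟩, ?_⟩
    rw [map_cls]
    congr 1
    apply Subtype.ext
    change p n (b - i n c) = z
    rw [map_sub, (hex n _).2 ⟨c, rfl⟩, sub_zero, hb]
  · rintro ⟨x, rfl⟩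
    obtain ⟨b, rfl⟩ := Q.cls_surjective n x
    rw [map_cls, connecting_cls P Q R hi hp hinj hex hsurj (b := (b : B n)) (a := 0) rfl,
      map_zero]
    exact (map_zero _).trans b.2.symm

theorem exact_connecting_map (n : ℕ) :
    Function.Exact (connecting P Q R hi hp hinj hex hsurj n) (P.map Q i hi (n + 1)) := by
  intro x
  constructor
  · intro hx
    obtain ⟨a, rfl⟩ := P.cls_surjective (n + 1) x
    rw [map_cls, Q.cls_succ_eq_zero] at hx
    obtain ⟨b, hb⟩ := hx
    have hz : dC n (p n b) = 0 := by
      rw [hp, hb]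
      exact (hex (n + 1) _).2 ⟨a, rfl⟩
    exact ⟨R.cls n ⟨p n b, hz⟩, connecting_cls P Q R hi hp hinj hex hsurj rfl hb.symm⟩
  · rintro ⟨y, rfl⟩
    obtain ⟨z, rfl⟩ := R.cls_surjective n y
    obtain ⟨⟨b, a⟩, hb, ha⟩ := exists_snake_lift Q hi hp hinj hex hsurj n z
    rw [connecting_cls P Q R hi hp hinj hex hsurj hb ha, map_cls, Q.cls_succ_eq_zero]
    exact ⟨b, ha.symm⟩

end Connecting

end CohomologyPresentation

end LongExact

section DiscreteModules

/-! ### Discrete modules and the standard resolution -/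

variable {k : Type*} [Ring k] [TopologicalSpace k]
  {G : Type*} [Group G] [TopologicalSpace G]

/-- A representation on a discrete space on which the group acts continuously. -/
structure IsDiscreteRep (A : TopRep k G) : Prop where
  discrete : DiscreteTopology A
  continuous_action : Continuous fun x : G × A => A.ρ x.1 x.2

/-- The action of a group element on a representation, as an additive map. -/
def act (A : TopRep k G) (g : G) : A →+ A := (A.ρ g : A →+ A)

omit [TopologicalSpace G] in
lemma act_apply (A : TopRep k G) (g : G) (a : A) : act A g a = A.ρ g a := rfl

omit [TopologicalSpace G] in
lemma act_one (A : TopRep k G) (a : A) : act A 1 a = a := by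
  rw [act_apply, map_one]
  rfl

omit [TopologicalSpace G] in
lemma act_mul (A : TopRep k G) (g h : G) (a : A) : act A (g * h) a = act A g (act A h a) := by
  rw [act_apply, map_mul]
  rfl

/-- The stabilizer of an element of a representation. -/
def stab (A : TopRep k G) (a : A) : Subgroup G where
  carrier := {g | act A g a = a}
  one_mem' := act_one A a
  mul_mem' {g h} hg hh := by
    change act A (g * h) a = a
    rw [act_mul, show act A h a = a from hh, show act A g a = a from hg]
  inv_mem' {g} hg := by
    change act A g⁻¹ a = a
    nth_rewrite 1 [← show act A g a = a from hg]
    rw [← act_mul, inv_mul_cancel, act_one]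

variable [IsTopologicalGroup G]

omit [IsTopologicalGroup G] in
lemma IsDiscreteRep.isOpen_stab {A : TopRep k G} (hA : IsDiscreteRep A) (a : A) :
    IsOpen (stab A a : Set G) := by
  have := hA.discrete
  exact (isOpen_discrete {a}).preimage (hA.continuous_action.comp (by fun_prop :
    Continuous fun g : G => (g, a)))

section

variable [CompactSpace G]

lemma discreteTopology_continuousMap (X Y : Type*) [TopologicalSpace X] [CompactSpace X]
    [TopologicalSpace Y] [DiscreteTopology Y] : DiscreteTopology C(X, Y) := by
  rw [discreteTopology_iff_isOpen_singleton]
  intro F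
  have hfin : (Set.range F).Finite := (isCompact_range F.continuous).finite_of_discrete
  have h : ({F} : Set C(X, Y)) =
      ⋂ y ∈ Set.range F, {g : C(X, Y) | Set.MapsTo g (F ⁻¹' {y}) {y}} := by
    ext g
    simp only [Set.mem_singleton_iff, Set.mem_iInter, Set.mem_ofPred_eq]
    refine ⟨?_, fun h => ContinuousMap.ext fun x => h (F x) ⟨x, rfl⟩ rfl⟩
    rintro rfl y - x hx
    exact hx
  rw [h]
  exact hfin.isOpen_biInter fun y _ => ContinuousMap.isOpen_setOfPred_mapsTo
    ((isClosed_discrete {y}).preimage F.continuous).isCompact (isOpen_discrete _)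

lemma IsDiscreteRep.coind₁ {A : TopRep k G} (hA : IsDiscreteRep A) : IsDiscreteRep A.coind₁ := by
  have := hA.discrete
  have hd : DiscreteTopology A.coind₁ := discreteTopology_continuousMap G A
  refine ⟨hd, ?_⟩
  rw [continuous_prod_of_discrete_right]
  intro F
  have h : Continuous fun x : G × G => A.ρ x.1 (F (x.1⁻¹ * x.2)) :=
    hA.continuous_action.comp (f := fun x : G × G => (x.1, F (x.1⁻¹ * x.2))) (by fun_prop)
  exact (ContinuousMap.curry ⟨_, h⟩).continuous

lemma IsDiscreteRep.resolutionX {A : TopRep k G} (hA : IsDiscreteRep A) (n : ℕ) :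
    IsDiscreteRep (TopRep.resolutionX A n) := by
  induction n with
  | zero => exact hA
  | succ n ih => exact ih.coind₁

end

omit [IsTopologicalGroup G] in
lemma IsDiscreteRep.res {A : TopRep k G} (hA : IsDiscreteRep A) (K : Subgroup G) :
    IsDiscreteRep (TopRep.res K.subtype A) :=
  ⟨hA.discrete, hA.continuous_action.comp (f := fun x : K × A => ((x.1 : G), x.2)) (by fun_prop)⟩

end DiscreteModules

section Cochains

variable {k : Type*} [Ring k] [TopologicalSpace k]
  {G : Type*} [Group G] [TopologicalSpace G] [IsTopologicalGroup G]

/-- The terms `A`, `C(G, A)`, `C(G, C(G, A))`, … of the standard resolution of `A`. -/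
abbrev Coch (A : TopRep k G) (n : ℕ) : Type _ := (TopRep.resolutionX A n).V

/-- The differential of the standard resolution, as an additive map. -/
def dCoch (A : TopRep k G) (n : ℕ) : Coch A n →+ Coch A (n + 1) := ((TopRep.d A n).hom : _ →+ _)

lemma dCoch_succ_apply (A : TopRep k G) (n : ℕ) (F : C(G, Coch A n)) (x : G) :
    (dCoch A (n + 1) F : C(G, C(G, Coch A n))) x = F - dCoch A n (F x) := rfl

lemma act_succ_apply (A : TopRep k G) (n : ℕ) (g : G) (F : C(G, Coch A n)) (x : G) :
    (act (TopRep.resolutionX A (n + 1)) g F : C(G, Coch A n)) x =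
      act (TopRep.resolutionX A n) g (F (g⁻¹ * x)) := rfl

lemma dCoch_act (A : TopRep k G) (n : ℕ) (g : G) (F : Coch A n) :
    dCoch A n (act _ g F) = act _ g (dCoch A n F) :=
  TopRep.hom_comm_apply (TopRep.d A n) g F

lemma dCoch_dCoch (A : TopRep k G) (n : ℕ) (F : Coch A n) :
    dCoch A (n + 1) (dCoch A n F) = 0 :=
  congr($(TopRep.d_comp_d A n) F)

/-! ### Pulling back cochains along continuous maps -/

section Pull

variable {G' : Type*} [Group G'] [TopologicalSpace G'] [IsTopologicalGroup G']
  {A : TopRep k G} {B : TopRep k G'}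

/-- The pullback `F ↦ f ∘ F ∘ s` of cochains along a continuous map `s` of groups (not necessarily
a homomorphism) and a linear map `f` of coefficients (not necessarily equivariant). -/
def pull (s : C(G', G)) (f : A →L[k] B) : (n : ℕ) → Coch A n →L[k] Coch B n
  | 0 => f
  | n + 1 =>
    { toFun := fun F => ((pull s f n : C(Coch A n, Coch B n)).comp F).comp s
      map_add' := fun _ _ => ContinuousMap.ext fun _ => map_add (pull s f n) _ _
      map_smul' := fun _ _ => ContinuousMap.ext fun _ => map_smul (pull s f n) _ _
      cont := (ContinuousMap.continuous_precomp s).comp (ContinuousMap.continuous_postcomp _) }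

lemma pull_succ_apply (s : C(G', G)) (f : A →L[k] B) (n : ℕ) (F : C(G, Coch A n)) (x : G') :
    (pull s f (n + 1) F : C(G', Coch B n)) x = pull s f n (F (s x)) := rfl

lemma resolutionMap_eq_pull {G G' : Type u} [Group G] [TopologicalSpace G] [IsTopologicalGroup G]
    [Group G'] [TopologicalSpace G'] [IsTopologicalGroup G'] {A : TopRep k G} {B : TopRep k G'}
    (φ : G' →ₜ* G) (f : TopRep.res φ A ⟶ B) (n : ℕ) (F : Coch A n) :
    (ContinuousCohomology.resolutionMap φ f n).hom F =
      pull (φ : C(G', G)) f.hom.toContinuousLinearMap n F := by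
  induction n with
  | zero => rfl
  | succ n ih => exact ContinuousMap.ext fun x => ih _

lemma dCoch_pull (s : C(G', G)) (f : A →L[k] B) (n : ℕ) (F : Coch A n) :
    dCoch B n (pull s f n F) = pull s f (n + 1) (dCoch A n F) := by
  induction n with
  | zero => rfl
  | succ n ih =>
    refine ContinuousMap.ext fun x => ?_
    rw [pull_succ_apply, dCoch_succ_apply, dCoch_succ_apply, map_sub, ← ih]
    rfl

lemma pull_pull {G'' : Type*} [Group G''] [TopologicalSpace G''] [IsTopologicalGroup G'']
    {C : TopRep k G''} (s : C(G', G)) (s' : C(G'', G')) (f : A →L[k] B) (f' : B →L[k] C) (n : ℕ)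
    (F : Coch A n) : pull s' f' n (pull s f n F) = pull (s.comp s') (f'.comp f) n F := by
  induction n with
  | zero => rfl
  | succ n ih => exact ContinuousMap.ext fun x => ih _

/-- The cochains that are invariant under right translation by `U` in each variable. -/
def RightInv (A : TopRep k G) (U : Subgroup G) : (n : ℕ) → Coch A n → Prop
  | 0, _ => True
  | n + 1, F => ∀ x : G, (∀ u ∈ U, (F : C(G, Coch A n)) (x * u) = (F : C(G, Coch A n)) x) ∧
      RightInv A U n ((F : C(G, Coch A n)) x)

lemma RightInv.mono {U V : Subgroup G} (h : U ≤ V) {n : ℕ} {F : Coch A n}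
    (hF : RightInv A V n F) : RightInv A U n F := by
  induction n with
  | zero => trivial
  | succ n ih => exact fun x => ⟨fun u hu => (hF x).1 u (h hu), ih (hF x).2⟩

lemma rightInv_bot (n : ℕ) (F : Coch A n) : RightInv A ⊥ n F := by
  induction n with
  | zero => trivial
  | succ n ih =>
    refine fun x => ⟨fun u hu => ?_, ih _⟩
    rw [Subgroup.mem_bot.1 hu, mul_one]

lemma RightInv.apply_eq {U : Subgroup G} {n : ℕ} {F : C(G, Coch A n)}
    (hF : RightInv A U (n + 1) F) {x y : G} (h : x⁻¹ * y ∈ U) : F y = F x := by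
  have := (hF x).1 _ h
  rwa [mul_inv_cancel_left] at this

lemma pull_congr {U : Subgroup G} {s s' : C(G', G)} (h : ∀ x, (s x)⁻¹ * s' x ∈ U) (f : A →L[k] B)
    {n : ℕ} {F : Coch A n} (hF : RightInv A U n F) : pull s f n F = pull s' f n F := by
  induction n with
  | zero => rfl
  | succ n ih =>
    refine ContinuousMap.ext fun x => ?_
    rw [pull_succ_apply, pull_succ_apply, hF.apply_eq (h x)]
    exact ih (hF _).2

/-- Pullback along a map that is equivariant up to right translation by `U` is equivariant on
`U`-invariant cochains. -/
lemma act_pull {U : Subgroup G} {s : C(G', G)} {f : A →L[k] B} {g : G} {g' : G'}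
    (hs : ∀ x, (g⁻¹ * s x)⁻¹ * s (g'⁻¹ * x) ∈ U) (hf : ∀ a, act B g' (f a) = f (act A g a))
    {n : ℕ} {F : Coch A n} (hF : RightInv A U n F) :
    act _ g' (pull s f n F) = pull s f n (act _ g F) := by
  induction n with
  | zero => exact hf F
  | succ n ih =>
    refine ContinuousMap.ext fun x => ?_
    rw [pull_succ_apply, act_succ_apply, pull_succ_apply, act_succ_apply, hF.apply_eq (hs x)]
    exact ih (hF _).2

lemma pull_id (n : ℕ) (F : Coch A n) :
    pull (ContinuousMap.id G) (ContinuousLinearMap.id k A) n F = F := by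
  induction n with
  | zero => rfl
  | succ n ih => exact ContinuousMap.ext fun x => ih _

/-- The action of `g` on cochains is the pullback along left translation by `g⁻¹`. -/
lemma act_eq_pull (g : G) (n : ℕ) (F : Coch A n) :
    act _ g F = pull (B := A) (ContinuousMap.mulLeft g⁻¹) (A.ρ g) n F := by
  induction n with
  | zero => rfl
  | succ n ih => exact ContinuousMap.ext fun x => ih _

end Pull

section Homotopy

variable [CompactSpace G] (A : TopRep k G) (t : C(G, G))

/-- A homotopy from the identity to the pullback of cochains along `t`. In terms of functions of
several variables it is the alternating sum of
`(x₀, …, xₙ₋₁) ↦ F (t x₀, …, t xⱼ, xⱼ, …, xₙ₋₁)`. -/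
def homotopy : (n : ℕ) → Coch A (n + 1) →L[k] Coch A n
  | 0 => 0
  | n + 1 =>
    { toFun := fun F => ⟨fun x => ((F : C(G, C(G, Coch A n))) (t x)) x -
        homotopy n ((F : C(G, C(G, Coch A n))) (t x)), by
          have := (homotopy n).continuous
          fun_prop⟩
      map_add' := fun F F' => ContinuousMap.ext fun x => by
        change (_ + _) - homotopy n (_ + _) = (_ - _) + (_ - _)
        rw [map_add]
        abel
      map_smul' := fun c F => ContinuousMap.ext fun x => by
        change c • _ - homotopy n (c • _) = c • (_ - _)
        rw [map_smul, smul_sub]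
      cont := by
        apply ContinuousMap.continuous_of_continuous_uncurry
        have := (homotopy n).continuous
        change Continuous fun p : C(G, C(G, Coch A n)) × G =>
          p.1 (t p.2) p.2 - homotopy n (p.1 (t p.2))
        fun_prop }

lemma homotopy_succ_apply (n : ℕ) (F : C(G, C(G, Coch A n))) (x : G) :
    (homotopy A t (n + 1) F : C(G, Coch A n)) x = F (t x) x - homotopy A t n (F (t x)) := rfl

/-- The homotopy formula `h d + d h = 1 - t*`. -/
lemma homotopy_dCoch (n : ℕ) (F : Coch A (n + 1)) :
    homotopy A t (n + 1) (dCoch A (n + 1) F) + dCoch A n (homotopy A t n F) =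
      F - pull t (ContinuousLinearMap.id k A) (n + 1) F := by
  induction n with
  | zero =>
    refine ContinuousMap.ext fun x => ?_
    change ((F : C(G, Coch A 0)) x - (F : C(G, Coch A 0)) (t x)) - 0 + 0 =
      (F : C(G, Coch A 0)) x - (F : C(G, Coch A 0)) (t x)
    abel
  | succ n ih =>
    refine ContinuousMap.ext fun x => ?_
    change C(G, C(G, Coch A n)) at F
    have h := ih (F (t x))
    change (F x - dCoch A (n + 1) (F (t x)) x) -
        homotopy A t (n + 1) (F - dCoch A (n + 1) (F (t x))) +
      (homotopy A t (n + 1) F - dCoch A n (F (t x) x - homotopy A t n (F (t x)))) =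
      F x - pull t _ (n + 1) (F (t x))
    rw [dCoch_succ_apply, map_sub, map_sub, eq_sub_of_add_eq h]
    abel

lemma act_homotopy {U : Subgroup G} {g : G} (ht : ∀ x, (g⁻¹ * t x)⁻¹ * t (g⁻¹ * x) ∈ U)
    {n : ℕ} {F : Coch A (n + 1)} (hF : RightInv A U (n + 1) F) :
    act _ g (homotopy A t n F) = homotopy A t n (act _ g F) := by
  induction n with
  | zero => exact map_zero _
  | succ n ih =>
    refine ContinuousMap.ext fun x => ?_
    rw [act_succ_apply, homotopy_succ_apply, homotopy_succ_apply, hF.apply_eq (ht x), map_sub,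
      ih (hF _).2]
    rfl

end Homotopy

section Uniform

variable [CompactSpace G] {A : TopRep k G}

/-- A cochain is uniformly locally constant, as it takes finitely many values in each variable. -/
lemma exists_rightInv (hA : IsDiscreteRep A) (n : ℕ) (F : Coch A n) :
    ∃ U : Subgroup G, IsOpen (U : Set G) ∧ RightInv A U n F := by
  induction n with
  | zero => exact ⟨⊤, isOpen_univ, trivial⟩
  | succ n ih =>
    change C(G, Coch A n) at F
    have := (hA.resolutionX n).discrete
    have := discreteTopology_continuousMap G (Coch A n)
    choose U hU hUF using ih
    have hfin : (Set.range F).Finite := (isCompact_range F.continuous).finite_of_discrete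
    let V : Subgroup G :=
      { carrier := {u | ∀ x, F (x * u) = F x}
        one_mem' := fun x => by rw [mul_one]
        mul_mem' := fun {a b} ha hb x => by rw [← mul_assoc, hb, ha]
        inv_mem' := fun {a} ha x => by rw [← ha, inv_mul_cancel_right] }
    have hV : IsOpen (V : Set G) := by
      have hc : Continuous fun x : G × G => F (x.2 * x.1) := by fun_prop
      convert (isOpen_discrete {F}).preimage (ContinuousMap.curry ⟨_, hc⟩).continuous using 1
      ext u
      exact ⟨fun h => ContinuousMap.ext h, fun h x => congr($h x)⟩
    refine ⟨V ⊓ ⨅ y ∈ Set.range F, U y, ?_, fun x => ⟨fun u hu => hu.1 x, ?_⟩⟩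
    · rw [Subgroup.coe_inf]
      simp only [Subgroup.coe_iInf]
      exact hV.inter (hfin.isOpen_biInter fun y _ => hU y)
    · exact (hUF (F x)).mono (inf_le_right.trans (iInf₂_le (F x) ⟨x, rfl⟩))

end Uniform

end Cochains

section Classes

/-! ### Cohomology classes of invariant cochains -/

variable {k : Type*} [Ring k] [TopologicalSpace k]
  {G : Type*} [Group G] [TopologicalSpace G] [IsTopologicalGroup G]

/-- The elements of a representation that are fixed by the subgroup `K`. -/
def fixedBy (A : TopRep k G) (K : Subgroup G) : AddSubgroup A where
  carrier := {a | ∀ g ∈ K, act A g a = a}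
  zero_mem' _ _ := map_zero _
  add_mem' {a b} ha hb g hg := by rw [map_add, ha g hg, hb g hg]
  neg_mem' {a} ha g hg := by rw [map_neg, ha g hg]

omit [TopologicalSpace G] [IsTopologicalGroup G] in
lemma fixedBy_anti (A : TopRep k G) {K L : Subgroup G} (h : L ≤ K) :
    fixedBy A K ≤ fixedBy A L := fun _ ha g hg => ha g (h hg)

lemma dCoch_mem_fixedBy {A : TopRep k G} {K : Subgroup G} {n : ℕ} {F : Coch A n}
    (hF : F ∈ fixedBy _ K) : dCoch A n F ∈ fixedBy (TopRep.resolutionX A (n + 1)) K :=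
  fun g hg => by rw [← dCoch_act, hF g hg]

/-- The `K`-invariant `n`-cocycles in the standard resolution of the `G`-module `A`. -/
def invCocycles (A : TopRep k G) (K : Subgroup G) (n : ℕ) : AddSubgroup (Coch A (n + 1)) :=
  fixedBy (TopRep.resolutionX A (n + 1)) K ⊓ (dCoch A (n + 1)).ker

lemma invCocycles_anti (A : TopRep k G) {K L : Subgroup G} (h : L ≤ K) (n : ℕ) :
    invCocycles A K n ≤ invCocycles A L n :=
  inf_le_inf_right _ (fixedBy_anti _ h)

/-- The coboundaries of `K`-invariant cochains; in degree `0` only the zero cochain. -/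
def IsInvBoundary (A : TopRep k G) (K : Subgroup G) (n : ℕ) (F : Coch A (n + 1)) : Prop :=
  ∃ E ∈ fixedBy (TopRep.resolutionX A n) K, (n = 0 → E = 0) ∧ dCoch A n E = F

/-- An invariant cocycle, as a cocycle of the complex of homogeneous cochains. -/
def toHomogeneous (A : TopRep k G) (n : ℕ) :
    invCocycles A ⊤ n →+ ((TopRep.homogeneousCochains A).d n (n + 1)).hom.ker where
  toFun F :=
    let F' : (TopRep.homogeneousCochains A).X n :=
      (⟨F.1, fun g => F.2.1 g trivial⟩ : (TopRep.resolutionX A (n + 1)).ρ.invariants)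
    ⟨F', Subtype.ext ((TopRep.homogeneousCochains.d_apply A n F').trans F.2.2)⟩
  map_zero' := rfl
  map_add' _ _ := rfl

/-- The class of an invariant cocycle in continuous cohomology. -/
noncomputable def cochClass (A : TopRep k G) (n : ℕ) :
    invCocycles A ⊤ n →+ continuousCohomology n A :=
  (homologyClass (TopRep.homogeneousCochains A) n).comp (toHomogeneous A n)

lemma cochClass_surjective (A : TopRep k G) (n : ℕ) : Function.Surjective (cochClass A n) := by
  intro x
  obtain ⟨z, rfl⟩ := homologyClass_surjective _ n x
  refine ⟨⟨z.1.1, fun g _ => z.1.2 g, ?_⟩, rfl⟩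
  have h : ((TopRep.homogeneousCochains A).d n (n + 1)).hom z.1 = 0 := z.2
  exact (TopRep.homogeneousCochains.d_apply A n _).symm.trans (congrArg Subtype.val h)

lemma cochClass_eq_zero_iff (A : TopRep k G) (n : ℕ) (F : invCocycles A ⊤ n) :
    cochClass A n F = 0 ↔ IsInvBoundary A ⊤ n F := by
  cases n with
  | zero =>
    refine (homologyClass_zero_eq_zero_iff _ _).trans ⟨fun h => ?_, ?_⟩
    · refine ⟨0, zero_mem _, fun _ => rfl, ?_⟩
      rw [map_zero]
      exact (congr(($h).1.1)).symm
    · rintro ⟨E, -, hE, hF⟩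
      rw [hE rfl, map_zero] at hF
      exact Subtype.ext (Subtype.ext hF.symm)
  | succ n =>
    refine (homologyClass_succ_eq_zero_iff _ n _).trans ⟨?_, ?_⟩
    · rintro ⟨E, hE⟩
      refine ⟨E.1, fun g _ => E.2 g, by simp, ?_⟩
      exact (TopRep.homogeneousCochains.d_apply A n E).symm.trans (congrArg Subtype.val hE)
    · rintro ⟨E, hE, -, hF⟩
      refine ⟨⟨E, fun g => hE g trivial⟩, Subtype.ext ?_⟩
      exact (TopRep.homogeneousCochains.d_apply A n _).trans hF

end Classes

section Map

variable {k : Type*} [Ring k] [TopologicalSpace k]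
  {G G' : Type u} [Group G] [TopologicalSpace G] [IsTopologicalGroup G]
  [Group G'] [TopologicalSpace G'] [IsTopologicalGroup G']

/-- The functoriality of continuous cohomology on classes of cocycles. -/
lemma map_cochClass {A : TopRep k G} {B : TopRep k G'} (φ : G' →ₜ* G) (f : TopRep.res φ A ⟶ B)
    (n : ℕ) (F : invCocycles A ⊤ n) (F' : invCocycles B ⊤ n)
    (h : pull (φ : C(G', G)) f.hom.toContinuousLinearMap (n + 1) F = F') :
    (ContinuousCohomology.map φ f n).hom (cochClass A n F) = cochClass B n F' :=
  homologyMap_homologyClass (ContinuousCohomology.cochainsMap φ f) n _ _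
    (Subtype.ext ((resolutionMap_eq_pull φ f (n + 1) F.1).trans h))

end Map

section Retraction

variable {G : Type*} [Group G] [TopologicalSpace G] [IsTopologicalGroup G]

/-- A subgroup `K` is a retract of the group, compatibly with left multiplication by `K`, up to an
open normal subgroup `U`: choose representatives for the orbits of `K` on `G ⧸ U`. -/
lemma exists_retraction_mod (K U : Subgroup G) [U.Normal] (hU : IsOpen (U : Set G)) :
    ∃ s : C(G, K), (∀ (g : K) (x : G), (g * s x : G)⁻¹ * s (g * x) ∈ U) ∧
      ∀ g : K, (g : G)⁻¹ * s g ∈ U := by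
  have := QuotientGroup.discreteTopology hU
  have hκ : ∀ c : G ⧸ U, ∃ g : K, g • (Quotient.mk (orbitRel K (G ⧸ U)) c).out = c := fun c =>
    orbitRel_apply.1 (Quotient.exact (Quotient.out_eq (Quotient.mk (orbitRel K (G ⧸ U)) c)).symm)
  -- `κ c` carries the chosen representative of the orbit of `c` to `c`; the map sought is
  -- `x ↦ κ x * (κ 1)⁻¹`
  choose κ hκ using hκ
  have hstab : ∀ (a b : K) (c : G ⧸ U), a • c = b • c → (a : G)⁻¹ * b ∈ U := by
    intro a b c h
    obtain ⟨x, rfl⟩ := QuotientGroup.mk_surjective c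
    have h' : ((a * x : G) : G ⧸ U) = ((b * x : G) : G ⧸ U) := h
    rw [QuotientGroup.eq] at h'
    have := Subgroup.Normal.conj_mem ‹_› _ h' x
    convert this using 1
    group
  have hmul : ∀ (g : K) (x : G), (g * (κ x * (κ (1 : G))⁻¹) : G)⁻¹ *
      (κ ((g * x : G) : G ⧸ U) * (κ (1 : G))⁻¹) ∈ U := by
    intro g x
    have h : ((g * κ x : K) : G)⁻¹ * κ ((g * x : G) : G ⧸ U) ∈ U := by
      refine hstab _ _ (Quotient.mk (orbitRel K (G ⧸ U)) x).out ?_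
      rw [mul_smul, hκ]
      have : (Quotient.mk (orbitRel K (G ⧸ U)) x) =
          Quotient.mk (orbitRel K (G ⧸ U)) ((g * x : G) : G ⧸ U) :=
        (Quotient.sound (orbitRel_apply.2 ⟨g, rfl⟩)).symm
      rw [this, hκ]
      rfl
    have := Subgroup.Normal.conj_mem ‹_› _ h (κ (1 : G))
    convert this using 1
    push_cast
    group
  refine ⟨⟨fun x => κ x * (κ (1 : G))⁻¹,
    (continuous_of_discreteTopology (f := fun c => κ c * (κ (1 : G))⁻¹)).comp
      continuous_quotient_mk'⟩, hmul, fun g => ?_⟩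
  have := hmul g 1
  simpa using this

end Retraction

section SubgroupClasses

/-! ### Cohomology of closed subgroups in terms of cochains on the whole group -/

variable {k : Type*} [Ring k] [TopologicalSpace k]
  {G : Type u} [Group G] [TopologicalSpace G] [IsTopologicalGroup G]

/-- The restriction of cochains on `G` to the subgroup `K`. -/
def resCoch (A : TopRep.{u} k G) (K : Subgroup G) (n : ℕ) :
    Coch A n →L[k] Coch (TopRep.res K.subtype A) n :=
  pull (inclG K : C(K, G)) (ContinuousLinearMap.id k A) n

lemma act_resCoch (A : TopRep.{u} k G) (K : Subgroup G) (n : ℕ) (g : K) (F : Coch A n) :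
    act _ g (resCoch A K n F) = resCoch A K n (act _ (g : G) F) :=
  act_pull (A := A) (B := TopRep.res K.subtype A) (s := (inclG K : C(K, G)))
    (f := ContinuousLinearMap.id k A) (g := (g : G)) (U := ⊥)
    (fun _ => Subgroup.mem_bot.2 (inv_mul_eq_one.2 rfl)) (fun _ => rfl) (rightInv_bot _ _)

lemma dCoch_resCoch (A : TopRep.{u} k G) (K : Subgroup G) (n : ℕ) (F : Coch A n) :
    dCoch _ n (resCoch A K n F) = resCoch A K (n + 1) (dCoch A n F) :=
  dCoch_pull _ _ n F

lemma resCoch_mem_invCocycles (A : TopRep.{u} k G) (K : Subgroup G) (n : ℕ) {F : Coch A (n + 1)}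
    (hF : F ∈ invCocycles A K n) :
    resCoch A K (n + 1) F ∈ invCocycles (TopRep.res K.subtype A) ⊤ n := by
  refine ⟨fun g _ => by rw [act_resCoch, hF.1 g g.2], ?_⟩
  change dCoch _ (n + 1) _ = 0
  rw [dCoch_resCoch, show dCoch A (n + 1) F = 0 from hF.2, map_zero]

/-- The class in `Hⁿ(K, A)` of a `K`-invariant cocycle on `G`. -/
noncomputable def clsK (A : TopRep.{u} k G) (K : Subgroup G) (n : ℕ) :
    invCocycles A K n →+ subgroupH n K A :=
  (cochClass (TopRep.res K.subtype A) n).comp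
    { toFun := fun F => ⟨resCoch A K (n + 1) F.1, resCoch_mem_invCocycles A K n F.2⟩
      map_zero' := Subtype.ext (map_zero (resCoch A K (n + 1)))
      map_add' := fun _ _ => Subtype.ext (map_add (resCoch A K (n + 1)) _ _) }

/-- The restriction maps send the class of a cocycle to the class of the same cocycle. -/
lemma resK_clsK (A : TopRep.{u} k G) {K L : Subgroup G} (h : L ≤ K) (n : ℕ)
    (F : invCocycles A K n) :
    (resK n h A).hom (clsK A K n F) = clsK A L n ⟨F, invCocycles_anti A h n F.2⟩ :=
  map_cochClass _ _ n _ _ (pull_pull _ _ _ _ _ _)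

lemma resG_cochClass (A : TopRep.{u} k G) (K : Subgroup G) (n : ℕ) (F : invCocycles A ⊤ n) :
    (resG n K A).hom (cochClass A n F) = clsK A K n ⟨F, invCocycles_anti A le_top n F.2⟩ :=
  map_cochClass _ _ n _ _ rfl

/-- The effect of a morphism of modules on cochains. -/
def coeffCoch {A B : TopRep.{u} k G} (f : A ⟶ B) (n : ℕ) : Coch A n →L[k] Coch B n :=
  pull (ContinuousMap.id G) f.hom.toContinuousLinearMap n

lemma act_coeffCoch {A B : TopRep.{u} k G} (f : A ⟶ B) (n : ℕ) (g : G) (F : Coch A n) :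
    act _ g (coeffCoch f n F) = coeffCoch f n (act _ g F) :=
  act_pull (U := ⊥) (fun x => by simp) (fun a => (TopRep.hom_comm_apply f g a).symm)
    (rightInv_bot _ _)

lemma coeffCoch_mem_invCocycles {A B : TopRep.{u} k G} (f : A ⟶ B) {K : Subgroup G} {n : ℕ}
    {F : Coch A (n + 1)} (hF : F ∈ invCocycles A K n) :
    coeffCoch f (n + 1) F ∈ invCocycles B K n := by
  refine ⟨fun g hg => by rw [act_coeffCoch, hF.1 g hg], ?_⟩
  change dCoch _ (n + 1) _ = 0
  rw [coeffCoch, dCoch_pull, show dCoch A (n + 1) F = 0 from hF.2, map_zero]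

lemma coeffMap_clsK {A B : TopRep.{u} k G} (f : A ⟶ B) (K : Subgroup G) (n : ℕ)
    (F : invCocycles A K n) :
    (coeffMap n K f).hom (clsK A K n F) =
      clsK B K n ⟨coeffCoch f (n + 1) F, coeffCoch_mem_invCocycles f F.2⟩ := by
  refine map_cochClass _ _ n _ _ ?_
  refine (pull_pull _ _ _ _ _ _).trans ?_
  exact (pull_pull (C := TopRep.res K.subtype B) (ContinuousMap.id G) (inclG K : C(K, G))
    f.hom.toContinuousLinearMap (ContinuousLinearMap.id k B) (n + 1) F.1).symm

lemma coeffMapG_cochClass {A B : TopRep.{u} k G} (f : A ⟶ B) (n : ℕ) (F : invCocycles A ⊤ n) :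
    (coeffMapG n f).hom (cochClass A n F) =
      cochClass B n ⟨coeffCoch f (n + 1) F, coeffCoch_mem_invCocycles f F.2⟩ :=
  map_cochClass _ _ n _ _ rfl

lemma clsK_eq_zero_of_isInvBoundary (A : TopRep.{u} k G) {K : Subgroup G} {n : ℕ}
    {F : invCocycles A K n} (hF : IsInvBoundary A K n F) : clsK A K n F = 0 := by
  obtain ⟨E, hE, h0, hEF⟩ := hF
  refine (cochClass_eq_zero_iff _ _ _).2 ⟨resCoch A K n E, fun g _ => ?_, fun hn => ?_, ?_⟩
  · rw [act_resCoch, hE g g.2]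
  · rw [h0 hn, map_zero]
  · rw [dCoch_resCoch, hEF]
    rfl

/-- The extension of cochains from `K` to `G` along a map `G → K`. -/
def extCoch (A : TopRep.{u} k G) {K : Subgroup G} (s : C(G, K)) (n : ℕ) :
    Coch (TopRep.res K.subtype A) n →L[k] Coch A n :=
  pull (A := TopRep.res K.subtype A) (B := A) s (ContinuousLinearMap.id k A) n

lemma dCoch_extCoch (A : TopRep.{u} k G) {K : Subgroup G} (s : C(G, K)) (n : ℕ)
    (E : Coch (TopRep.res K.subtype A) n) :
    dCoch A n (extCoch A s n E) = extCoch A s (n + 1) (dCoch _ n E) :=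
  dCoch_pull _ _ n E

lemma extCoch_resCoch (A : TopRep.{u} k G) {K : Subgroup G} (s : C(G, K)) (n : ℕ) (F : Coch A n) :
    extCoch A s n (resCoch A K n F) =
      pull ((inclG K : C(K, G)).comp s) (ContinuousLinearMap.id k A) n F :=
  pull_pull _ _ _ _ n F

lemma resCoch_extCoch (A : TopRep.{u} k G) {K U : Subgroup G} {s : C(G, K)}
    (hs : ∀ g : K, (g : G)⁻¹ * s g ∈ U) {n : ℕ} {E : Coch (TopRep.res K.subtype A) n}
    (hU : RightInv (TopRep.res K.subtype A) (U.subgroupOf K) n E) :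
    resCoch A K n (extCoch A s n E) = E :=
  (pull_pull (A := TopRep.res K.subtype A) (B := A) (C := TopRep.res K.subtype A) s
    (inclG K : C(K, G)) (ContinuousLinearMap.id k A) (ContinuousLinearMap.id k A) n E).trans
    ((pull_congr (s := ContinuousMap.id K) (fun x => hs x) _ hU).symm.trans (pull_id n E))

lemma extCoch_mem_fixedBy {A : TopRep.{u} k G} {K U : Subgroup G} {s : C(G, K)}
    (hs : ∀ (g : K) (x : G), (g * s x : G)⁻¹ * s (g * x) ∈ U) {n : ℕ}
    {E : Coch (TopRep.res K.subtype A) n} (hE : E ∈ fixedBy (TopRep.resolutionX _ n) ⊤)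
    (hU : RightInv (TopRep.res K.subtype A) (U.subgroupOf K) n E) :
    extCoch A s n E ∈ fixedBy (TopRep.resolutionX A n) K := by
  intro g hg
  have h := act_pull (A := TopRep.res K.subtype A) (B := A) (s := s)
    (f := ContinuousLinearMap.id k A) (g := (⟨g, hg⟩ : K)) (g' := g)
    (fun x => hs ⟨g, hg⟩⁻¹ x) (fun a => rfl) hU
  rw [hE _ trivial] at h
  exact h

variable [CompactSpace G] [TotallyDisconnectedSpace G]

/-- A cochain on `K` is invariant under right translation by the intersection of `K` with an open
normal subgroup of `G`. -/
lemma exists_normal_rightInv_res {A : TopRep.{u} k G} (hA : IsDiscreteRep A) {K : Subgroup G}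
    (hK : IsClosed (K : Set G)) (n : ℕ) (E : Coch (TopRep.res K.subtype A) n) :
    ∃ U : OpenNormalSubgroup G,
      RightInv (TopRep.res K.subtype A) (U.toSubgroup.subgroupOf K) n E := by
  have : CompactSpace K := isCompact_iff_compactSpace.1 hK.isCompact
  obtain ⟨W, hW, hWE⟩ := exists_rightInv (hA.res K) n E
  obtain ⟨V, hV, hVW⟩ := isOpen_induced_iff.1 hW
  obtain ⟨U, hU⟩ := ProfiniteGrp.exist_openNormalSubgroup_sub_open_nhds_of_one hV
    (show (1 : K) ∈ Subtype.val ⁻¹' V from hVW ▸ W.one_mem)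
  refine ⟨U, hWE.mono fun x hx => ?_⟩
  change x ∈ (W : Set K)
  rw [← hVW]
  exact hU hx

lemma exists_normal_rightInv {A : TopRep.{u} k G} (hA : IsDiscreteRep A) (n : ℕ) (F : Coch A n) :
    ∃ U : OpenNormalSubgroup G, RightInv A U.toSubgroup n F := by
  obtain ⟨W, hW, hWF⟩ := exists_rightInv hA n F
  obtain ⟨U, hU⟩ := ProfiniteGrp.exist_openNormalSubgroup_sub_open_nhds_of_one hW W.one_mem
  exact ⟨U, hWF.mono hU⟩

/-- Every class of a closed subgroup `K` is represented by a `K`-invariant cocycle on the whole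
group, the pullback of a cocycle on `K` along a retraction of `G` onto `K` modulo a small open
normal subgroup. -/
theorem clsK_surjective {A : TopRep.{u} k G} (hA : IsDiscreteRep A) {K : Subgroup G}
    (hK : IsClosed (K : Set G)) (n : ℕ) : Function.Surjective (clsK A K n) := by
  intro x
  obtain ⟨E, rfl⟩ := cochClass_surjective _ n x
  obtain ⟨U, hU⟩ := exists_normal_rightInv_res hA hK (n + 1) E.1
  obtain ⟨s, hs, hs'⟩ := exists_retraction_mod K U.toSubgroup U.isOpen
  have hd : dCoch A (n + 1) (extCoch A s (n + 1) E.1) = 0 := by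
    rw [dCoch_extCoch, show dCoch _ (n + 1) E.1 = 0 from E.2.2, map_zero]
  exact ⟨⟨extCoch A s (n + 1) E.1, extCoch_mem_fixedBy hs E.2.1 hU, hd⟩,
    congrArg (cochClass _ n) (Subtype.ext (resCoch_extCoch A hs' hU))⟩

theorem clsK_eq_zero_iff {A : TopRep.{u} k G} (hA : IsDiscreteRep A) {K : Subgroup G}
    (hK : IsClosed (K : Set G)) (n : ℕ) (F : invCocycles A K n) :
    clsK A K n F = 0 ↔ IsInvBoundary A K n F := by
  refine ⟨fun h => ?_, clsK_eq_zero_of_isInvBoundary A⟩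
  obtain ⟨E, hE, h0, hEF⟩ := (cochClass_eq_zero_iff _ _ _).1 h
  obtain ⟨U, hU⟩ := exists_normal_rightInv_res hA hK n E
  obtain ⟨V, hV⟩ := exists_normal_rightInv hA (n + 1) F.1
  obtain ⟨s, hs, -⟩ := exists_retraction_mod K (U ⊓ V).toSubgroup (U ⊓ V).isOpen
  have hle : (U ⊓ V).toSubgroup ≤ U.toSubgroup := fun x hx => hx.1
  -- the pullback of `E` along the approximate retraction bounds the pullback of `F`, which is
  -- homotopic to `F`
  let t : C(G, G) := (inclG K : C(K, G)).comp s
  have hhF : homotopy A t n F.1 ∈ fixedBy (TopRep.resolutionX A n) K := by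
    intro g hg
    rw [act_homotopy A t (U := V.toSubgroup) (fun x => (hs ⟨g, hg⟩⁻¹ x).2) hV, F.2.1 g hg]
  refine ⟨extCoch A s n E + homotopy A t n F.1,
    add_mem (extCoch_mem_fixedBy hs hE (hU.mono (Subgroup.comap_mono hle))) hhF,
    fun hn => ?_, ?_⟩
  · subst hn
    rw [h0 rfl, map_zero, zero_add]
    rfl
  · have h1 := homotopy_dCoch A t n F.1
    rw [show dCoch A (n + 1) F.1 = 0 from F.2.2, map_zero, zero_add] at h1
    have h2 : dCoch _ n E = resCoch A K (n + 1) F.1 := hEF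
    rw [map_add, h1, dCoch_extCoch, h2, extCoch_resCoch]
    exact add_sub_cancel _ _

omit [TotallyDisconnectedSpace G] in
/-- Conjugation by `g` sends the class of a cocycle `F` to the class of `g • F`. -/
theorem conjRes_clsK {A : TopRep.{u} k G} (g : G) {K L : Subgroup G}
    (h : ∀ l ∈ L, g⁻¹ * l * g ∈ K) (n : ℕ) (F : invCocycles A K n)
    (F' : invCocycles A L n) (hF : F'.1 = act (TopRep.resolutionX A (n + 1)) g F.1) :
    (conjRes n g h A).hom (clsK A K n F) = clsK A L n F' := by
  -- conjugation differs from the action of `g` by the right translation `t`, which is homotopic to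
  -- the identity
  let t : C(G, G) := ContinuousMap.mulRight g
  have ht : ∀ a n (E : Coch A (n + 1)),
      act _ a (homotopy A t n E) = homotopy A t n (act _ a E) := fun a n E =>
    act_homotopy A t (U := ⊥)
      (fun x => Subgroup.mem_bot.2 (inv_mul_eq_one.2 (mul_assoc a⁻¹ x g).symm)) (rightInv_bot _ _)
  have hmem : act _ g (homotopy A t n F.1) ∈ fixedBy (TopRep.resolutionX A n) L := by
    intro l hl
    have h1 : act _ (g⁻¹ * l * g) (homotopy A t n F.1) = homotopy A t n F.1 := by
      rw [ht, F.2.1 _ (h l hl)]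
    nth_rewrite 2 [← h1]
    rw [← act_mul, ← act_mul]
    congr 1
    group
  have h1 := homotopy_dCoch A t n F.1
  rw [show dCoch A (n + 1) F.1 = 0 from F.2.2, map_zero, zero_add] at h1
  let F₂ : invCocycles A L n :=
    F' - ⟨dCoch A n (act _ g (homotopy A t n F.1)), dCoch_mem_fixedBy hmem, dCoch_dCoch _ _ _⟩
  have hF₂ : F₂.1 = act _ g (pull t (ContinuousLinearMap.id k A) (n + 1) F.1) := by
    change F'.1 - dCoch A n (act _ g (homotopy A t n F.1)) = _
    rw [dCoch_act, h1, hF, map_sub, sub_sub_cancel]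
  have hcls : clsK A L n F₂ = clsK A L n F' := by
    rw [← sub_eq_zero, ← map_sub]
    refine clsK_eq_zero_of_isInvBoundary A ⟨-act _ g (homotopy A t n F.1), neg_mem hmem, ?_, ?_⟩
    · rintro rfl
      exact (congrArg Neg.neg (map_zero (act A g))).trans neg_zero
    · rw [map_neg]
      change _ = F'.1 - dCoch A n (act _ g (homotopy A t n F.1)) - F'.1
      abel
  rw [← hcls]
  refine map_cochClass _ _ n _ _ ?_
  change _ = resCoch A L (n + 1) F₂.1
  rw [hF₂, act_eq_pull, pull_pull]
  have hl := pull_pull (A := A) (B := TopRep.res K.subtype A) (C := TopRep.res L.subtype A)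
    (inclG K : C(K, G)) (conjHom g h : C(L, K)) (ContinuousLinearMap.id k A) (A.ρ g) (n + 1) F.1
  have hr := pull_pull (A := A) (B := A) (C := TopRep.res L.subtype A)
    (t.comp (ContinuousMap.mulLeft g⁻¹)) (inclG L : C(L, G))
    ((A.ρ g).comp (ContinuousLinearMap.id k A)) (ContinuousLinearMap.id k A) (n + 1) F.1
  have hs : (inclG K : C(K, G)).comp (conjHom g h : C(L, K)) =
      (t.comp (ContinuousMap.mulLeft g⁻¹)).comp (inclG L : C(L, G)) := rfl
  rw [hs] at hl
  exact hl.trans hr.symm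

end SubgroupClasses

section Etale

/-! ### The étale space of a continuously varying family of subgroups -/

variable {k : Type*} [Ring k] [TopologicalSpace k]
  {G : Type u} [Group G] [TopologicalSpace G] [IsTopologicalGroup G]
  [CompactSpace G] [TotallyDisconnectedSpace G]
  {A : TopRep.{u} k G} {X : Type*} [TopologicalSpace X]

/-- A family of closed subgroups is upper semicontinuous if being contained in a given open subgroup
is an open condition. -/
structure IsUpperSemicontinuousFamily (K : X → Subgroup G) : Prop where
  isClosed : ∀ x, IsClosed (K x : Set G)
  isOpen : ∀ H : Subgroup G, IsOpen (H : Set G) → IsOpen {x | K x ≤ H}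

omit [TotallyDisconnectedSpace G] in
/-- A cocycle that is invariant under `K` is invariant under an open subgroup containing `K`. -/
lemma exists_open_invCocycles (hA : IsDiscreteRep A) {K : Subgroup G} {n : ℕ}
    (F : invCocycles A K n) :
    ∃ H : Subgroup G, IsOpen (H : Set G) ∧ K ≤ H ∧ F.1 ∈ invCocycles A H n :=
  ⟨stab _ F.1, (hA.resolutionX _).isOpen_stab _, fun _ hg => F.2.1 _ hg, fun _ hg => hg, F.2.2⟩

lemma exists_open_resK_eq (hA : IsDiscreteRep A) {K : Subgroup G} (hK : IsClosed (K : Set G))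
    {n : ℕ} (a : subgroupH n K A) :
    ∃ (H : Subgroup G) (h : K ≤ H) (c : subgroupH n H A), IsOpen (H : Set G) ∧
      (resK n h A).hom c = a := by
  obtain ⟨F, rfl⟩ := clsK_surjective hA hK n a
  obtain ⟨H, hH, hKH, hF⟩ := exists_open_invCocycles hA F
  exact ⟨H, hKH, clsK A H n ⟨F, hF⟩, hH, resK_clsK A hKH n _⟩

/-- Two classes with the same restriction to `K` have the same restriction to an open subgroup
containing `K`. -/
lemma exists_open_resK_eq_resK (hA : IsDiscreteRep A) {K H H' : Subgroup G}
    (hK : IsClosed (K : Set G)) (hH : IsOpen (H : Set G)) (hH' : IsOpen (H' : Set G))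
    (h : K ≤ H) (h' : K ≤ H') {n : ℕ} (c : subgroupH n H A) (c' : subgroupH n H' A)
    (hc : (resK n h A).hom c = (resK n h' A).hom c') :
    ∃ (L : Subgroup G), IsOpen (L : Set G) ∧ K ≤ L ∧ ∀ M ≤ L, ∃ (i : M ≤ H) (i' : M ≤ H'),
      (resK n i A).hom c = (resK n i' A).hom c' := by
  obtain ⟨F, rfl⟩ := clsK_surjective hA (Subgroup.isClosed_of_isOpen _ hH) n c
  obtain ⟨F', rfl⟩ := clsK_surjective hA (Subgroup.isClosed_of_isOpen _ hH') n c'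
  rw [resK_clsK, resK_clsK, ← sub_eq_zero, ← map_sub, clsK_eq_zero_iff hA hK] at hc
  obtain ⟨E, hE, h0, hEF⟩ := hc
  refine ⟨H ⊓ H' ⊓ stab _ E, (hH.inter hH').inter ((hA.resolutionX _).isOpen_stab _),
    le_inf (le_inf h h') fun g hg => hE g hg, fun M hM => ?_⟩
  have i : M ≤ H := fun g hg => (hM hg).1.1
  have i' : M ≤ H' := fun g hg => (hM hg).1.2
  refine ⟨i, i', ?_⟩
  rw [resK_clsK, resK_clsK, ← sub_eq_zero, ← map_sub]
  exact clsK_eq_zero_of_isInvBoundary A ⟨E, fun g hg => (hM hg).2, h0, hEF⟩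

variable {K : X → Subgroup G}

omit [CompactSpace G] [TotallyDisconnectedSpace G] in
lemma isOpen_basicSet (n : ℕ) {H : Subgroup G} (hH : IsOpen (H : Set G)) (c : subgroupH n H A)
    {U : Set X} (hU : IsOpen U) : IsOpen (EtaleH.basicSet K n A H c U) :=
  TopologicalSpace.isOpen_generateFrom_of_mem ⟨H, c, U, hH, hU, rfl⟩

/-- Sections that are locally restrictions of a class of an open subgroup are continuous. -/
lemma continuousOn_of_resK (hA : IsDiscreteRep A) (hK : IsUpperSemicontinuousFamily K) {n : ℕ}
    (s : ∀ x, subgroupH n (K x) A) {H : Subgroup G} (hH : IsOpen (H : Set G))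
    (c : subgroupH n H A) {U : Set X}
    (hs : ∀ y ∈ U, ∃ h : K y ≤ H, s y = (resK n h A).hom c) :
    ContinuousOn (EtaleH.ofFamily K n A s) U := by
  rw [continuousOn_iff_continuous_domRestrict]
  refine continuous_generateFrom_iff.2 ?_
  rintro _ ⟨H', c', U', hH', hU', rfl⟩
  rw [isOpen_iff_mem_nhds]
  rintro ⟨x, hx⟩ ⟨hxU', h', e'⟩
  obtain ⟨h, e⟩ := hs x hx
  obtain ⟨L, hL, hKL, hLe⟩ := exists_open_resK_eq_resK hA (hK.isClosed x) hH hH' h h' c c'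
    (e.symm.trans e'.symm)
  have hW : IsOpen (Subtype.val ⁻¹' (U' ∩ {y | K y ≤ L}) : Set U) :=
    (hU'.inter (hK.isOpen L hL)).preimage continuous_subtype_val
  filter_upwards [hW.mem_nhds ⟨hxU', hKL⟩]
  rintro ⟨y, hy⟩ ⟨hyU', hyL⟩
  obtain ⟨i, i', hii⟩ := hLe _ hyL
  obtain ⟨_, ey⟩ := hs y hy
  exact ⟨hyU', i', hii.symm.trans ey.symm⟩

theorem mem_contProd_iff_continuous (hA : IsDiscreteRep A) (hK : IsUpperSemicontinuousFamily K)
    {n : ℕ} (s : ∀ x, subgroupH n (K x) A) :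
    s ∈ contProd K n A ↔ Continuous (EtaleH.ofFamily K n A s) := by
  constructor
  · intro hs
    rw [continuous_iff_continuousAt]
    intro x
    obtain ⟨H, c, U, hH, hU, hx, hc⟩ := hs x
    exact (continuousOn_of_resK hA hK s hH c hc).continuousAt (hU.mem_nhds hx)
  · intro hs x
    obtain ⟨H, h, c, hH, hc⟩ := exists_open_resK_eq hA (hK.isClosed x) (s x)
    refine ⟨H, c, _, hH, (isOpen_basicSet n hH c isOpen_univ).preimage hs, ⟨trivial, h, hc⟩, ?_⟩
    rintro y ⟨-, hy, e⟩
    exact ⟨hy, e.symm⟩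

theorem isLocalHomeomorph_etaleH_proj (hA : IsDiscreteRep A) (hK : IsUpperSemicontinuousFamily K)
    (n : ℕ) : IsLocalHomeomorph (EtaleH.proj K n A) := by
  have hcont : Continuous (EtaleH.proj K n A) := by
    refine continuous_def.2 fun U hU => ?_
    rw [isOpen_iff_mem_nhds]
    intro a ha
    obtain ⟨H, h, c, hH, hc⟩ := exists_open_resK_eq hA (hK.isClosed a.1) a.2
    filter_upwards [(isOpen_basicSet n hH c hU).mem_nhds ⟨ha, h, hc⟩] with b hb using hb.1
  refine IsLocalHomeomorph.mk _ fun a => ?_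
  obtain ⟨H, h, c, hH, hc⟩ := exists_open_resK_eq hA (hK.isClosed a.1) a.2
  classical
  -- the section through `a` defined by `c`, extended by zero
  let s : ∀ x, subgroupH n (K x) A := fun x => if h : K x ≤ H then (resK n h A).hom c else 0
  have hs : ∀ y ∈ {x | K x ≤ H}, ∃ h : K y ≤ H, s y = (resK n h A).hom c :=
    fun y hy => ⟨hy, dif_pos hy⟩
  exact ⟨{
    toFun := EtaleH.proj K n A
    invFun := EtaleH.ofFamily K n A s
    source := EtaleH.basicSet K n A H c Set.univ
    target := {x | K x ≤ H}
    map_source' := fun b hb => hb.2.1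
    map_target' := fun y hy => ⟨trivial, hy, (hs y hy).2.symm⟩
    left_inv' := fun b hb => by
      obtain ⟨-, hb, e⟩ := hb
      exact Sigma.ext rfl (heq_of_eq ((hs b.1 hb).2.trans e))
    right_inv' := fun y hy => rfl
    open_source := isOpen_basicSet n hH c isOpen_univ
    open_target := hK.isOpen H hH
    continuousOn_toFun := hcont.continuousOn
    continuousOn_invFun := continuousOn_of_resK hA hK s hH c hs },
    ⟨trivial, h, hc⟩, fun _ _ => rfl⟩

/-- The continuous product in terms of cochains: the families that are locally the class of a fixed
cocycle on `G`. -/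
theorem mem_contProd_iff_exists_cocycle (hA : IsDiscreteRep A) {n : ℕ}
    {s : ∀ x, subgroupH n (K x) A} :
    s ∈ contProd K n A ↔ ∀ x, ∃ (F : Coch A (n + 1)) (U : Set X), IsOpen U ∧ x ∈ U ∧
      ∀ y ∈ U, ∃ hF : F ∈ invCocycles A (K y) n, s y = clsK A (K y) n ⟨F, hF⟩ := by
  constructor
  · intro hs x
    obtain ⟨H, c, U, hH, hU, hx, hc⟩ := hs x
    obtain ⟨F, rfl⟩ := clsK_surjective hA (Subgroup.isClosed_of_isOpen _ hH) n c
    refine ⟨F, U, hU, hx, fun y hy => ?_⟩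
    obtain ⟨h, e⟩ := hc y hy
    exact ⟨invCocycles_anti A h n F.2, e.trans (resK_clsK A h n F)⟩
  · intro hs x
    obtain ⟨F, U, hU, hx, hF⟩ := hs x
    obtain ⟨hFx, -⟩ := hF x hx
    have hst : F ∈ invCocycles A (stab (TopRep.resolutionX A (n + 1)) F) n :=
      ⟨fun g hg => hg, hFx.2⟩
    refine ⟨_, clsK A _ n ⟨F, hst⟩, U, (hA.resolutionX (n + 1)).isOpen_stab F, hU, hx,
      fun y hy => ?_⟩
    obtain ⟨hFy, e⟩ := hF y hy
    have h : K y ≤ stab (TopRep.resolutionX A (n + 1)) F := fun g hg => hFy.1 g hg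
    exact ⟨h, e.trans (resK_clsK A h n ⟨F, hst⟩).symm⟩

end Etale

section Selection

/-! ### Orbit spaces with a continuous section -/

/-- On a profinite space, local choices can be made locally constantly. -/
lemma exists_isLocallyConstant_of_local {X M : Type*} [TopologicalSpace X] [CompactSpace X]
    [T2Space X] [TotallyDisconnectedSpace X] (P : X → M → Prop)
    (h : ∀ x, ∃ (m : M) (U : Set X), IsOpen U ∧ x ∈ U ∧ ∀ y ∈ U, P y m) :
    ∃ φ : X → M, IsLocallyConstant φ ∧ ∀ x, P x (φ x) := by
  choose m U hU hx hP using h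
  obtain ⟨n, W, hW, hcov, hdisj⟩ :=
    TopologicalSpace.IsOpenCover.exists_finite_nonempty_disjoint_clopen_cover
      (U := fun x => (⟨U x, hU x⟩ : TopologicalSpace.Opens X))
      (TopologicalSpace.IsOpenCover.of_sets hU
        (Set.eq_univ_of_forall fun x => Set.mem_iUnion.2 ⟨x, hx x⟩))
  choose i hi using fun j => (hW j).2
  choose j hj using fun x => Set.mem_iUnion.1 (hcov (Set.mem_univ x))
  refine ⟨fun x => m (i (j x)), IsLocallyConstant.comp ?_ fun j => m (i j),
    fun x => hP _ x (hi _ (hj x))⟩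
  refine (IsLocallyConstant.iff_exists_open _).2 fun x => ⟨W (j x), (W (j x)).isOpen, hj x, ?_⟩
  intro y hy
  by_contra hne
  have hd : Disjoint (W (j y)) (W (j x)) := hdisj hne
  have : y ∈ W (j y) ⊓ W (j x) := ⟨hj y, hy⟩
  rw [hd.eq_bot] at this
  exact this

variable {G : Type*} [Group G] {Y : Type*} [TopologicalSpace Y] [MulAction G Y]
  (σ : OrbitSection G Y)

namespace OrbitSection

lemma injective : Function.Injective σ := fun x y h => by
  rw [← σ.isSection x, ← σ.isSection y]
  exact congrArg (orbitMk G) h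

lemma t2Space [T2Space Y] (σ : OrbitSection G Y) : T2Space (OrbitSpace G Y) :=
  T2Space.of_injective_continuous σ.injective σ.continuous_toFun

lemma totallyDisconnectedSpace [TotallyDisconnectedSpace Y] (σ : OrbitSection G Y) :
    TotallyDisconnectedSpace (OrbitSpace G Y) :=
  ⟨isTotallyDisconnected_of_image σ.continuous_toFun.continuousOn σ.injective
    (isTotallyDisconnected_of_totallyDisconnectedSpace _)⟩

lemma exists_eq_smul (y : Y) : ∃ (g : G) (x : OrbitSpace G Y), y = g • σ x := by
  obtain ⟨g, hg⟩ := σ.exists_smul y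
  exact ⟨g⁻¹, _, by rw [← hg, inv_smul_smul]⟩

lemma orbitMk_smul (g : G) (x : OrbitSpace G Y) : orbitMk G (g • σ x) = x :=
  (Quotient.sound (orbitRel_apply.2 ⟨g, rfl⟩) : orbitMk G (g • σ x) = orbitMk G (σ x)).trans
    (σ.isSection x)

variable [TopologicalSpace G] [CompactSpace G] [T2Space Y] [ContinuousSMul G Y]
  [CompactSpace Y]

omit [CompactSpace Y] in
/-- The stabilizers of the points of a section vary upper semicontinuously. -/
lemma isUpperSemicontinuousFamily {G : Type u} [Group G] [TopologicalSpace G] [CompactSpace G]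
    [MulAction G Y] [ContinuousSMul G Y] (σ : OrbitSection G Y) :
    IsUpperSemicontinuousFamily fun x => stabilizer G (σ x) where
  isClosed x := isClosed_eq (f := fun g : G => g • σ x) (by fun_prop) continuous_const
  isOpen H hH := by
    have hc : IsClosed {p : G × OrbitSpace G Y | p.1 ∉ H ∧ p.1 • σ p.2 = σ p.2} := by
      have hσ : Continuous σ := σ.continuous_toFun
      exact (hH.isClosed_compl.preimage continuous_fst).inter
        (isClosed_eq (by fun_prop) (by fun_prop))
    have h := isClosedMap_snd_of_compactSpace _ hc
    convert h.isOpen_compl using 1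
    ext x
    constructor
    · rintro hx ⟨⟨g, y⟩, ⟨hg, hgy⟩, rfl⟩
      exact hg (hx hgy)
    · intro hx g hg
      by_contra hgH
      exact hx ⟨(g, x), ⟨hgH, hg⟩, rfl⟩

/-- The translates of a section cover the space, so continuity can be checked on `G × G \ Y`. -/
lemma isQuotientMap_smul : Topology.IsQuotientMap fun p : G × OrbitSpace G Y => p.1 • σ p.2 := by
  have hσ : Continuous σ := σ.continuous_toFun
  have hc : Continuous fun p : G × OrbitSpace G Y => p.1 • σ p.2 := by fun_prop
  exact hc.isClosedMap.isQuotientMap hc fun y => by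
    obtain ⟨g, x, h⟩ := σ.exists_eq_smul y
    exact ⟨(g, x), h.symm⟩

end OrbitSection

end Selection

section EquivariantFunctions

/-! ### Equivariant functions on a `G`-space -/

variable {k : Type*} [Ring k] [TopologicalSpace k]
  {G : Type*} [Group G] [TopologicalSpace G]
  {Y : Type*} [TopologicalSpace Y] [MulAction G Y]

/-- The locally constant equivariant functions from a `G`-space to a representation. -/
def equivariantFun (Y : Type*) [TopologicalSpace Y] [MulAction G Y] (R : TopRep k G) :
    AddSubgroup (Y → R) where
  carrier := {Φ | IsLocallyConstant Φ ∧ ∀ (g : G) y, Φ (g • y) = act R g (Φ y)}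
  zero_mem' := ⟨IsLocallyConstant.const 0, fun _ _ => (map_zero _).symm⟩
  add_mem' {Φ Ψ} hΦ hΨ := ⟨hΦ.1.add hΨ.1, fun g y => by
    rw [Pi.add_apply, Pi.add_apply, hΦ.2, hΨ.2, map_add]⟩
  neg_mem' {Φ} hΦ := ⟨hΦ.1.neg, fun g y => by rw [Pi.neg_apply, Pi.neg_apply, hΦ.2, map_neg]⟩

/-- Equivariant functions that vanish at a point. -/
def equivariantFunPointed (y₀ : Y) (R : TopRep k G) : AddSubgroup (Y → R) :=
  equivariantFun Y R ⊓ (Pi.evalAddMonoidHom (fun _ => R) y₀).ker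

omit [TopologicalSpace G] in
lemma const_mem_equivariantFun {R : TopRep k G} {a : R} (ha : a ∈ fixedBy R ⊤) :
    (fun _ => a) ∈ equivariantFun Y R :=
  ⟨IsLocallyConstant.const a, fun g _ => (ha g trivial).symm⟩

omit [TopologicalSpace G] in
lemma apply_mem_fixedBy {R : TopRep k G} {Φ : Y → R} (hΦ : Φ ∈ equivariantFun Y R) (y : Y) :
    Φ y ∈ fixedBy R (stabilizer G y) := fun g hg => by
  rw [← hΦ.2, mem_stabilizer_iff.1 hg]

/-- An equivariant function is determined by arbitrary locally constant values, fixed by the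
stabilizers, on a section of the orbit space. -/
lemma exists_equivariantFun [CompactSpace G] [T2Space Y] [ContinuousSMul G Y] [CompactSpace Y]
    (σ : OrbitSection G Y) {R : TopRep k G} (hR : IsDiscreteRep R) {φ : OrbitSpace G Y → R}
    (hφ : IsLocallyConstant φ) (hfix : ∀ x, φ x ∈ fixedBy R (stabilizer G (σ x))) :
    ∃ Φ ∈ equivariantFun Y R, ∀ x, Φ (σ x) = φ x := by
  have := hR.discrete
  choose γ hγ using σ.exists_smul
  have key : ∀ (g : G) x, act R (γ (g • σ x))⁻¹ (φ (orbitMk G (g • σ x))) = act R g (φ x) := by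
    intro g x
    rw [σ.orbitMk_smul]
    have h := hγ (g • σ x)
    rw [σ.orbitMk_smul, smul_smul] at h
    have h2 := hfix x _ h
    nth_rewrite 1 [← h2]
    rw [← act_mul, inv_mul_cancel_left]
  refine ⟨fun y => act R (γ y)⁻¹ (φ (orbitMk G y)), ⟨?_, ?_⟩, fun x => ?_⟩
  · rw [IsLocallyConstant.iff_continuous, σ.isQuotientMap_smul.continuous_iff]
    have hc : Continuous fun p : G × OrbitSpace G Y => R.ρ p.1 (φ p.2) :=
      hR.continuous_action.comp (f := fun p : G × OrbitSpace G Y => (p.1, φ p.2))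
        (continuous_fst.prodMk (hφ.continuous.comp continuous_snd))
    exact hc.congr fun p => (key p.1 p.2).symm
  · intro g y
    obtain ⟨h, x, rfl⟩ := σ.exists_eq_smul y
    dsimp only
    rw [key, smul_smul, key, act_mul]
  · have := key 1 x
    rwa [one_smul, act_one] at this

variable {G : Type u} [Group G] [TopologicalSpace G] [MulAction G Y] [IsTopologicalGroup G]
  (A : TopRep.{u} k G)

/-- The differential of the standard resolution applied to the values of equivariant functions. -/
def dEquivariant (Y : Type*) [TopologicalSpace Y] [MulAction G Y] (n : ℕ) :
    equivariantFun Y (TopRep.resolutionX A n) →+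
      equivariantFun Y (TopRep.resolutionX A (n + 1)) where
  toFun Φ := ⟨fun y => dCoch A n (Φ.1 y), Φ.2.1.comp _, fun g y => by
    rw [← dCoch_act, ← Φ.2.2]⟩
  map_zero' := Subtype.ext (funext fun _ => map_zero _)
  map_add' _ _ := Subtype.ext (funext fun _ => map_add _ _ _)

/-- The differential on equivariant functions that vanish at a point. -/
def dEquivariantPointed (y₀ : Y) (n : ℕ) :
    equivariantFunPointed y₀ (TopRep.resolutionX A n) →+
      equivariantFunPointed y₀ (TopRep.resolutionX A (n + 1)) where
  toFun Φ := ⟨dEquivariant A Y n ⟨Φ, Φ.2.1⟩, (dEquivariant A Y n ⟨Φ, Φ.2.1⟩).2, by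
    change dCoch A n (Φ.1 y₀) = 0
    rw [show Φ.1 y₀ = 0 from Φ.2.2, map_zero]⟩
  map_zero' := Subtype.ext (funext fun _ => map_zero _)
  map_add' _ _ := Subtype.ext (funext fun _ => map_add _ _ _)

variable {A} in
lemma apply_mem_invCocycles {n : ℕ} {Φ : Y → Coch A (n + 1)}
    (hΦ : Φ ∈ equivariantFun Y (TopRep.resolutionX A (n + 1)))
    (hd : ∀ y, dCoch A (n + 1) (Φ y) = 0) (y : Y) :
    Φ y ∈ invCocycles A (stabilizer G y) n := ⟨apply_mem_fixedBy hΦ y, hd y⟩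

variable [CompactSpace G] [TotallyDisconnectedSpace G] [CompactSpace Y] [T2Space Y]
  [TotallyDisconnectedSpace Y] [ContinuousSMul G Y] (σ : OrbitSection G Y)

variable {A} in
omit [CompactSpace Y] [T2Space Y] [TotallyDisconnectedSpace Y] [ContinuousSMul G Y] in
lemma class_mem_contProd (hA : IsDiscreteRep A) {n : ℕ} {Φ : Y → Coch A (n + 1)}
    (hΦ : Φ ∈ equivariantFun Y (TopRep.resolutionX A (n + 1)))
    (hd : ∀ y, dCoch A (n + 1) (Φ y) = 0) :
    (fun x => clsK A (stabilizer G (σ x)) n ⟨Φ (σ x), apply_mem_invCocycles hΦ hd (σ x)⟩) ∈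
      contProd (fun x => stabilizer G (σ x)) n A := by
  rw [mem_contProd_iff_exists_cocycle hA]
  intro x
  refine ⟨Φ (σ x), {y | Φ (σ y) = Φ (σ x)},
    (hΦ.1.comp_continuous σ.continuous_toFun).isOpen_fiber _, rfl, fun y hy => ?_⟩
  have hy' : Φ (σ y) = Φ (σ x) := hy
  refine ⟨hy' ▸ apply_mem_invCocycles hΦ hd (σ y), ?_⟩
  congr 1
  exact Subtype.ext hy'

variable {A} in
/-- Every element of the continuous product is the family of classes of an equivariant cocycle:
local cocycles representing it are patched on the orbit space and extended equivariantly. -/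
lemma exists_class_eq (hA : IsDiscreteRep A) {n : ℕ} {s : ∀ x, subgroupH n (stabilizer G (σ x)) A}
    (hs : s ∈ contProd (fun x => stabilizer G (σ x)) n A) :
    ∃ (Φ : Y → Coch A (n + 1)) (hΦ : Φ ∈ equivariantFun Y (TopRep.resolutionX A (n + 1)))
      (hd : ∀ y, dCoch A (n + 1) (Φ y) = 0), ∀ x,
      clsK A (stabilizer G (σ x)) n ⟨Φ (σ x), apply_mem_invCocycles hΦ hd (σ x)⟩ = s x := by
  have := σ.t2Space
  have := σ.totallyDisconnectedSpace
  obtain ⟨φ, hφ, hφs⟩ := exists_isLocallyConstant_of_local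
    (fun x F => ∃ hF : F ∈ invCocycles A (stabilizer G (σ x)) n, s x = clsK A _ n ⟨F, hF⟩)
    ((mem_contProd_iff_exists_cocycle hA).1 hs)
  obtain ⟨Φ, hΦ, hΦφ⟩ := exists_equivariantFun σ (hA.resolutionX (n + 1)) hφ
    fun x => (hφs x).1.1
  have hd : ∀ y, dCoch A (n + 1) (Φ y) = 0 := by
    intro y
    obtain ⟨g, x, rfl⟩ := σ.exists_eq_smul y
    rw [hΦ.2, dCoch_act, hΦφ, show dCoch A (n + 1) (φ x) = 0 from (hφs x).1.2, map_zero]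
  refine ⟨Φ, hΦ, hd, fun x => ?_⟩
  obtain ⟨hF, e⟩ := hφs x
  rw [e]
  congr 1
  exact Subtype.ext (hΦφ x)

variable {A} in
/-- An equivariant cocycle with trivial classes is the coboundary of an equivariant function: local
primitives are patched on the orbit space and extended equivariantly. -/
lemma class_eq_zero_iff (hA : IsDiscreteRep A) {n : ℕ} {Φ : Y → Coch A (n + 1)}
    (hΦ : Φ ∈ equivariantFun Y (TopRep.resolutionX A (n + 1)))
    (hd : ∀ y, dCoch A (n + 1) (Φ y) = 0) :
    (∀ x, clsK A (stabilizer G (σ x)) n ⟨Φ (σ x), apply_mem_invCocycles hΦ hd (σ x)⟩ = 0) ↔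
      ∃ Ψ ∈ equivariantFun Y (TopRep.resolutionX A n), (n = 0 → Ψ = 0) ∧
        ∀ y, dCoch A n (Ψ y) = Φ y := by
  constructor
  · intro h
    have := σ.t2Space
    have := σ.totallyDisconnectedSpace
    have hK := σ.isUpperSemicontinuousFamily
    obtain ⟨ψ, hψ, hψΦ⟩ := exists_isLocallyConstant_of_local
      (fun x E => E ∈ fixedBy (TopRep.resolutionX A n) (stabilizer G (σ x)) ∧
        (n = 0 → E = 0) ∧ dCoch A n E = Φ (σ x)) (fun x => by
        obtain ⟨E, hE, h0, hEΦ⟩ := (clsK_eq_zero_iff hA (hK.isClosed x) n _).1 (h x)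
        refine ⟨E, {y | Φ (σ y) = Φ (σ x)} ∩ {y | stabilizer G (σ y) ≤ stab _ E},
          ((hΦ.1.comp_continuous σ.continuous_toFun).isOpen_fiber _).inter
            (hK.isOpen _ ((hA.resolutionX n).isOpen_stab E)), ⟨rfl, fun g hg => hE g hg⟩, ?_⟩
        rintro y ⟨hy, hy'⟩
        exact ⟨fun g hg => hy' hg, h0, hEΦ.trans (Eq.symm hy)⟩)
    obtain ⟨Ψ, hΨ, hΨψ⟩ := exists_equivariantFun σ (hA.resolutionX n) hψ fun x => (hψΦ x).1
    refine ⟨Ψ, hΨ, fun hn => funext fun y => ?_, fun y => ?_⟩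
    · obtain ⟨g, x, rfl⟩ := σ.exists_eq_smul y
      rw [hΨ.2, hΨψ, (hψΦ x).2.1 hn, map_zero]
      rfl
    · obtain ⟨g, x, rfl⟩ := σ.exists_eq_smul y
      rw [hΨ.2, hΨψ, dCoch_act, (hψΦ x).2.2, hΦ.2]
  · rintro ⟨Ψ, hΨ, h0, hd'⟩ x
    exact clsK_eq_zero_of_isInvBoundary A ⟨Ψ (σ x), apply_mem_fixedBy hΨ _,
      fun hn => by rw [h0 hn]; rfl, hd' _⟩

end EquivariantFunctions

section Presentations

/-! ### Complexes computing the terms of the sequence -/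

variable {k : Type*} [Ring k] [TopologicalSpace k]
  {G : Type u} [Group G] [TopologicalSpace G] [IsTopologicalGroup G]

/-- The differential on invariant cochains. -/
def dInvariant (A : TopRep.{u} k G) (n : ℕ) :
    fixedBy (TopRep.resolutionX A n) ⊤ →+ fixedBy (TopRep.resolutionX A (n + 1)) ⊤ where
  toFun F := ⟨dCoch A n F, dCoch_mem_fixedBy F.2⟩
  map_zero' := Subtype.ext (map_zero _)
  map_add' _ _ := Subtype.ext (map_add _ _ _)

/-- A cocycle of the complex of invariant cochains, as an invariant cocycle. -/
def toInvCocycles (A : TopRep.{u} k G) (n : ℕ) :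
    (dInvariant A (n + 1)).ker →+ invCocycles A ⊤ n where
  toFun F := ⟨F.1.1, F.1.2, congrArg Subtype.val F.2⟩
  map_zero' := rfl
  map_add' _ _ := rfl

/-- The invariant cochains compute `Hⁿ(G, A)`. -/
noncomputable def groupPresentation (A : TopRep.{u} k G) :
    CohomologyPresentation (fun n => dInvariant A (n + 1)) fun n => continuousCohomology n A where
  d_d n F := Subtype.ext (dCoch_dCoch A (n + 1) F)
  cls n := (cochClass A n).comp (toInvCocycles A n)
  cls_surjective n x := by
    obtain ⟨F, rfl⟩ := cochClass_surjective A n x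
    exact ⟨⟨⟨F.1, F.2.1⟩, Subtype.ext F.2.2⟩, rfl⟩
  cls_zero_eq_zero F hF := by
    obtain ⟨E, -, h0, hE⟩ := (cochClass_eq_zero_iff A 0 _).1 hF
    rw [h0 rfl, map_zero] at hE
    exact Subtype.ext (Subtype.ext hE.symm)
  cls_succ_eq_zero n F := by
    refine (cochClass_eq_zero_iff A (n + 1) _).trans ⟨?_, ?_⟩
    · rintro ⟨E, hE, -, h⟩
      exact ⟨⟨E, hE⟩, Subtype.ext h⟩
    · rintro ⟨E, hE⟩
      exact ⟨E.1, E.2, by simp, congrArg Subtype.val hE⟩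

/-- A section passes through every fixed point. -/
lemma OrbitSection.apply_orbitMk_of_fixed {G Y : Type*} [Group G] [TopologicalSpace Y]
    [MulAction G Y] (σ : OrbitSection G Y) {y₀ : Y} (h₀ : ∀ g : G, g • y₀ = y₀) :
    σ (orbitMk G y₀) = y₀ := by
  obtain ⟨g, hg⟩ := σ.exists_smul y₀
  rw [← hg, h₀]

section

variable {G Y : Type*} [Group G] [TopologicalSpace G] [TopologicalSpace Y] [MulAction G Y]
  {y₀ : Y} {R : TopRep k G} {Φ : Y → R}

omit [TopologicalSpace G] in
lemma const_sub_mem (hΦ : Φ ∈ equivariantFun Y R) {a : R} (ha : a ∈ fixedBy R ⊤) (h : Φ y₀ = a) :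
    (fun y => Φ y - a) ∈ equivariantFunPointed y₀ R :=
  ⟨(equivariantFun Y R).sub_mem hΦ (const_mem_equivariantFun ha), sub_eq_zero.2 h⟩

omit [TopologicalSpace G] in
lemma apply_mem_fixedBy_top (h₀ : ∀ g : G, g • y₀ = y₀) (hΦ : Φ ∈ equivariantFun Y R) :
    Φ y₀ ∈ fixedBy R ⊤ := fun g _ => by
  rw [← hΦ.2, h₀]

end

variable [CompactSpace G] [TotallyDisconnectedSpace G]
  {Y : Type*} [TopologicalSpace Y] [MulAction G Y] [CompactSpace Y] [T2Space Y]
  [TotallyDisconnectedSpace Y] [ContinuousSMul G Y] (σ : OrbitSection G Y)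
  {A : TopRep.{u} k G}

/-- The value of an equivariant cocycle at a point. -/
def evalCocycle (A : TopRep.{u} k G) (n : ℕ) (y : Y) :
    (dEquivariant A Y (n + 1)).ker →+ invCocycles A (stabilizer G y) n where
  toFun Φ := ⟨Φ.1.1 y, apply_mem_invCocycles Φ.1.2 (congrFun (congrArg Subtype.val Φ.2)) y⟩
  map_zero' := rfl
  map_add' _ _ := rfl

/-- The family of the classes of the values of an equivariant cocycle on a section. -/
noncomputable def classFamily (A : TopRep.{u} k G) (n : ℕ) :
    (dEquivariant A Y (n + 1)).ker →+ ∀ x, subgroupH n (stabilizer G (σ x)) A :=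
  AddMonoidHom.pi fun x => (clsK A (stabilizer G (σ x)) n).comp (evalCocycle A n (σ x))

/-- A cocycle that vanishes at `y₀`, as a cocycle. -/
def forgetPointed (A : TopRep.{u} k G) (y₀ : Y) (n : ℕ) :
    (dEquivariantPointed A y₀ (n + 1)).ker →+ (dEquivariant A Y (n + 1)).ker where
  toFun Φ := ⟨⟨Φ.1.1, Φ.1.2.1⟩, by
    have h : dEquivariantPointed A y₀ (n + 1) Φ.1 = 0 := Φ.2
    have h' := congrArg Subtype.val h
    exact Subtype.ext h'⟩
  map_zero' := rfl
  map_add' _ _ := rfl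

omit [CompactSpace Y] [T2Space Y] [TotallyDisconnectedSpace Y] [ContinuousSMul G Y] in
lemma classFamily_mem (hA : IsDiscreteRep A) (n : ℕ) (Φ : (dEquivariant A Y (n + 1)).ker) :
    classFamily σ A n Φ ∈ contProd (fun x => stabilizer G (σ x)) n A :=
  class_mem_contProd σ hA Φ.1.2 (congrFun (congrArg Subtype.val Φ.2))

lemma classFamily_eq_zero_iff (hA : IsDiscreteRep A) (n : ℕ)
    (Φ : (dEquivariant A Y (n + 1)).ker) :
    classFamily σ A n Φ = 0 ↔ ∃ Ψ ∈ equivariantFun Y (TopRep.resolutionX A n),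
      (n = 0 → Ψ = 0) ∧ ∀ y, dCoch A n (Ψ y) = Φ.1.1 y :=
  funext_iff.trans (class_eq_zero_iff σ hA Φ.1.2 (congrFun (congrArg Subtype.val Φ.2)))

/-- The equivariant functions on a `G`-space with values in the standard resolution compute the
continuous product of the cohomology groups of the stabilizers. -/
noncomputable def orbitPresentation (hA : IsDiscreteRep A) :
    CohomologyPresentation (fun n => dEquivariant A Y (n + 1))
      fun n => contProd (fun x => stabilizer G (σ x)) n A where
  d_d n Φ := Subtype.ext (funext fun y => dCoch_dCoch A (n + 1) (Φ.1 y))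
  cls n := (classFamily σ A n).codRestrict _ (classFamily_mem σ hA n)
  cls_surjective n s := by
    obtain ⟨Φ, hΦ, hd, h⟩ := exists_class_eq σ hA s.2
    exact ⟨⟨⟨Φ, hΦ⟩, Subtype.ext (funext hd)⟩, Subtype.ext (funext h)⟩
  cls_zero_eq_zero Φ hΦ := by
    obtain ⟨Ψ, -, h0, h⟩ := (classFamily_eq_zero_iff σ hA 0 Φ).1 (congrArg Subtype.val hΦ)
    refine Subtype.ext (Subtype.ext (funext fun y => (h y).symm.trans ?_))
    rw [h0 rfl]
    exact map_zero _
  cls_succ_eq_zero n Φ := by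
    refine Subtype.ext_iff.trans ((classFamily_eq_zero_iff σ hA (n + 1) Φ).trans ⟨?_, ?_⟩)
    · rintro ⟨Ψ, hΨ, -, h⟩
      exact ⟨⟨Ψ, hΨ⟩, Subtype.ext (funext h)⟩
    · rintro ⟨Ψ, hΨ⟩
      exact ⟨Ψ.1, Ψ.2, by simp, congrFun (congrArg Subtype.val hΨ)⟩

variable {y₀ : Y} (h₀ : ∀ g : G, g • y₀ = y₀)

/-- The equivariant functions that vanish at a fixed point compute the continuous product over the
orbit space pointed by that point: constant functions can be subtracted. -/
noncomputable def pointedPresentation (hA : IsDiscreteRep A) :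
    CohomologyPresentation (fun n => dEquivariantPointed A y₀ (n + 1))
      fun n => contProdPointed (fun x => stabilizer G (σ x)) n A (orbitMk G y₀) where
  d_d n Φ := Subtype.ext (funext fun y => dCoch_dCoch A (n + 1) (Φ.1 y))
  cls n := ((classFamily σ A n).comp (forgetPointed A y₀ n)).codRestrict _ fun Φ =>
    ⟨classFamily_mem σ hA n (forgetPointed A y₀ n Φ), by
      refine (congrArg (clsK A _ n) (Subtype.ext ?_)).trans (map_zero (clsK A _ n))
      change Φ.1.1 (σ (orbitMk G y₀)) = 0
      rw [σ.apply_orbitMk_of_fixed h₀]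
      exact Φ.1.2.2⟩
  cls_surjective n s := by
    obtain ⟨Φ, hΦ, hd, h⟩ := exists_class_eq σ hA s.2.1
    -- the value of `Φ` at the base point bounds an invariant cochain `E`
    have hb : IsInvBoundary A (stabilizer G (σ (orbitMk G y₀))) n (Φ (σ (orbitMk G y₀))) := by
      refine (clsK_eq_zero_iff hA (σ.isUpperSemicontinuousFamily.isClosed _) n
        ⟨_, apply_mem_invCocycles hΦ hd _⟩).1 ?_
      rw [h]
      exact s.2.2
    rw [σ.apply_orbitMk_of_fixed h₀] at hb
    obtain ⟨E, hE, h0, hEΦ⟩ := hb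
    have hE' : E ∈ fixedBy (TopRep.resolutionX A n) ⊤ := fun g _ => hE g (h₀ g)
    have hd' : ∀ y, dCoch A (n + 1) (Φ y - dCoch A n E) = 0 := fun y => by
      rw [map_sub, hd, dCoch_dCoch, sub_zero]
    refine ⟨⟨⟨fun y => Φ y - dCoch A n E,
      const_sub_mem hΦ (dCoch_mem_fixedBy hE') hEΦ.symm⟩, Subtype.ext (funext hd')⟩,
      Subtype.ext (funext fun x => ?_)⟩
    refine Eq.trans ?_ (h x)
    rw [← sub_eq_zero]
    refine (map_sub (clsK A _ n) _ _).symm.trans (clsK_eq_zero_of_isInvBoundary A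
      ⟨-E, neg_mem (fixedBy_anti _ le_top hE'), fun hn => by rw [h0 hn, neg_zero], ?_⟩)
    rw [map_neg]
    change _ = Φ (σ x) - dCoch A n E - Φ (σ x)
    abel
  cls_zero_eq_zero Φ hΦ := by
    obtain ⟨Ψ, -, h0, h⟩ := (classFamily_eq_zero_iff σ hA 0 (forgetPointed A y₀ 0 Φ)).1
      (congrArg Subtype.val hΦ)
    refine Subtype.ext (Subtype.ext (funext fun y => (h y).symm.trans ?_))
    rw [h0 rfl]
    exact map_zero _
  cls_succ_eq_zero n Φ := by
    refine Subtype.ext_iff.trans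
      ((classFamily_eq_zero_iff σ hA (n + 1) (forgetPointed A y₀ (n + 1) Φ)).trans ⟨?_, ?_⟩)
    · rintro ⟨Ψ, hΨ, -, h⟩
      have hz : dCoch A (n + 1) (Ψ y₀) = 0 := (h y₀).trans Φ.1.2.2
      refine ⟨⟨fun y => Ψ y - Ψ y₀, const_sub_mem hΨ (apply_mem_fixedBy_top h₀ hΨ) rfl⟩,
        Subtype.ext (funext fun y => ?_)⟩
      change dCoch A (n + 1) (Ψ y - Ψ y₀) = _
      rw [map_sub, hz, sub_zero, h]
      rfl
    · rintro ⟨Ψ, hΨ⟩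
      exact ⟨Ψ.1, Ψ.2.1, by simp, congrFun (congrArg Subtype.val hΨ)⟩

end Presentations

section Coefficients

/-! ### Locally constant functions on a pro-`π` tree -/

lemma isLocallyConstant_toZModPow {p : ℕ} [Fact p.Prime] (n : ℕ) :
    IsLocallyConstant (PadicInt.toZModPow (p := p) n) := by
  refine (IsLocallyConstant.iff_exists_open _).2 fun x =>
    ⟨Metric.ball x ((p : ℝ) ^ (-n : ℤ)), Metric.isOpen_ball, Metric.mem_ball_self
      (zpow_pos (by exact_mod_cast (Fact.out : p.Prime).pos) _), fun y hy => ?_⟩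
  rw [← sub_eq_zero, ← map_sub, ← RingHom.mem_ker, PadicInt.ker_toZModPow,
    ← PadicInt.norm_le_pow_iff_mem_span_pow]
  exact (mem_ball_iff_norm.1 hy).le

/-- The reduction of the pro-`π` integers modulo a positive integer whose prime factors lie in
`π`. -/
lemma exists_zHat_ringHom_zmod (π : Set Nat.Primes) (m : ℕ) (hm : 0 < m)
    (hπ : ∀ p : Nat.Primes, (p : ℕ) ∣ m → p ∈ π) :
    ∃ ρ : ZHat π →+* ZMod m, IsLocallyConstant ρ := by
  induction m using Nat.recOnPosPrimePosCoprime with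
  | zero => exact absurd hm (lt_irrefl 0)
  | one => exact ⟨⟨⟨⟨fun _ => 1, Subsingleton.elim _ _⟩, fun _ _ => Subsingleton.elim _ _⟩,
      Subsingleton.elim _ _, fun _ _ => Subsingleton.elim _ _⟩,
      IsLocallyConstant.of_constant _ fun _ _ => Subsingleton.elim _ _⟩
  | prime_pow p n hp hn =>
    let q : π := ⟨⟨p, hp⟩, hπ ⟨p, hp⟩ (dvd_pow_self p hn.ne')⟩
    have : Fact p.Prime := ⟨hp⟩
    exact ⟨(PadicInt.toZModPow (p := p) n).comp (Pi.evalRingHom _ q),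
      (isLocallyConstant_toZModPow (p := p) n).comp_continuous (continuous_apply q)⟩
  | coprime a b ha hb hab iha ihb =>
    obtain ⟨ρ, hρ⟩ := iha (by omega) fun p hp => hπ p (hp.mul_right b)
    obtain ⟨τ, hτ⟩ := ihb (by omega) fun p hp => hπ p (hp.mul_left a)
    exact ⟨(ZMod.chineseRemainder hab).symm.toRingHom.comp (ρ.prod τ),
      (hρ.comp₂ hτ Prod.mk).comp (ZMod.chineseRemainder hab).symm⟩

/-- Every element of `B` is killed by a positive integer whose prime factors lie in `π`. -/
def IsPrimary (π : Set Nat.Primes) (B : Type*) [AddCommGroup B] : Prop :=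
  ∀ b : B, ∃ m : ℕ, 0 < m ∧ m • b = 0 ∧ ∀ p : Nat.Primes, (p : ℕ) ∣ m → p ∈ π

lemma IsPrimary.exists_smul_eq_zero {π : Set Nat.Primes} {B : Type*} [AddCommGroup B]
    (hB : IsPrimary π B) {X : Type*} [TopologicalSpace X] [CompactSpace X] {f : X → B}
    (hf : IsLocallyConstant f) :
    ∃ m : ℕ, 0 < m ∧ (∀ x, m • f x = 0) ∧ ∀ p : Nat.Primes, (p : ℕ) ∣ m → p ∈ π := by
  choose μ hpos hμ hπ using hB
  refine ⟨∏ b ∈ hf.range_finite.toFinset, μ b, Finset.prod_pos fun b _ => hpos b, fun x => ?_,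
    fun p hp => ?_⟩
  · obtain ⟨c, hc⟩ := Finset.dvd_prod_of_mem μ (hf.range_finite.mem_toFinset.2 ⟨x, rfl⟩)
    rw [hc, mul_comm, mul_smul, hμ, smul_zero]
  · obtain ⟨b, -, hb⟩ := (Prime.dvd_finsetProd_iff p.2.prime _).1 hp
    exact hπ b p hb

end Coefficients

section Topology

variable (R : Type*) [CommRing R] [TopologicalSpace R] (X : Type*) [TopologicalSpace X]

/-- The topology of `R⟦X⟧` as an inverse limit of the spaces `R[S]`. -/
noncomputable instance : TopologicalSpace (FreeProfinite R X) :=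
  TopologicalSpace.induced
    (fun m => (fun S s => m.1 S s : ∀ S : DiscreteQuotient X, S → R)) inferInstance

variable {R X}

lemma continuous_coefficient (S : DiscreteQuotient X) (s : S) :
    Continuous fun m : FreeProfinite R X => m.1 S s := by
  have h : Continuous fun m : FreeProfinite R X =>
    (fun S s => m.1 S s : ∀ S : DiscreteQuotient X, S → R) := continuous_induced_dom
  exact (continuous_pi_iff.1 (continuous_pi_iff.1 h S)) s

variable [CompactSpace X]

lemma continuous_extend {N : Type*} [AddCommGroup N] [Module R N] [TopologicalSpace N]
    [ContinuousAdd N] (hN : ∀ c : N, Continuous fun r : R => r • c) (f : LocallyConstant X N) :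
    Continuous (extend R f) := by
  have := Fintype.ofFinite f.discreteQuotient
  have h : ∀ m, extend R f m = ∑ s : f.discreteQuotient, m.1 f.discreteQuotient s • f.lift s := by
    intro m
    rw [extend_apply, Finsupp.linearCombination_apply, Finsupp.sum_fintype]
    exact fun s => zero_smul R _
  exact (continuous_finsetSum _ fun s _ =>
    (hN (f.lift s)).comp (continuous_coefficient _ s)).congr fun m => (h m).symm

lemma mapDomain_apply_fintype {α β M : Type*} [Fintype α] [DecidableEq β] [AddCommMonoid M]
    (f : α → β) (x : α →₀ M) (t : β) : x.mapDomain f t = ∑ s with f s = t, x s := by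
  rw [Finsupp.mapDomain, Finsupp.sum_fintype _ _ fun _ => Finsupp.single_zero _,
    Finsupp.finsetSum_apply, Finset.sum_filter]
  exact Finset.sum_congr rfl fun s _ => Finsupp.single_apply

/-- The compatibility conditions that define `R⟦X⟧` are closed, as they involve finite sums only. -/
lemma isClosed_range_coefficients [IsTopologicalRing R] [T2Space R] :
    IsClosed (Set.range fun m : FreeProfinite R X =>
      (fun S s => m.1 S s : ∀ S : DiscreteQuotient X, S → R)) := by
  classical
  have (S : DiscreteQuotient X) : Fintype S := Fintype.ofFinite S
  have h : (Set.range fun m : FreeProfinite R X =>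
      (fun S s => m.1 S s : ∀ S : DiscreteQuotient X, S → R)) =
      ⋂ (S : DiscreteQuotient X) (S' : DiscreteQuotient X) (hS : S ≤ S') (t : S'),
        {a | ∑ s : S with DiscreteQuotient.ofLE hS s = t, a S s = a S' t} := by
    ext a
    simp only [Set.mem_iInter, Set.mem_ofPred_eq]
    constructor
    · rintro ⟨m, rfl⟩ S S' hS t
      rw [← mapDomain_apply_fintype]
      exact congr($(m.2 S S' hS) t)
    · intro ha
      refine ⟨⟨fun S => Finsupp.equivFunOnFinite.symm (a S),
        fun S S' hS => Finsupp.ext fun t => ?_⟩, rfl⟩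
      exact (mapDomain_apply_fintype _ _ t).trans (ha S S' hS t)
  rw [h]
  refine isClosed_iInter fun S => isClosed_iInter fun S' => isClosed_iInter fun hS =>
    isClosed_iInter fun t => isClosed_eq ?_ ?_
  · fun_prop
  · fun_prop

instance [IsTopologicalRing R] [CompactSpace R] [T2Space R] :
    CompactSpace (FreeProfinite R X) := by
  have h : Topology.IsClosedEmbedding fun m : FreeProfinite R X =>
      (fun S s => m.1 S s : ∀ S : DiscreteQuotient X, S → R) :=
    ⟨⟨⟨rfl⟩, fun m m' hm => Subtype.ext (funext fun S => Finsupp.ext fun s =>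
      congrFun (congrFun hm S) s)⟩, isClosed_range_coefficients⟩
  exact h.compactSpace

end Topology

section Tree

variable {T : Type*} [TopologicalSpace T] (Γ : ProfiniteGraph T) (R : Type*) [CommRing R]
  {B : Type*} [AddCommGroup B] [Module R B]

lemma boundaryAux_dirac (t : T) :
    Γ.boundaryAux R (dirac R (Γ.toE t)) = dirac R (Γ.d₁ t) - dirac R (Γ.d₀ t) :=
  Subtype.ext (funext fun S => extend_dirac R (Γ.boundaryLC R S) (Γ.toE t))

/-- The function `e ↦ f (d₁ e) - f (d₀ e)` on edges attached to a function `f` on vertices. -/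
noncomputable def coboundary (f : LocallyConstant Γ.V B) : LocallyConstant Γ.E B :=
  (Γ.boundaryLC R f.discreteQuotient).map
    (Finsupp.linearCombination R (f.lift : f.discreteQuotient → B))

lemma coboundary_apply (f : LocallyConstant Γ.V B) (t : T) :
    coboundary Γ R f (Γ.toE t) = f (Γ.d₁ t) - f (Γ.d₀ t) := by
  change Finsupp.linearCombination R (f.lift : f.discreteQuotient → B)
    (Finsupp.single _ 1 - Finsupp.single _ 1) = _
  rw [map_sub, Finsupp.linearCombination_single, Finsupp.linearCombination_single, one_smul,
    one_smul]
  rfl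

/-- The transpose of the boundary map is the coboundary. -/
lemma extend_boundaryAux (f : LocallyConstant Γ.V B) (m : FreeProfinite R Γ.E) :
    extend R f (Γ.boundaryAux R m) = extend R (coboundary Γ R f) m :=
  (extend_map R (Γ.boundaryLC R f.discreteQuotient)
    (Finsupp.linearCombination R (f.lift : f.discreteQuotient → B)) m).symm

lemma exists_boundaryAux_eq
    (hex : Function.Exact (Γ.boundary R) (augmentation R (X := Γ.V))) (v w : Γ.V) :
    ∃ m, Γ.boundaryAux R m = dirac R v - dirac R w := by
  have h : augmentation R (dirac R v - dirac R w) = 0 := by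
    rw [map_sub, augmentation, extend_dirac, extend_dirac]
    exact sub_self _
  obtain ⟨q, hq⟩ := (hex _).1 h
  obtain ⟨m, rfl⟩ := Submodule.Quotient.mk_surjective _ q
  exact ⟨m, hq⟩

lemma eq_of_coboundary_eq_zero
    (hex : Function.Exact (Γ.boundary R) (augmentation R (X := Γ.V))) {f : Γ.V → B}
    (hf : IsLocallyConstant f) (h : ∀ t, f (Γ.d₁ t) = f (Γ.d₀ t)) (v w : Γ.V) : f v = f w := by
  obtain ⟨m, hm⟩ := exists_boundaryAux_eq Γ R hex v w
  have h0 : coboundary Γ R ⟨f, hf⟩ = LocallyConstant.map (0 : B →ₗ[R] B)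
      (coboundary Γ R ⟨f, hf⟩) := by
    ext e
    obtain ⟨t, rfl⟩ := Quotient.exists_rep e
    refine (coboundary_apply Γ R ⟨f, hf⟩ t).trans (sub_eq_zero.2 (h t))
  have h1 := extend_boundaryAux Γ R ⟨f, hf⟩ m
  rw [hm, map_sub, extend_dirac, extend_dirac, h0, extend_map] at h1
  exact sub_eq_zero.1 h1

variable [CompactSpace T] [T2Space T] [TopologicalSpace R] [IsTopologicalRing R] [CompactSpace R]
  [T2Space R]

/-- Since `d` is a homeomorphism onto the kernel of the augmentation, and since `v ↦ v - v₀` is a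
continuous map to that kernel, every locally constant function `g` on edges is the coboundary of
`v ↦ g (d⁻¹ (v - v₀))`. Compactness makes this function locally constant. -/
lemma exists_coboundary_eq (hinj : Function.Injective (Γ.boundary R))
    (hex : Function.Exact (Γ.boundary R) (augmentation R (X := Γ.V)))
    (hB : ∀ b : B, IsLocallyConstant fun r : R => r • b) {g : Γ.E → B}
    (hg : IsLocallyConstant g) (h0 : g Γ.basePoint = 0) :
    ∃ f : Γ.V → B, IsLocallyConstant f ∧ ∀ t, f (Γ.d₁ t) - f (Γ.d₀ t) = g (Γ.toE t) := by
  have : CompactSpace Γ.V := isCompact_iff_compactSpace.1 Γ.isClosed_verts.isCompact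
  let _ : TopologicalSpace B := ⊥
  have : DiscreteTopology B := ⟨rfl⟩
  let v₀ : Γ.V := ⟨_, Γ.nonempty_verts.some_mem⟩
  let ge : FreeProfinite R Γ.E →ₗ[R] B := extend R ⟨g, hg⟩
  have hge : Continuous ge := continuous_extend (fun b => (hB b).continuous) _
  have hge_eq : ∀ m m', Γ.boundaryAux R m = Γ.boundaryAux R m' → ge m = ge m' := by
    intro m m' h
    have hq : Submodule.Quotient.mk (m - m') = (0 : FreeProfinitePointed R Γ.basePoint) := by
      apply hinj
      rw [map_zero]
      change Γ.boundaryAux R (m - m') = 0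
      rw [map_sub, h, sub_self]
    obtain ⟨c, hc⟩ := Submodule.mem_span_singleton.1 ((Submodule.Quotient.mk_eq_zero _).1 hq)
    rw [← sub_eq_zero, ← map_sub, ← hc, map_smul]
    change c • extend R _ _ = 0
    rw [extend_dirac]
    exact (congrArg (c • ·) h0).trans (smul_zero c)
  choose μ hμ using fun v => exists_boundaryAux_eq Γ R hex v v₀
  refine ⟨fun v => ge (μ v), ?_, fun t => ?_⟩
  · -- the graph of `v ↦ d⁻¹ (v - v₀)`, with all representatives modulo the base point, is compact
    let Z : Set (FreeProfinite R Γ.E × Γ.V) :=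
      {p | Γ.boundaryAux R p.1 = dirac R p.2 - dirac R v₀}
    have hZ : IsClosed Z := by
      have hZ' : Z = ⋂ (S : DiscreteQuotient Γ.V) (s : S),
          {p | (Γ.boundaryAux R p.1).1 S s =
            Finsupp.single (S.proj p.2) (1 : R) s - Finsupp.single (S.proj v₀) (1 : R) s} := by
        ext p
        simp only [Set.mem_iInter, Set.mem_ofPred_eq]
        exact ⟨fun h S s => congr(($h).1 S s), fun h =>
          Subtype.ext (funext fun S => Finsupp.ext fun s => h S s)⟩
      rw [hZ']
      refine isClosed_iInter fun S => isClosed_iInter fun s => isClosed_eq ?_ ?_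
      · have h1 : ∀ m, (Γ.boundaryAux R m).1 S s =
            extend R ((Γ.boundaryLC R S).map (Finsupp.lapply (R := R) s)) m := fun m =>
          (extend_map R (Γ.boundaryLC R S) (Finsupp.lapply (R := R) s) m).symm
        simp only [h1]
        exact (continuous_extend (fun c => by fun_prop) _).comp continuous_fst
      · have h2 : IsLocallyConstant fun v => Finsupp.single (S.proj v) (1 : R) s :=
          S.proj_isLocallyConstant.comp fun q => Finsupp.single q (1 : R) s
        exact (h2.continuous.comp continuous_snd).sub continuous_const
    have : CompactSpace Z := isCompact_iff_compactSpace.1 hZ.isCompact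
    have hc : Continuous fun p : Z => p.1.2 := continuous_snd.comp continuous_subtype_val
    have hq : Topology.IsQuotientMap fun p : Z => p.1.2 :=
      hc.isClosedMap.isQuotientMap hc fun v => ⟨⟨(μ v, v), hμ v⟩, rfl⟩
    rw [IsLocallyConstant.iff_continuous, hq.continuous_iff]
    exact (hge.comp (continuous_fst.comp continuous_subtype_val)).congr fun p =>
      hge_eq _ _ (p.2.trans (hμ _).symm)
  · change ge (μ (Γ.d₁ t)) - ge (μ (Γ.d₀ t)) = _
    rw [← map_sub]
    refine (hge_eq _ (dirac R (Γ.toE t)) ?_).trans (extend_dirac R ⟨g, hg⟩ (Γ.toE t))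
    rw [map_sub, hμ, hμ, boundaryAux_dirac]
    abel

end Tree

section ProTree

variable {T : Type*} [TopologicalSpace T] {Γ : ProfiniteGraph T} {π : Set Nat.Primes}
  (hΓ : Γ.IsProTree π) {B : Type*} [AddCommGroup B] (hB : IsPrimary π B)

/-- The subgroup killed by a suitable integer is a module over the pro-`π` integers. -/
lemma exists_module_torsionBy (π : Set Nat.Primes) (B : Type*) [AddCommGroup B] {m : ℕ}
    (hm : 0 < m) (hπ : ∀ p : Nat.Primes, (p : ℕ) ∣ m → p ∈ π) :
    ∃ _ : Module (ZHat π) (nsmulAddMonoidHom (α := B) m).ker,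
      ∀ b : (nsmulAddMonoidHom (α := B) m).ker, IsLocallyConstant fun r : ZHat π => r • b := by
  obtain ⟨ρ, hρ⟩ := exists_zHat_ringHom_zmod π m hm hπ
  let _ : Module (ZMod m) (nsmulAddMonoidHom (α := B) m).ker :=
    AddCommGroup.zmodModule fun b => Subtype.ext b.2
  exact ⟨Module.compHom _ ρ, fun b => hρ.comp fun c : ZMod m => c • b⟩

include hΓ hB in
/-- A locally constant function on the vertices of a pro-`π` tree with values in a `π`-primary group
is constant if it takes the same value at the two ends of each edge. -/
lemma IsProTree.eq_of_coboundary_eq_zero [CompactSpace Γ.V] {f : Γ.V → B}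
    (hf : IsLocallyConstant f) (h : ∀ t, f (Γ.d₁ t) = f (Γ.d₀ t)) (v w : Γ.V) : f v = f w := by
  obtain ⟨m, hm, hmf, hπ⟩ := hB.exists_smul_eq_zero hf
  obtain ⟨_, -⟩ := exists_module_torsionBy π B hm hπ
  have h1 := ProPi.eq_of_coboundary_eq_zero Γ (ZHat π) hΓ.2.1
    (f := fun v => (⟨f v, hmf v⟩ : (nsmulAddMonoidHom (α := B) m).ker))
    (IsLocallyConstant.desc _ Subtype.val hf Subtype.val_injective)
    (fun t => Subtype.ext (h t)) v w
  exact congrArg Subtype.val h1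

include hΓ hB in
/-- On a pro-`π` tree, every locally constant function on edges with values in a `π`-primary group
is a coboundary. -/
lemma IsProTree.exists_coboundary_eq [CompactSpace T] [T2Space T] {g : Γ.E → B}
    (hg : IsLocallyConstant g) (h0 : g Γ.basePoint = 0) :
    ∃ f : Γ.V → B, IsLocallyConstant f ∧ ∀ t, f (Γ.d₁ t) - f (Γ.d₀ t) = g (Γ.toE t) := by
  obtain ⟨m, hm, hmg, hπ⟩ := hB.exists_smul_eq_zero hg
  obtain ⟨_, hcont⟩ := exists_module_torsionBy π B hm hπ
  obtain ⟨f, hf, hfg⟩ := ProPi.exists_coboundary_eq Γ (ZHat π) hΓ.1 hΓ.2.1 hcont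
    (g := fun e => (⟨g e, hmg e⟩ : (nsmulAddMonoidHom (α := B) m).ker))
    (IsLocallyConstant.desc _ Subtype.val hg Subtype.val_injective) (Subtype.ext h0)
  exact ⟨fun v => f v, hf.comp _, fun t => congrArg Subtype.val (hfg t)⟩

end ProTree

section EdgeSpace

/-! ### The spaces of vertices and edges -/

namespace ProfiniteGraph

variable {T : Type*} [TopologicalSpace T] (Γ : ProfiniteGraph T)

instance [CompactSpace T] : CompactSpace Γ.V :=
  isCompact_iff_compactSpace.1 Γ.isClosed_verts.isCompact

lemma isQuotientMap_toE : Topology.IsQuotientMap Γ.toE := isQuotientMap_quot_mk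

section Separation

variable [CompactSpace T] [T2Space T] [TotallyDisconnectedSpace T]

/-- A clopen subset of `T` that does not meet `V(T)` is the preimage of a clopen subset of `T /
V(T)`. -/
lemma exists_isClopen_of_toE_ne {s t : T} (hne : Γ.toE s ≠ Γ.toE t) (ht : t ∉ Γ.verts) :
    ∃ D : Set Γ.E, IsClopen D ∧ Γ.toE t ∈ D ∧ Γ.toE s ∉ D := by
  obtain ⟨C, hC, htC, hCV⟩ := compact_exists_isClopen_in_isOpen
    (Γ.isClosed_verts.union (isClosed_singleton (x := s))).isOpen_compl
    (show t ∈ (Γ.verts ∪ {s})ᶜ by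
      rintro (h | rfl)
      exacts [ht h, hne rfl])
  have hsat : Γ.toE ⁻¹' (Γ.toE '' C) = C := by
    refine Set.Subset.antisymm ?_ (Set.subset_preimage_image _ _)
    rintro x ⟨y, hy, hyx⟩
    rcases Quotient.exact hyx with rfl | ⟨h, -⟩
    · exact hy
    · exact absurd (Or.inl h) (hCV hy)
  refine ⟨Γ.toE '' C, ?_, ⟨t, htC, rfl⟩, fun h => ?_⟩
  · rwa [← Γ.isQuotientMap_toE.isClopen_preimage, hsat]
  · have hs : s ∈ Γ.toE ⁻¹' (Γ.toE '' C) := h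
    rw [hsat] at hs
    exact hCV hs (Or.inr rfl)

instance : TotallySeparatedSpace Γ.E := by
  rw [totallySeparatedSpace_iff_exists_isClopen]
  intro e f hne
  obtain ⟨s, rfl⟩ := Γ.isQuotientMap_toE.surjective e
  obtain ⟨t, rfl⟩ := Γ.isQuotientMap_toE.surjective f
  by_cases hs : s ∈ Γ.verts
  · have ht : t ∉ Γ.verts := fun ht => hne (Γ.toE_eq_of_mem hs ht)
    obtain ⟨D, hD, h, h'⟩ := Γ.exists_isClopen_of_toE_ne hne ht
    exact ⟨Dᶜ, hD.compl, h', fun hc => hc h⟩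
  · obtain ⟨D, hD, h, h'⟩ := Γ.exists_isClopen_of_toE_ne hne.symm hs
    exact ⟨D, hD, h, h'⟩

end Separation

variable {G : Type*} [Group G] [MulAction G T] [Γ.GraphAction G]

lemma smul_basePoint (g : G) : g • Γ.basePoint = Γ.basePoint :=
  Γ.toE_eq_basePoint (Γ.smul_mem_verts g Γ.nonempty_verts.some_mem)

lemma d₀_smul (g : G) (t : T) : Γ.d₀ (g • t) = g • Γ.d₀ t :=
  Subtype.ext (GraphAction.smul_d₀ g t)

lemma d₁_smul (g : G) (t : T) : Γ.d₁ (g • t) = g • Γ.d₁ t :=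
  Subtype.ext (GraphAction.smul_d₁ g t)

variable [TopologicalSpace G] [ContinuousSMul G T]

instance : ContinuousSMul G Γ.V where
  continuous_smul := Continuous.subtype_mk (f := fun p : G × Γ.V => p.1 • (p.2 : T)) (by fun_prop) _

instance [CompactSpace G] [T2Space G] [CompactSpace T] [T2Space T]
    [TotallyDisconnectedSpace T] :
    ContinuousSMul G Γ.E where
  continuous_smul := by
    have hc : Continuous (Prod.map id Γ.toE : G × T → G × Γ.E) :=
      continuous_id.prodMap Γ.isQuotientMap_toE.continuous
    have hq : Topology.IsQuotientMap (Prod.map id Γ.toE : G × T → G × Γ.E) :=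
      hc.isClosedMap.isQuotientMap hc
        (Function.surjective_id.prodMap Γ.isQuotientMap_toE.surjective)
    rw [hq.continuous_iff]
    exact Γ.isQuotientMap_toE.continuous.comp (continuous_smul (M := G) (X := T))

end ProfiniteGraph

end EdgeSpace

section Primary

/-! ### Discrete `π`-primary modules -/

variable {k : Type*} [Ring k] [TopologicalSpace k]
  {G : Type u} [Group G] [TopologicalSpace G] [IsTopologicalGroup G] {π : Set Nat.Primes}
  {A : TopRep.{u} k G}

omit [IsTopologicalGroup G] in
lemma IsDiscretePrimary.isDiscreteRep (hA : IsDiscretePrimary π A) : IsDiscreteRep A :=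
  ⟨hA.discrete, hA.continuous_action⟩

/-- Continuous cochains on a compact group have finitely many values, and so bounded exponent. -/
lemma IsDiscretePrimary.isPrimary_coch [CompactSpace G] (hA : IsDiscretePrimary π A) (n : ℕ) :
    IsPrimary π (Coch A n) := by
  induction n with
  | zero => exact hA.primary
  | succ n ih =>
    intro F
    have := (hA.isDiscreteRep.resolutionX n).discrete
    let F' : C(G, Coch A n) := F
    obtain ⟨m, hm, hF, hπ⟩ :=
      ih.exists_smul_eq_zero ((IsLocallyConstant.iff_continuous F').2 F'.continuous)
    exact ⟨m, hm, ContinuousMap.ext hF, hπ⟩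

end Primary

section TreeSequence

/-! ### The short exact sequence of complexes of a pro-`π` tree -/

variable {T : Type*} [TopologicalSpace T] (Γ : ProfiniteGraph T)

/-- The function `e ↦ Φ (d₁ e) - Φ (d₀ e)` on edges, for a function `Φ` on vertices. -/
def edgeDifference {M : Type*} [AddCommGroup M] (Φ : Γ.V → M) : Γ.E → M :=
  Quotient.lift (fun t => Φ (Γ.d₁ t) - Φ (Γ.d₀ t)) (by
    rintro s t (rfl | ⟨hs, ht⟩)
    · rfl
    · rw [Γ.d₀_vert ⟨s, hs⟩, Γ.d₁_vert ⟨s, hs⟩, Γ.d₀_vert ⟨t, ht⟩, Γ.d₁_vert ⟨t, ht⟩,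
        sub_self, sub_self])

lemma IsLocallyConstant.edgeDifference {M : Type*} [AddCommGroup M] {Φ : Γ.V → M}
    (hΦ : IsLocallyConstant Φ) : IsLocallyConstant (edgeDifference Γ Φ) := fun s =>
  isOpen_coinduced.2 (((hΦ.comp_continuous Γ.d₁.continuous).comp₂
    (hΦ.comp_continuous Γ.d₀.continuous) fun a b => a - b) s)

variable {k : Type*} [Ring k] [TopologicalSpace k]

section

variable {G : Type*} [Group G] [TopologicalSpace G]

/-- The constant functions with invariant value. -/
def constEquivariant (Y : Type*) [TopologicalSpace Y] [MulAction G Y] (R : TopRep k G) :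
    fixedBy R ⊤ →+ equivariantFun Y R where
  toFun a := ⟨fun _ => a, const_mem_equivariantFun a.2⟩
  map_zero' := rfl
  map_add' _ _ := rfl

variable [MulAction G T] [Γ.GraphAction G]

omit [TopologicalSpace G] in
lemma edgeDifference_mem {R : TopRep k G} {Φ : Γ.V → R} (hΦ : Φ ∈ equivariantFun Γ.V R) :
    edgeDifference Γ Φ ∈ equivariantFunPointed Γ.basePoint R := by
  refine ⟨⟨IsLocallyConstant.edgeDifference Γ hΦ.1, fun g e => ?_⟩, ?_⟩
  · obtain ⟨t, rfl⟩ := Quotient.exists_rep e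
    change Φ (Γ.d₁ (g • t)) - Φ (Γ.d₀ (g • t)) = act R g (Φ (Γ.d₁ t) - Φ (Γ.d₀ t))
    rw [Γ.d₀_smul, Γ.d₁_smul, hΦ.2, hΦ.2, map_sub]
  · change Φ (Γ.d₁ _) - Φ (Γ.d₀ _) = 0
    rw [Γ.d₀_vert ⟨_, Γ.nonempty_verts.some_mem⟩, Γ.d₁_vert ⟨_, Γ.nonempty_verts.some_mem⟩,
      sub_self]

/-- The map from equivariant functions on vertices to equivariant functions on edges induced by
`e ↦ d₁ e - d₀ e`. -/
def edgeDifferenceHom (R : TopRep k G) :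
    equivariantFun Γ.V R →+ equivariantFunPointed Γ.basePoint R where
  toFun Φ := ⟨edgeDifference Γ Φ.1, edgeDifference_mem Γ Φ.2⟩
  map_zero' := Subtype.ext (funext fun e => by
    obtain ⟨t, rfl⟩ := Quotient.exists_rep e
    exact sub_self _)
  map_add' Φ Ψ := Subtype.ext (funext fun e => by
    obtain ⟨t, rfl⟩ := Quotient.exists_rep e
    exact add_sub_add_comm _ _ _ _)

omit [TopologicalSpace G] in
lemma constEquivariant_injective (R : TopRep k G) :
    Function.Injective (constEquivariant Γ.V R) := fun _ _ h =>
  Subtype.ext (congrFun (congrArg Subtype.val h) ⟨_, Γ.nonempty_verts.some_mem⟩)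

variable {Γ} {π : Set Nat.Primes}

omit [TopologicalSpace G] in
/-- The kernel of the map to functions on edges consists of the constant functions, whose value is
invariant by equivariance. -/
lemma exact_constEquivariant_edgeDifferenceHom [CompactSpace T] (hΓ : Γ.IsProTree π)
    {R : TopRep k G} (hR : IsPrimary π R) :
    Function.Exact (constEquivariant Γ.V R) (edgeDifferenceHom Γ R) := by
  intro Φ
  constructor
  · intro h
    let v₀ : Γ.V := ⟨_, Γ.nonempty_verts.some_mem⟩
    have hc := IsProTree.eq_of_coboundary_eq_zero hΓ hR Φ.2.1 fun t =>
      sub_eq_zero.1 (congrFun (congrArg Subtype.val h) (Γ.toE t))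
    exact ⟨⟨Φ.1 v₀, fun g _ => by rw [← Φ.2.2]; exact hc _ _⟩,
      Subtype.ext (funext fun v => hc v₀ v)⟩
  · rintro ⟨a, rfl⟩
    refine Subtype.ext (funext fun e => ?_)
    obtain ⟨t, rfl⟩ := Quotient.exists_rep e
    exact sub_self _

end

section

variable {G : Type u} [Group G] [TopologicalSpace G] [IsTopologicalGroup G]
  [MulAction G T] [Γ.GraphAction G] {Γ} {π : Set Nat.Primes} {A : TopRep.{u} k G}

/-- With coefficients in `C(G, X)` an equivariant function on edges is determined by the composite
with evaluation at `1`, an arbitrary locally constant function with values in `X`. That composite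
is the coboundary of a function `χ` on vertices, and `v ↦ (g ↦ g • χ (g⁻¹ • v))` is the equivariant
function attached to `χ`. -/
lemma edgeDifferenceHom_surjective [CompactSpace G] [CompactSpace T] [T2Space T]
    [ContinuousSMul G T] (hΓ : Γ.IsProTree π) (hA : IsDiscretePrimary π A) (n : ℕ) :
    Function.Surjective (edgeDifferenceHom Γ (TopRep.resolutionX A (n + 1))) := by
  intro ψ
  have hX := hA.isDiscreteRep.resolutionX n
  have := hX.discrete
  have : DiscreteTopology C(G, Coch A n) := discreteTopology_continuousMap _ _
  let ψ' : Γ.E → C(G, Coch A n) := ψ.1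
  have hψ' : IsLocallyConstant ψ' := ψ.2.1.1
  have hψ0 : ψ' Γ.basePoint = 0 := ψ.2.2
  obtain ⟨χ, hχ, hχψ⟩ := IsProTree.exists_coboundary_eq hΓ (hA.isPrimary_coch n)
    (g := fun e => ψ' e 1) (hψ'.comp fun F : C(G, Coch A n) => F 1) (by rw [hψ0]; rfl)
  have hc : Continuous fun x : Γ.V × G =>
      (TopRep.resolutionX A n).ρ x.2 (χ (x.2⁻¹ • x.1)) :=
    hX.continuous_action.comp (f := fun x : Γ.V × G => (x.2, χ (x.2⁻¹ • x.1)))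
      (continuous_snd.prodMk (hχ.continuous.comp (by fun_prop)))
  let φ : C(Γ.V, C(G, Coch A n)) := ContinuousMap.curry ⟨_, hc⟩
  have hφ (v : Γ.V) (g : G) : φ v g = act (TopRep.resolutionX A n) g (χ (g⁻¹ • v)) := rfl
  refine ⟨⟨φ, (IsLocallyConstant.iff_continuous _).2 φ.continuous, fun h v =>
    ContinuousMap.ext fun g => ?_⟩, Subtype.ext (funext fun e => ?_)⟩
  · rw [hφ]
    refine Eq.trans ?_ (act_succ_apply A n h (φ v) g).symm
    rw [hφ, ← act_mul, mul_inv_cancel_left, mul_inv_rev, inv_inv, smul_smul]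
  · obtain ⟨t, rfl⟩ := Quotient.exists_rep e
    refine ContinuousMap.ext fun g => ?_
    change φ (Γ.d₁ t) g - φ (Γ.d₀ t) g = ψ' (Γ.toE t) g
    rw [hφ, hφ, ← map_sub, ← Γ.d₁_smul, ← Γ.d₀_smul, hχψ]
    have h1 : ψ' (Γ.toE (g⁻¹ • t)) = act (TopRep.resolutionX A (n + 1)) g⁻¹ (ψ' (Γ.toE t)) :=
      ψ.2.1.2 g⁻¹ (Γ.toE t)
    have h2 : ψ' (Γ.toE (g⁻¹ • t)) 1 =
        act (TopRep.resolutionX A n) g⁻¹ (ψ' (Γ.toE t) (g⁻¹⁻¹ * 1)) := by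
      rw [h1]
      exact act_succ_apply A n g⁻¹ (ψ' (Γ.toE t)) 1
    rw [h2, ← act_mul, mul_inv_cancel, act_one, inv_inv, mul_one]

lemma dEquivariant_constEquivariant (A : TopRep.{u} k G) (Y : Type*) [TopologicalSpace Y]
    [MulAction G Y] (n : ℕ) (a : fixedBy (TopRep.resolutionX A n) ⊤) :
    dEquivariant A Y n (constEquivariant Y _ a) = constEquivariant Y _ (dInvariant A n a) := rfl

lemma dEquivariantPointed_edgeDifferenceHom (Γ : ProfiniteGraph T) [Γ.GraphAction G]
    (A : TopRep.{u} k G) (n : ℕ) (Φ : equivariantFun Γ.V (TopRep.resolutionX A n)) :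
    dEquivariantPointed A Γ.basePoint n (edgeDifferenceHom Γ _ Φ) =
      edgeDifferenceHom Γ _ (dEquivariant A Γ.V n Φ) :=
  Subtype.ext (funext fun e => by
    obtain ⟨t, rfl⟩ := Quotient.exists_rep e
    exact map_sub _ _ _)

end

end TreeSequence

section Naturality

/-! ### Functoriality of the complexes in the coefficients -/

variable {k : Type*} [Ring k] [TopologicalSpace k]
  {G : Type u} [Group G] [TopologicalSpace G] [IsTopologicalGroup G]
  {A B : TopRep.{u} k G} (f : A ⟶ B)

lemma dCoch_coeffCoch (n : ℕ) (F : Coch A n) :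
    dCoch B n (coeffCoch f n F) = coeffCoch f (n + 1) (dCoch A n F) := dCoch_pull _ _ n F

/-- The effect of a morphism of modules on invariant cochains. -/
def coeffInvariant (n : ℕ) :
    fixedBy (TopRep.resolutionX A n) ⊤ →+ fixedBy (TopRep.resolutionX B n) ⊤ where
  toFun F := ⟨coeffCoch f n F, fun g hg => by rw [act_coeffCoch, F.2 g hg]⟩
  map_zero' := Subtype.ext (map_zero (coeffCoch f n))
  map_add' _ _ := Subtype.ext (map_add (coeffCoch f n) _ _)

lemma dInvariant_coeffInvariant (n : ℕ) (F : fixedBy (TopRep.resolutionX A n) ⊤) :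
    dInvariant B n (coeffInvariant f n F) = coeffInvariant f (n + 1) (dInvariant A n F) :=
  Subtype.ext (dCoch_coeffCoch f n F)

/-- The effect of a morphism of modules on equivariant functions. -/
def coeffEquivariant (Y : Type*) [TopologicalSpace Y] [MulAction G Y] (n : ℕ) :
    equivariantFun Y (TopRep.resolutionX A n) →+ equivariantFun Y (TopRep.resolutionX B n) where
  toFun Φ := ⟨fun y => coeffCoch f n (Φ.1 y), Φ.2.1.comp _, fun g y => by
    dsimp only
    rw [act_coeffCoch, Φ.2.2]⟩
  map_zero' := Subtype.ext (funext fun _ => map_zero (coeffCoch f n))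
  map_add' _ _ := Subtype.ext (funext fun _ => map_add (coeffCoch f n) _ _)

/-- The effect of a morphism of modules on equivariant functions that vanish at a point. -/
def coeffPointed {Y : Type*} [TopologicalSpace Y] [MulAction G Y] (y₀ : Y) (n : ℕ) :
    equivariantFunPointed y₀ (TopRep.resolutionX A n) →+
      equivariantFunPointed y₀ (TopRep.resolutionX B n) where
  toFun Φ := ⟨coeffEquivariant f Y n ⟨Φ, Φ.2.1⟩, (coeffEquivariant f Y n ⟨Φ, Φ.2.1⟩).2, by
    change coeffCoch f n (Φ.1 y₀) = 0
    rw [show Φ.1 y₀ = 0 from Φ.2.2, map_zero]⟩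
  map_zero' := Subtype.ext (funext fun _ => map_zero (coeffCoch f n))
  map_add' _ _ := Subtype.ext (funext fun _ => map_add (coeffCoch f n) _ _)

section

variable {Y : Type*} [TopologicalSpace Y] [MulAction G Y]

lemma dEquivariant_coeffEquivariant (n : ℕ) (Φ : equivariantFun Y (TopRep.resolutionX A n)) :
    dEquivariant B Y n (coeffEquivariant f Y n Φ) =
      coeffEquivariant f Y (n + 1) (dEquivariant A Y n Φ) :=
  Subtype.ext (funext fun y => dCoch_coeffCoch f n (Φ.1 y))

lemma dEquivariantPointed_coeffPointed {y₀ : Y} (n : ℕ)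
    (Φ : equivariantFunPointed y₀ (TopRep.resolutionX A n)) :
    dEquivariantPointed B y₀ n (coeffPointed f y₀ n Φ) =
      coeffPointed f y₀ (n + 1) (dEquivariantPointed A y₀ n Φ) :=
  Subtype.ext (funext fun y => dCoch_coeffCoch f n (Φ.1 y))

end

open CohomologyPresentation

lemma coeffMapG_cls (n : ℕ) (z : (dInvariant A (n + 1)).ker) :
    (coeffMapG n f).hom ((groupPresentation A).cls n z) =
      (groupPresentation B).cls n (kerMap (fun n => coeffInvariant f (n + 1))
        (fun n => dInvariant_coeffInvariant f (n + 1)) n z) :=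
  coeffMapG_cochClass f n _

variable [CompactSpace G] [TotallyDisconnectedSpace G]
  {Y : Type*} [TopologicalSpace Y] [MulAction G Y] [CompactSpace Y] [T2Space Y]
  [TotallyDisconnectedSpace Y] [ContinuousSMul G Y] (σ : OrbitSection G Y)
  (hA : IsDiscreteRep A) (hB : IsDiscreteRep B)

lemma contProdMap_cls (n : ℕ) (z : (dEquivariant A Y (n + 1)).ker) :
    contProdMap _ n f ((orbitPresentation σ hA).cls n z) =
      (orbitPresentation σ hB).cls n (kerMap (fun n => coeffEquivariant f Y (n + 1))
        (fun n => dEquivariant_coeffEquivariant f (n + 1)) n z) :=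
  Subtype.ext (funext fun _ => coeffMap_clsK f _ n _)

lemma contProdPointedMap_cls {y₀ : Y} (h₀ : ∀ g : G, g • y₀ = y₀) (n : ℕ)
    (z : (dEquivariantPointed A y₀ (n + 1)).ker) :
    contProdPointedMap _ n (orbitMk G y₀) f ((pointedPresentation σ h₀ hA).cls n z) =
      (pointedPresentation σ h₀ hB).cls n (kerMap (fun n => coeffPointed f y₀ (n + 1))
        (fun n => dEquivariantPointed_coeffPointed f (n + 1)) n z) :=
  Subtype.ext (funext fun _ => coeffMap_clsK f _ n _)

end Naturality

section Sequence

/-! ### The maps of the long exact sequence -/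

variable {G : Type u} [Group G] [TopologicalSpace G] [IsTopologicalGroup G] [CompactSpace G]
  [TotallyDisconnectedSpace G]
  {T : Type v} [TopologicalSpace T] [CompactSpace T] [T2Space T] [TotallyDisconnectedSpace T]
  [MulAction G T] [ContinuousSMul G T] {π : Set Nat.Primes} {Γ : ProfiniteGraph T}
  [Γ.GraphAction G]

open CohomologyPresentation

/-- The continuous product over the vertices, presented by the equivariant functions on them. -/
noncomputable def vertexPresentation (σ : OrbitSection G T) {A : TopRep.{u} ℤ G}
    (hA : IsDiscreteRep A) :
    CohomologyPresentation (fun n => dEquivariant A Γ.V (n + 1)) fun n => VertexProd Γ σ n A :=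
  orbitPresentation (Γ.vertexSection σ) hA

/-- The first map of the sequence, induced by the inclusion of the constant functions. -/
noncomputable def toVertexProd (σ : OrbitSection G T) {A : TopRep.{u} ℤ G} (hA : IsDiscreteRep A)
    (n : ℕ) : continuousCohomology n A →+ VertexProd Γ σ n A :=
  (groupPresentation A).map (vertexPresentation σ hA) (fun _ => constEquivariant Γ.V _)
    (fun n => dEquivariant_constEquivariant A Γ.V (n + 1)) n

/-- The first map of the sequence is given by restriction. -/
lemma toVertexProd_apply (σ : OrbitSection G T) {A : TopRep.{u} ℤ G} (hA : IsDiscreteRep A) (n : ℕ)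
    (c : continuousCohomology n A) (v : OrbitSpace G Γ.V) :
    (toVertexProd σ hA n c).1 v = (resG n (vertexStab Γ σ v) A).hom c := by
  obtain ⟨z, rfl⟩ := (groupPresentation A).cls_surjective n c
  rw [toVertexProd, map_cls]
  exact (resG_cochClass A (vertexStab Γ σ v) n (toInvCocycles A n z)).symm

lemma toVertexProd_coeffMapG (σ : OrbitSection G T) {A B : TopRep.{u} ℤ G} (f : A ⟶ B)
    (hA : IsDiscreteRep A) (hB : IsDiscreteRep B) (n : ℕ) (c : continuousCohomology n A) :
    toVertexProd σ hB n ((coeffMapG n f).hom c) =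
      contProdMap (vertexStab Γ σ) n f (toVertexProd σ hA n c) := by
  obtain ⟨z, rfl⟩ := (groupPresentation A).cls_surjective n c
  rw [coeffMapG_cls, toVertexProd, toVertexProd, map_cls, map_cls]
  exact (contProdMap_cls f (Γ.vertexSection σ) hA hB n (kerMap (fun _ => constEquivariant Γ.V _)
    (fun n => dEquivariant_constEquivariant A Γ.V (n + 1)) n z)).symm

variable [T2Space G]

/-- The continuous product over the edges, presented by the equivariant functions on them that
vanish at the base point. -/
noncomputable def edgePresentation (σ : OrbitSection G T) {A : TopRep.{u} ℤ G}
    (hA : IsDiscreteRep A) :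
    CohomologyPresentation (fun n => dEquivariantPointed A Γ.basePoint (n + 1))
      fun n => EdgeProd Γ σ n A :=
  pointedPresentation (Γ.edgeSection σ) Γ.smul_basePoint hA

/-- The second map of the sequence, induced by the map `Φ ↦ (e ↦ Φ (d₁ e) - Φ (d₀ e))` of
complexes. -/
noncomputable def toEdgeProd (σ : OrbitSection G T) {A : TopRep.{u} ℤ G} (hA : IsDiscreteRep A)
    (n : ℕ) : VertexProd Γ σ n A →+ EdgeProd Γ σ n A :=
  (vertexPresentation σ hA).map (edgePresentation σ hA) (fun _ => edgeDifferenceHom Γ _)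
    (fun n => dEquivariantPointed_edgeDifferenceHom Γ A (n + 1)) n

/-- The third map of the sequence, the connecting homomorphism of the short exact sequence of
complexes. -/
noncomputable def edgeConnecting (σ : OrbitSection G T) (hΓ : Γ.IsProTree π)
    {A : TopRep.{u} ℤ G} (hA : IsDiscretePrimary π A) (n : ℕ) :
    EdgeProd Γ σ n A →+ continuousCohomology (n + 1) A :=
  connecting (groupPresentation A) (vertexPresentation σ hA.isDiscreteRep)
    (edgePresentation σ hA.isDiscreteRep)
    (fun n => dEquivariant_constEquivariant A Γ.V (n + 1))
    (fun n => dEquivariantPointed_edgeDifferenceHom Γ A (n + 1))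
    (fun _ => constEquivariant_injective Γ _)
    (fun n => exact_constEquivariant_edgeDifferenceHom hΓ (hA.isPrimary_coch (n + 1)))
    (edgeDifferenceHom_surjective hΓ hA) n

/-- The second map of the sequence is induced by `e ↦ d₁ e - d₀ e`. -/
lemma toEdgeProd_apply (σ : OrbitSection G T) {A : TopRep.{u} ℤ G} (hA : IsDiscreteRep A) (n : ℕ)
    (s : VertexProd Γ σ n A) (e : OrbitSpace G Γ.E) {t : T} (ht : Γ.toE t = Γ.edgeSection σ e)
    {g₀ g₁ : G} (hg₀ : g₀ • Γ.vertexSection σ (orbitMk G (Γ.d₀ t)) = Γ.d₀ t)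
    (hg₁ : g₁ • Γ.vertexSection σ (orbitMk G (Γ.d₁ t)) = Γ.d₁ t)
    (h₀ : ∀ l ∈ edgeStab Γ σ e, g₀⁻¹ * l * g₀ ∈ vertexStab Γ σ (orbitMk G (Γ.d₀ t)))
    (h₁ : ∀ l ∈ edgeStab Γ σ e, g₁⁻¹ * l * g₁ ∈ vertexStab Γ σ (orbitMk G (Γ.d₁ t))) :
    (toEdgeProd σ hA n s).1 e =
      (conjRes n g₁ h₁ A).hom (s.1 (orbitMk G (Γ.d₁ t))) -
      (conjRes n g₀ h₀ A).hom (s.1 (orbitMk G (Γ.d₀ t))) := by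
  obtain ⟨Φ, rfl⟩ := (vertexPresentation σ hA).cls_surjective n s
  rw [toEdgeProd, map_cls]
  -- the value of the cocycle at `w = g • σ v` is the translate by `g` of its value at `σ v`
  have key : ∀ (w : Γ.V) (g : G), g • Γ.vertexSection σ (orbitMk G w) = w →
      ∀ h : ∀ l ∈ edgeStab Γ σ e, g⁻¹ * l * g ∈ vertexStab Γ σ (orbitMk G w),
      ∃ hw : Φ.1.1 w ∈ invCocycles A (edgeStab Γ σ e) n,
      (conjRes n g h A).hom (((vertexPresentation σ hA).cls n Φ).1 (orbitMk G w)) =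
        clsK A (edgeStab Γ σ e) n ⟨Φ.1.1 w, hw⟩ := by
    intro w g hg h
    have hw : Φ.1.1 w ∈ invCocycles A (edgeStab Γ σ e) n := by
      refine invCocycles_anti A (K := stabilizer G w) ?_ n
        (apply_mem_invCocycles Φ.1.2 (congrFun (congrArg Subtype.val Φ.2)) w)
      intro l hl
      have h1 := mem_stabilizer_iff.1 (h l hl)
      rw [mul_smul, mul_smul, hg, inv_smul_eq_iff, hg] at h1
      exact h1
    refine ⟨hw, conjRes_clsK g h n
      (evalCocycle A n (Γ.vertexSection σ (orbitMk G w)) Φ) ⟨Φ.1.1 w, hw⟩ ?_⟩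
    change Φ.1.1 w = act _ g (Φ.1.1 (Γ.vertexSection σ (orbitMk G w)))
    rw [← Φ.1.2.2, hg]
  obtain ⟨hw₀, e₀⟩ := key _ g₀ hg₀ h₀
  obtain ⟨hw₁, e₁⟩ := key _ g₁ hg₁ h₁
  rw [e₀, e₁, ← map_sub]
  refine congrArg (clsK A (edgeStab Γ σ e) n) (Subtype.ext ?_)
  change edgeDifference Γ Φ.1.1 (Γ.edgeSection σ e) = Φ.1.1 (Γ.d₁ t) - Φ.1.1 (Γ.d₀ t)
  rw [← ht]
  rfl

variable (σ : OrbitSection G T) {A B : TopRep.{u} ℤ G} (f : A ⟶ B)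

lemma toEdgeProd_contProdMap (hA : IsDiscreteRep A) (hB : IsDiscreteRep B) (n : ℕ)
    (s : VertexProd Γ σ n A) :
    toEdgeProd σ hB n (contProdMap (vertexStab Γ σ) n f s) =
      contProdPointedMap (edgeStab Γ σ) n (orbitBasePoint G Γ) f (toEdgeProd σ hA n s) := by
  obtain ⟨z, rfl⟩ := (vertexPresentation σ hA).cls_surjective n s
  have h : contProdMap (vertexStab Γ σ) n f ((vertexPresentation σ hA).cls n z) =
      (vertexPresentation σ hB).cls n _ := contProdMap_cls f (Γ.vertexSection σ) hA hB n z
  rw [h, toEdgeProd, toEdgeProd, map_cls, map_cls]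
  refine Eq.trans ?_
    (contProdPointedMap_cls f (Γ.edgeSection σ) hA hB Γ.smul_basePoint n _).symm
  refine congrArg ((edgePresentation σ hB).cls n) (Subtype.ext (Subtype.ext (funext fun e => ?_)))
  obtain ⟨t, rfl⟩ := Quotient.exists_rep e
  exact (map_sub (coeffCoch f (n + 1)) _ _).symm

lemma edgeConnecting_contProdPointedMap (hΓ : Γ.IsProTree π) (hA : IsDiscretePrimary π A)
    (hB : IsDiscretePrimary π B) (n : ℕ) (s : EdgeProd Γ σ n A) :
    edgeConnecting σ hΓ hB n
        (contProdPointedMap (edgeStab Γ σ) n (orbitBasePoint G Γ) f s) =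
      (coeffMapG (n + 1) f).hom (edgeConnecting σ hΓ hA n s) := by
  obtain ⟨z, rfl⟩ := (edgePresentation σ hA.isDiscreteRep).cls_surjective n s
  obtain ⟨⟨b, a⟩, hb, ha⟩ := exists_snake_lift (vertexPresentation σ hA.isDiscreteRep)
    (fun n => dEquivariant_constEquivariant A Γ.V (n + 1))
    (fun n => dEquivariantPointed_edgeDifferenceHom Γ A (n + 1))
    (fun _ => constEquivariant_injective Γ _)
    (fun n => exact_constEquivariant_edgeDifferenceHom hΓ (hA.isPrimary_coch (n + 1)))
    (edgeDifferenceHom_surjective hΓ hA) n z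
  have h : contProdPointedMap (edgeStab Γ σ) n (orbitBasePoint G Γ) f
      ((edgePresentation σ hA.isDiscreteRep).cls n z) =
      (edgePresentation σ hB.isDiscreteRep).cls n _ :=
    contProdPointedMap_cls f (Γ.edgeSection σ) hA.isDiscreteRep hB.isDiscreteRep
      Γ.smul_basePoint n z
  have h' : edgeConnecting σ hΓ hA n ((edgePresentation σ hA.isDiscreteRep).cls n z) =
      (groupPresentation A).cls (n + 1) a := connecting_cls _ _ _ _ _ _ _ _ hb ha
  rw [h, h', coeffMapG_cls]
  refine connecting_cls _ _ _ _ _ _ _ _ (b := coeffEquivariant f Γ.V (n + 1) b) ?_ ?_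
  · refine Eq.trans (Subtype.ext (funext fun e => ?_))
      (congrArg (coeffPointed f Γ.basePoint (n + 1)) hb)
    obtain ⟨t, rfl⟩ := Quotient.exists_rep e
    exact (map_sub (coeffCoch f (n + 1)) _ _).symm
  · rw [dEquivariant_coeffEquivariant]
    exact congrArg (coeffEquivariant f Γ.V (n + 1 + 1)) ha

end Sequence

end ProPi

theorem mainTheorem3 {G : Type u} [Group G] [TopologicalSpace G] [IsTopologicalGroup G]
    [CompactSpace G] [T2Space G] [TotallyDisconnectedSpace G]
    {T : Type v} [TopologicalSpace T] [CompactSpace T] [T2Space T] [TotallyDisconnectedSpace T]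
    [MulAction G T] [ContinuousSMul G T]
    (π : Set Nat.Primes) (Γ : ProPi.ProfiniteGraph T) [Γ.GraphAction G] (hΓ : Γ.IsProTree π)
    (σ : ProPi.OrbitSection G T) :
    -- the cohomology groups of the stabilizers form étale spaces over `G \ V(T)` and `G \ E*(T)`,
    -- and the continuous products are their groups of continuous global sections
    (∀ (A : TopRep.{u} ℤ G), ProPi.IsDiscretePrimary π A → ∀ n : ℕ,
      (IsLocalHomeomorph (ProPi.EtaleH.proj (ProPi.vertexStab Γ σ) n A) ∧
        ∀ s, s ∈ ProPi.contProd (ProPi.vertexStab Γ σ) n A ↔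
          Continuous (ProPi.EtaleH.ofFamily (ProPi.vertexStab Γ σ) n A s)) ∧
      (IsLocalHomeomorph (ProPi.EtaleH.proj (ProPi.edgeStab Γ σ) n A) ∧
        ∀ s, s ∈ ProPi.contProd (ProPi.edgeStab Γ σ) n A ↔
          Continuous (ProPi.EtaleH.ofFamily (ProPi.edgeStab Γ σ) n A s))) ∧
    -- the maps of the sequence
    ∃ (α : ∀ (A : TopRep.{u} ℤ G), ProPi.IsDiscretePrimary π A → ∀ n : ℕ,
        continuousCohomology n A →+ ProPi.VertexProd Γ σ n A)
      (β : ∀ (A : TopRep.{u} ℤ G), ProPi.IsDiscretePrimary π A → ∀ n : ℕ,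
        ProPi.VertexProd Γ σ n A →+ ProPi.EdgeProd Γ σ n A)
      (δ : ∀ (A : TopRep.{u} ℤ G), ProPi.IsDiscretePrimary π A → ∀ n : ℕ,
        ProPi.EdgeProd Γ σ n A →+ continuousCohomology (n + 1) A),
      -- `α` is given by the restriction maps
      (∀ A hA n c v, (α A hA n c).1 v = (ProPi.resG n (ProPi.vertexStab Γ σ v) A).hom c) ∧
      -- `β` is induced by `e ↦ d₁ e - d₀ e`
      (∀ A hA n s (e : ProPi.OrbitSpace G Γ.E) (t : T), t ∉ Γ.verts →
        Γ.toE t = Γ.edgeSection σ e → ∀ (g₀ g₁ : G),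
        g₀ • Γ.vertexSection σ (ProPi.orbitMk G (Γ.d₀ t)) = Γ.d₀ t →
        g₁ • Γ.vertexSection σ (ProPi.orbitMk G (Γ.d₁ t)) = Γ.d₁ t →
        ∀ (h₀ : ∀ l ∈ ProPi.edgeStab Γ σ e,
            g₀⁻¹ * l * g₀ ∈ ProPi.vertexStab Γ σ (ProPi.orbitMk G (Γ.d₀ t)))
          (h₁ : ∀ l ∈ ProPi.edgeStab Γ σ e,
            g₁⁻¹ * l * g₁ ∈ ProPi.vertexStab Γ σ (ProPi.orbitMk G (Γ.d₁ t))),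
        (β A hA n s).1 e =
          (ProPi.conjRes n g₁ h₁ A).hom (s.1 (ProPi.orbitMk G (Γ.d₁ t))) -
          (ProPi.conjRes n g₀ h₀ A).hom (s.1 (ProPi.orbitMk G (Γ.d₀ t)))) ∧
      -- exactness
      (∀ A hA, Function.Injective (α A hA 0) ∧ ∀ n,
        Function.Exact (α A hA n) (β A hA n) ∧
        Function.Exact (β A hA n) (δ A hA n) ∧
        Function.Exact (δ A hA n) (α A hA (n + 1))) ∧
      -- naturality in the module
      (∀ A hA B hB (f : A ⟶ B) n,
        (∀ c, α B hB n ((ProPi.coeffMapG n f).hom c) =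
          ProPi.contProdMap (ProPi.vertexStab Γ σ) n f (α A hA n c)) ∧
        (∀ s, β B hB n (ProPi.contProdMap (ProPi.vertexStab Γ σ) n f s) =
          ProPi.contProdPointedMap (ProPi.edgeStab Γ σ) n (ProPi.orbitBasePoint G Γ) f
            (β A hA n s)) ∧
        (∀ s, δ B hB n (ProPi.contProdPointedMap (ProPi.edgeStab Γ σ) n
            (ProPi.orbitBasePoint G Γ) f s) =
          (ProPi.coeffMapG (n + 1) f).hom (δ A hA n s))) := by
  refine ⟨fun A hA n => ⟨⟨?_, ?_⟩, ?_, ?_⟩,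
    fun A hA n => ProPi.toVertexProd σ hA.isDiscreteRep n,
    fun A hA n => ProPi.toEdgeProd σ hA.isDiscreteRep n,
    fun A hA n => ProPi.edgeConnecting σ hΓ hA n,
    fun A hA n c v => ProPi.toVertexProd_apply σ hA.isDiscreteRep n c v,
    fun A hA n s e t _ ht g₀ g₁ hg₀ hg₁ h₀ h₁ => ?_,
    fun A hA => ⟨?_, fun n => ⟨?_, ?_, ?_⟩⟩,
    fun A hA B hB f n => ⟨ProPi.toVertexProd_coeffMapG σ f _ _ n,
      ProPi.toEdgeProd_contProdMap σ f _ _ n,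
      ProPi.edgeConnecting_contProdPointedMap σ f hΓ hA hB n⟩⟩
  · exact ProPi.isLocalHomeomorph_etaleH_proj hA.isDiscreteRep
      (Γ.vertexSection σ).isUpperSemicontinuousFamily n
  · exact ProPi.mem_contProd_iff_continuous hA.isDiscreteRep
      (Γ.vertexSection σ).isUpperSemicontinuousFamily
  · exact ProPi.isLocalHomeomorph_etaleH_proj hA.isDiscreteRep
      (Γ.edgeSection σ).isUpperSemicontinuousFamily n
  · exact ProPi.mem_contProd_iff_continuous hA.isDiscreteRep
      (Γ.edgeSection σ).isUpperSemicontinuousFamily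
  · exact ProPi.toEdgeProd_apply σ hA.isDiscreteRep n s e ht hg₀ hg₁ h₀ h₁
  · exact ProPi.CohomologyPresentation.map_zero_injective _ _
      fun _ => ProPi.constEquivariant_injective Γ _
  · exact ProPi.CohomologyPresentation.exact_map_map _ _ _
      (fun _ => ProPi.constEquivariant_injective Γ _)
      (fun n => ProPi.exact_constEquivariant_edgeDifferenceHom hΓ (hA.isPrimary_coch (n + 1)))
      (ProPi.edgeDifferenceHom_surjective hΓ hA) n
  · exact ProPi.CohomologyPresentation.exact_map_connecting _ _ _ _ _ _ _ _ n
  · exact ProPi.CohomologyPresentation.exact_connecting_map _ _ _ _ _ _ _ _ n
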